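/- **Setting.** All spaces $\mathbb{R}^n$ carry the infinity norm. Fix a horizon $T$, a state $s_0$, a nonempty compact set $\mathcal X_0$ of decisions $x_0$, costs $C_t(s_t,x_t,\xi_{[t]},\zeta_t)$, transitions $s_{t+1}=S_t(s_t,x_t,\xi_t,\zeta_t)$ and, for $1\le t\le T$, feasible sets $\mathcal X_t(s_t,x_{t-1},\xi_{[t]})=\{x_t: g_{t,i}(s_t,x_t,x_{t-1},\xi_{[t]})\le 0,\ i\in I_t\}$ with $I_t$ finite. The exogenous process $\xi$ ($\xi_0$ deterministic, $\xi_{[t]}=(\xi_0,\dots,\xi_t)$) is given by conditional distributions of $\xi_{t+1}$ given $\xi_{[t]}$. The endogenous variables $\zeta_0,\dots,\zeta_T$ are independent of each other and of $\xi$, with $\zeta_t\sim P_t$; $\tilde\zeta$ is a perturbation of $\zeta$ with independent $\tilde\zeta_t\sim\tilde P_t$. All $P_t,\tilde P_t$ have finite first moment, and $d_K(P,Q)=\sup\{\int f\,dP-\int f\,dQ: f \text{ is } 1\text{-Lipschitz}\}$ is the Kantorovich metric. The value functions are, with $v_{T+1}=0$, $$v_t(s_{t-1},x_{t-1},\xi_{[t]},\zeta_{t-1})=\min_{x_t\in\mathcal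 X_t(s_t,x_{t-1},\xi_{[t]})}\mathbb E_{\zeta_t}\big[C_t(s_t,x_t,\xi_{[t]},\zeta_t)+\mathbb E_{\xi_{t+1}|\xi_{[t]}}v_{t+1}(s_t,x_t,\xi_{[t+1]},\zeta_t)\big],$$ where $s_t=S_{t-1}(s_{t-1},x_{t-1},\xi_{t-1},\zeta_{t-1})$, and the optimal value is $\vartheta(\zeta)=\min_{x_0\in\mathcal X_0}\mathbb E_{\zeta_0}[C_0(s_0,x_0,\xi_0,\zeta_0)+\mathbb E_{\xi_1}v_1(s_0,x_0,\xi_{[1]},\zeta_0)]$. For a realization of $(\xi,\zeta)$ let $\mathcal X^*(\zeta)$ be the set of vectors $(x_0,\dots,x_T)$ such that $x_0$ and each $x_t$, given $(s_t,x_{t-1},\xi_{[t]})$, attain these minima along the realization. $\vartheta(\tilde\zeta)$ and $\mathcal X^*(\tilde\zeta)$ are defined in the same way from $\tilde P_t$. A feasible policy is a family of measurable functions $x_t$ of $(\xi_{[t]},\zeta_0,\dots,\zeta_{t-1})$ satisfying all constraints. **Assumptions.** $C_t,S_t,g_{t,i}$ are continuous, and $g_{t,i}$ is convex in $x_t$.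 The sets $\mathcal X_t(\cdot)$, $1\le t\le T$, lie in bounded sets $\mathcal X_t^0$ and have diameter at most $A$. There is $\rho>0$ such that for all $t\ge1$ and all $(s_t,x_{t-1},\xi_{[t]})$ some $\bar x_t$ satisfies $g_{t,i}(s_t,\bar x_t,x_{t-1},\xi_{[t]})\le-\rho$ for all $i$. $C_t$ ($0\le t\le T$) and $S_t$ ($0\le t<T$) are Lipschitz in $(s_t,x_t,\zeta_t)$ with moduli $L_{C,t}$, $L_{S,t}$, and $g_{t,i}$ ($1\le t\le T$) is Lipschitz in $(s_t,x_{t-1})$ with modulus $L_{g,t}$ (with respect to the sum of the norms, uniformly in the other arguments). For $\zeta$ and for $\tilde\zeta$, some feasible policy has integrable costs at all stages. Put $L_C=\max_{0\le t\le T}L_{C,t}$, $L_S=\max_{0\le t<T}L_{S,t}$, $L_{X,t}=\frac A\rho L_{g,t}$, $L_{T+1}=0$, $L_t=(L_{C,t}+L_{t+1})(L_S+L_{X,t}+L_{X,t}L_S)$ and $$\hat L_t=L_CL_S+L_CL_{X,t}L_S+L_C+L_{t+1}L_S+L_{t+1}L_{X,t}L_S .$$ **(i)** $\displaystyle |\vartheta(\zeta)-\vartheta(\tilde\zeta)|\le\sum_{t=0}^{T-1}\hat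 L_{t+1}\,d_K(P_t,\tilde P_t)+L_C\,d_K(P_T,\tilde P_T).$ **(ii)** For every $\beta>0$ there are constants $H_t$, $L_{X,k,t}$, depending only on $T,\beta,\rho,A$ and the Lipschitz moduli, such that the following holds. Suppose that $$\mathbb E_{\xi,\zeta}\Big[\sum_{t=0}^TC_t(s_t^{\bm x},x_t,\xi_{[t]},\zeta_t)\Big]-\vartheta(\zeta)\ \ge\ \beta\,\mathbb E_{\xi,\zeta}\big[d(\bm x,\mathcal X^*(\zeta))\big]\quad\text{for all feasible policies }\bm x,$$ where $s_t^{\bm x}$ are the states generated by $\bm x$, and that the same condition holds for $\tilde\zeta$ in place of $\zeta$. Then $$\mathbb E_{\xi,\zeta,\tilde\zeta}\big[\mathbb H(\mathcal X^*(\zeta),\mathcal X^*(\tilde\zeta))\big]\le\sum_{t=0}^{T}\Big(H_t+\sum_{k=t+1}^{T}L_{X,k,t}\Big)d_K(P_t,\tilde P_t),$$ where $\mathbb H$ is the Hausdorff distance and the expectation is taken with the pairs $(\zeta_t,\tilde\zeta_t)$ independent of each other and of $\xi$, each pair being any coupling of $P_t$ and $\tilde P_t$ with $\mathbb E\|\zeta_t-\tilde\zeta_t\|=d_K(P_t,\tilde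 P_t)$. -/

import Mathlib

open MeasureTheory ProbabilityTheory

noncomputable section

namespace MspMdp

/-- `ℝⁿ` with the infinity norm. -/
abbrev Vec (n : ℕ) : Type := Fin n → ℝ

/-- Kantorovich metric: supremum of `∫ f dμ - ∫ f dν` over all functions `f` with Lipschitz
modulus at most one (used for measures with finite first moment). -/
def kantorovich {n : ℕ} (μ ν : Measure (Vec n)) : ℝ :=
  sSup {r : ℝ | ∃ f : Vec n → ℝ, LipschitzWith 1 f ∧ r = ∫ z, f z ∂μ - ∫ z, f z ∂ν}

/-- `π` is a coupling of `μ` and `ν` that realizes their Kantorovich distance. -/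
structure IsOptimalCoupling {n : ℕ} (π : Measure (Vec n × Vec n)) (μ ν : Measure (Vec n)) :
    Prop where
  fst_eq : π.map Prod.fst = μ
  snd_eq : π.map Prod.snd = ν
  cost_eq : ∫ p, ‖p.1 - p.2‖ ∂π = kantorovich μ ν

/-- Data of an integrated MSP-MDP problem, except for the horizon and for the distributions of the
endogenous variables. Stages are numbered from `0`; data of stages after the horizon `T` are never
used. The exogenous process is given by its conditional distributions; `ξ₀` is the
(deterministic) initial piece `ξ_[0]` of its history. -/
structure Model where
  /-- dimension of the state `s_t` -/
  dS : ℕ → ℕ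
  /-- dimension of the decision `x_t` -/
  dX : ℕ → ℕ
  /-- dimension of the exogenous variable `ξ_t` -/
  dE : ℕ → ℕ
  /-- dimension of the endogenous variable `ζ_t` -/
  dZ : ℕ → ℕ
  /-- number of constraints at stage `t` -/
  nI : ℕ → ℕ
  s₀ : Vec (dS 0)
  ξ₀ : (i : Finset.Iic 0) → Vec (dE i)
  /-- feasible set of the decision at stage `0` -/
  X₀ : Set (Vec (dX 0))
  /-- cost `C_t(s_t, x_t, ξ_[t], ζ_t)` -/
  C : (t : ℕ) → Vec (dS t) → Vec (dX t) → ((i : Finset.Iic t) → Vec (dE i)) → Vec (dZ t) → ℝ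
  /-- transition `s_{t+1} = S_t(s_t, x_t, ξ_t, ζ_t)` -/
  S : (t : ℕ) → Vec (dS t) → Vec (dX t) → Vec (dE t) → Vec (dZ t) → Vec (dS (t + 1))
  /-- `g t i` is the `i`-th constraint function `g_{t+1,i}(s_{t+1}, x_{t+1}, x_t, ξ_[t+1])` of
  stage `t + 1` -/
  g : (t : ℕ) → Fin (nI (t + 1)) → Vec (dS (t + 1)) → Vec (dX (t + 1)) → Vec (dX t) →
    ((i : Finset.Iic (t + 1)) → Vec (dE i)) → ℝ
  /-- conditional distribution of `ξ_{t+1}` given `ξ_[t]` -/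
  κ : (t : ℕ) → Kernel ((i : Finset.Iic t) → Vec (dE i)) (Vec (dE (t + 1)))
  markov : ∀ t, IsMarkovKernel (κ t)

namespace Model

variable (M : Model)

instance (t : ℕ) : IsMarkovKernel (M.κ t) := M.markov t

/-- Exogenous histories `ξ_[t]`. -/
abbrev Hist (t : ℕ) : Type := (i : Finset.Iic t) → Vec (M.dE i)

/-- Paths of decisions, of the exogenous process and of the endogenous process. -/
abbrev DecPath : Type := (t : ℕ) → Vec (M.dX t)
abbrev ExoPath : Type := (t : ℕ) → Vec (M.dE t)
abbrev EndoPath : Type := (t : ℕ) → Vec (M.dZ t)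

/-- The history `ξ_[t]` of an exogenous path. -/
def hist (t : ℕ) (ξ : M.ExoPath) : M.Hist t := (Finset.Iic t).restrict ξ

/-- `ξ_[t+1] = (ξ_[t], ξ_{t+1})`. -/
def snoc {t : ℕ} (h : M.Hist t) (e : Vec (M.dE (t + 1))) : M.Hist (t + 1) :=
  IicProdIoc (X := fun i ↦ Vec (M.dE i)) t (t + 1)
    (h, MeasurableEquiv.piSingleton (X := fun i ↦ Vec (M.dE i)) t e)

/-- The value `ξ_t` in the history `ξ_[t]`. -/
def last {t : ℕ} (h : M.Hist t) : Vec (M.dE t) := h ⟨t, Finset.mem_Iic.2 le_rfl⟩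

/-- Feasible set `𝒳_{t+1}(s_{t+1}, x_t, ξ_[t+1])` of stage `t + 1`. -/
def feas (t : ℕ) (s : Vec (M.dS (t + 1))) (x : Vec (M.dX t)) (h : M.Hist (t + 1)) :
    Set (Vec (M.dX (t + 1))) :=
  {y | ∀ i, M.g t i s y x h ≤ 0}

/-- The states generated by a path of decisions along a realization of `(ξ, ζ)`. -/
def state (x : M.DecPath) (ξ : M.ExoPath) (ζ : M.EndoPath) : (t : ℕ) → Vec (M.dS t)
  | 0 => M.s₀
  | t + 1 => M.S t (state x ξ ζ t) (x t) (ξ t) (ζ t)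

/-! ### The nested problem -/

/-- `costToGo P k t s x ξ_[t]`: expected cost of the stages `t, …, t + k` when at stage `t` the
state is `s` and the decision is `x`, and later decisions are optimal, for `ζ_j ∼ P j`:
`E_{ζ_t}[C_t(s, x, ξ_[t], ζ_t) + E_{ξ_{t+1} | ξ_[t]}[v_{t+1}(s, x, ξ_[t+1], ζ_t)]]`, where
`v_{t+1}(s, x, ξ_[t+1], ζ_t)` is the minimum over `y ∈ 𝒳_{t+1}(s_{t+1}, x, ξ_[t+1])`,
`s_{t+1} = S_t(s, x, ξ_t, ζ_t)`, of the cost to go of stage `t + 1`; after the last stage (`k = 0`)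
there is no `v`. -/
def costToGo (P : (t : ℕ) → Measure (Vec (M.dZ t))) :
    ℕ → (t : ℕ) → Vec (M.dS t) → Vec (M.dX t) → M.Hist t → ℝ
  | 0, t, s, x, h => ∫ z, M.C t s x h z ∂(P t)
  | k + 1, t, s, x, h =>
    ∫ z, (M.C t s x h z +
      ∫ e, sInf ((fun y ↦ costToGo P k (t + 1) (M.S t s x (M.last h) z) y (M.snoc h e)) ''
        M.feas t (M.S t s x (M.last h) z) x (M.snoc h e)) ∂(M.κ t h)) ∂(P t)

/-- Optimal value `ϑ(ζ)` for `ζ_t ∼ P t`, `t = 0, …, T`. -/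
def optVal (T : ℕ) (P : (t : ℕ) → Measure (Vec (M.dZ t))) : ℝ :=
  sInf ((fun x ↦ M.costToGo P T 0 M.s₀ x M.ξ₀) '' M.X₀)

/-- The set `𝒳^*(ζ)` along a realization of `(ξ, ζ)`: the decision vectors `(x_0, …, x_T)` that
solve the nested problem, i.e. `x_0` is optimal at stage `0` and each later `x_t` is optimal for
the problem of stage `t` given `(s_t, x_{t-1}, ξ_[t])`. -/
def optSet (T : ℕ) (P : (t : ℕ) → Measure (Vec (M.dZ t))) (ξ : M.ExoPath) (ζ : M.EndoPath) :
    Set ((t : Finset.Iic T) → Vec (M.dX t)) :=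
  (Finset.Iic T).restrict '' {x : M.DecPath |
    (x 0 ∈ M.X₀ ∧
      ∀ y ∈ M.X₀, M.costToGo P T 0 M.s₀ (x 0) M.ξ₀ ≤ M.costToGo P T 0 M.s₀ y M.ξ₀) ∧
    ∀ t < T,
      x (t + 1) ∈ M.feas t (M.state x ξ ζ (t + 1)) (x t) (M.hist (t + 1) ξ) ∧
      ∀ y ∈ M.feas t (M.state x ξ ζ (t + 1)) (x t) (M.hist (t + 1) ξ),
        M.costToGo P (T - (t + 1)) (t + 1) (M.state x ξ ζ (t + 1)) (x (t + 1))
            (M.hist (t + 1) ξ) ≤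
          M.costToGo P (T - (t + 1)) (t + 1) (M.state x ξ ζ (t + 1)) y (M.hist (t + 1) ξ)}

/-! ### Policies -/

/-- Distribution of the exogenous process. -/
def exoLaw : Measure M.ExoPath := Kernel.traj (X := fun i ↦ Vec (M.dE i)) M.κ 0 M.ξ₀

/-- Joint distribution of `(ξ, ζ)`: the `ζ_t ∼ P t` are independent of each other and of `ξ`. -/
def law (P : (t : ℕ) → Measure (Vec (M.dZ t))) [∀ t, IsProbabilityMeasure (P t)] :
    Measure (M.ExoPath × M.EndoPath) :=
  M.exoLaw.prod (Measure.infinitePi P)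

/-- Measurable nonanticipative policies: `x_t` is a function of `ξ_[t]` and
`ζ_0, …, ζ_{t-1}`. -/
structure Policy where
  toFun : (t : ℕ) → M.Hist t × ((i : Finset.Iio t) → Vec (M.dZ i)) → Vec (M.dX t)
  measurable : ∀ t, Measurable (toFun t)

variable {M} in
/-- Decisions of a policy along a realization of `(ξ, ζ)`. -/
def Policy.path (x : M.Policy) (ξ : M.ExoPath) (ζ : M.EndoPath) : M.DecPath :=
  fun t ↦ x.toFun t (M.hist t ξ, (Finset.Iio t).restrict ζ)

variable {M} in
/-- Feasibility of a policy up to stage `T`. -/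
def Policy.IsFeasible (x : M.Policy) (T : ℕ) : Prop :=
  ∀ ξ ζ, x.path ξ ζ 0 ∈ M.X₀ ∧
    ∀ t < T, x.path ξ ζ (t + 1) ∈
      M.feas t (M.state (x.path ξ ζ) ξ ζ (t + 1)) (x.path ξ ζ t) (M.hist (t + 1) ξ)

/-- Cost `C_t(s_t^x, x_t, ξ_[t], ζ_t)` of a path of decisions at stage `t`. -/
def stageCost (x : M.DecPath) (ξ : M.ExoPath) (ζ : M.EndoPath) (t : ℕ) : ℝ :=
  M.C t (M.state x ξ ζ t) (x t) (M.hist t ξ) (ζ t)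

/-- Expected total cost of a policy. -/
def expCost (T : ℕ) (P : (t : ℕ) → Measure (Vec (M.dZ t))) [∀ t, IsProbabilityMeasure (P t)]
    (x : M.Policy) : ℝ :=
  ∫ ω, ∑ t ∈ Finset.range (T + 1), M.stageCost (x.path ω.1 ω.2) ω.1 ω.2 t ∂(M.law P)

/-- First-order growth condition with constant `β`: for all feasible policies `x`, the expected
cost of `x` exceeds the optimal value by at least `β E[d(x, 𝒳^*(ζ))]`. -/
def Growth (T : ℕ) (P : (t : ℕ) → Measure (Vec (M.dZ t))) [∀ t, IsProbabilityMeasure (P t)]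
    (β : ℝ) : Prop :=
  ∀ x : M.Policy, x.IsFeasible T →
    ENNReal.ofReal β * ∫⁻ ω, ENNReal.ofReal (Metric.infDist
        ((Finset.Iic T).restrict (x.path ω.1 ω.2)) (M.optSet T P ω.1 ω.2)) ∂(M.law P) ≤
      ENNReal.ofReal (M.expCost T P x - M.optVal T P)

end Model

/-! ### Assumptions and constants -/

/-- Moduli: `LC t`, `LS t`, `Lg t` are Lipschitz moduli of `C_t`, `S_t`, `g_{t,i}`; `A` bounds the
diameters of the feasible sets; `ρ` is the constant in Slater's condition. -/
structure Moduli where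
  LC : ℕ → ℝ
  LS : ℕ → ℝ
  Lg : ℕ → ℝ
  A : ℝ
  ρ : ℝ
  LC_nonneg : ∀ t, 0 ≤ LC t
  LS_nonneg : ∀ t, 0 ≤ LS t
  Lg_nonneg : ∀ t, 0 ≤ Lg t
  ρ_pos : 0 < ρ

namespace Moduli

variable (c : Moduli)

/-- `L_C`, the maximum of `LC t` for `t = 0, …, T`. -/
def maxC (T : ℕ) : ℝ := ⨆ t : Fin (T + 1), c.LC t

/-- `L_S`, the maximum of `LS t` for `t = 0, …, T - 1`. -/
def maxS (T : ℕ) : ℝ := ⨆ t : Fin T, c.LS t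

/-- Lipschitz modulus `A L_{g,t} / ρ` of the feasible set of stage `t`. -/
def LX (t : ℕ) : ℝ := c.A / c.ρ * c.Lg t

/-- Auxiliary recursion for `LV`; `k` is the number of stages `t, …, T`. -/
def LVaux (T : ℕ) : ℕ → ℕ → ℝ
  | 0, _ => 0
  | k + 1, t => (c.LC t + LVaux T k (t + 1)) * (c.maxS T + c.LX t + c.LX t * c.maxS T)

/-- The constants `L_t` with `L_{T+1} = 0` and
`L_t = (L_{C,t} + L_{t+1}) (L_S + L_{X,t} + L_{X,t} L_S)` for `t ≤ T`. -/
def LV (T t : ℕ) : ℝ := c.LVaux T (T + 1 - t) t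

/-- `L̂_t = L_C L_S + L_C L'_{X,t} + L_C + L_{t+1} L_S + L_{t+1} L'_{X,t}`, where
`L'_{X,t} = L_{X,t} L_S` is the Lipschitz modulus of the feasible set of stage `t` with respect
to `ζ_{t-1}`. -/
def Lhat (T t : ℕ) : ℝ :=
  c.maxC T * c.maxS T + c.maxC T * (c.LX t * c.maxS T) + c.maxC T +
    c.LV T (t + 1) * c.maxS T + c.LV T (t + 1) * (c.LX t * c.maxS T)

end Moduli

/-- Assumptions on the functions and feasible sets of the model with horizon `T`. -/
structure Regular (M : Model) (T : ℕ) (c : Moduli) : Prop where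
  X₀_nonempty : M.X₀.Nonempty
  X₀_compact : IsCompact M.X₀
  C_cont : ∀ t ≤ T, Continuous
    (fun p : Vec (M.dS t) × Vec (M.dX t) × M.Hist t × Vec (M.dZ t) ↦ M.C t p.1 p.2.1 p.2.2.1 p.2.2.2)
  S_cont : ∀ t < T, Continuous
    (fun p : Vec (M.dS t) × Vec (M.dX t) × Vec (M.dE t) × Vec (M.dZ t) ↦
      M.S t p.1 p.2.1 p.2.2.1 p.2.2.2)
  g_cont : ∀ t < T, ∀ i, Continuous
    (fun p : Vec (M.dS (t + 1)) × Vec (M.dX (t + 1)) × Vec (M.dX t) × M.Hist (t + 1) ↦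
      M.g t i p.1 p.2.1 p.2.2.1 p.2.2.2)
  /-- the feasible sets of a stage lie in a common bounded set -/
  bounded : ∀ t < T, ∃ B : Set (Vec (M.dX (t + 1))), Bornology.IsBounded B ∧
    ∀ s x h, M.feas t s x h ⊆ B
  diam_le : ∀ t < T, ∀ s x h, ∀ y ∈ M.feas t s x h, ∀ y' ∈ M.feas t s x h, ‖y - y'‖ ≤ c.A
  slater : ∀ t < T, ∀ s x h, ∃ y, ∀ i, M.g t i s y x h ≤ -c.ρ
  g_convex : ∀ t < T, ∀ i s x h, ConvexOn ℝ Set.univ (fun y ↦ M.g t i s y x h)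
  C_lip : ∀ t ≤ T, ∀ s s' x x' h z z',
    |M.C t s x h z - M.C t s' x' h z'| ≤ c.LC t * (‖s - s'‖ + ‖x - x'‖ + ‖z - z'‖)
  S_lip : ∀ t < T, ∀ s s' x x' e z z',
    ‖M.S t s x e z - M.S t s' x' e z'‖ ≤ c.LS t * (‖s - s'‖ + ‖x - x'‖ + ‖z - z'‖)
  g_lip : ∀ t < T, ∀ i s s' y x x' h,
    |M.g t i s y x h - M.g t i s' y x' h| ≤ c.Lg (t + 1) * (‖s - s'‖ + ‖x - x'‖)

/-- Integrability: the `ζ_t ∼ P t` have finite first moments and some feasible policy has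
integrable costs at all stages. -/
structure FiniteCost (M : Model) (T : ℕ) (P : (t : ℕ) → Measure (Vec (M.dZ t)))
    [∀ t, IsProbabilityMeasure (P t)] : Prop where
  moment : ∀ t ≤ T, Integrable (fun z ↦ ‖z‖) (P t)
  policy : ∃ x : M.Policy, x.IsFeasible T ∧ ∀ t ≤ T,
    Integrable (fun ω ↦ M.stageCost (x.path ω.1 ω.2) ω.1 ω.2 t) (M.law P)

end MspMdp

end

/-! Both estimates rest on one fact about constraints. If convex constraints with a Slater point of
depth ρ change by δ, a feasible point becomes feasible again after a move of length Aδ/ρ towards the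
Slater point (`exists_feasible_near`). Hence feasible sets are Lipschitz in (s_t, x_{t-1}). Backward
induction then makes the cost to go Lipschitz in state and decision (`lipMeas_costToGo`), and the
integrand of stage t Lipschitz in ζ_t with modulus at most `Lhat` at t + 1 (`abs_stageVal_sub_le`,
`stageVal_modulus_le`).

Part (i) exchanges the laws one stage at a time. The exchange at stage t costs that modulus times
d_K(P_t, P'_t), by Kantorovich duality in its trivial direction. Errors from later stages pass
unamplified through minima over a common set and through averages (`abs_costToGo_sub_le`).

Part (ii) needs the growth condition along single realizations, whereas the hypothesis concerns
expectations. The bridge is the gap of a decision: its cost to go minus the optimal cost to go at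
the same stage. The excess cost of a feasible policy is the sum of its expected gaps
(`expCost_sub_optVal`). The hypothesis therefore says that a control problem, with later gaps as
running cost and -β times the distance from the optimal decisions as terminal reward, has
nonnegative value. Its dynamic program `growthVal` is nonpositive, since zero gaps are always
available, so on optimal prefixes it vanishes almost surely (`ae_growthAt`). One more Bellman step
from an optimal prefix gives β · distance ≤ gap at every single stage (`pathGrowth_of_growthAt`).

Stability is then deterministic. Gaps are Lipschitz in decisions and in ζ, and change by at most
twice the bound of (i) when the laws change. A solution for one problem can be followed stage by
stage: repair feasibility, bound the gap, and use growth to jump to an optimal decision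
(`exists_isOpt_near`). Averaging the resulting Hausdorff bound over optimal couplings turns ‖ζ_t -
ζ̃_t‖ into Kantorovich distances. -/

open MeasureTheory ProbabilityTheory

noncomputable section

namespace MspMdp

open Model

/-! ### Convex constraints with a Slater point -/

section Constraints

variable {ι E : Type*} [NormedAddCommGroup E] [NormedSpace ℝ E]

/-- A point that is feasible for constraints `g` lies close to a point that is feasible for
perturbed convex constraints `g'` satisfying Slater's condition. -/
theorem exists_feasible_near {g g' : ι → E → ℝ} {ρ δ A : ℝ} (hρ : 0 < ρ) (hδ : 0 ≤ δ)
    (hconv : ∀ i, ConvexOn ℝ Set.univ (g' i)) {w : E} (hw : ∀ i, g' i w ≤ -ρ)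
    (hA : ∀ y, (∀ i, g' i y ≤ 0) → ‖y - w‖ ≤ A) {y : E} (hclose : ∀ i, |g i y - g' i y| ≤ δ)
    (hy : ∀ i, g i y ≤ 0) : ∃ y', (∀ i, g' i y' ≤ 0) ∧ ‖y - y'‖ ≤ A / ρ * δ := by
  have hs : 0 < ρ + δ := by linarith
  have hab : ρ / (ρ + δ) + δ / (ρ + δ) = 1 := by field_simp
  -- The weights balance the violation δ at `y` against the slack ρ at `w`: the convexity bound
  -- becomes (ρδ - δρ)/(ρ + δ) = 0.
  set y' := (ρ / (ρ + δ)) • y + (δ / (ρ + δ)) • w with hy'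
  have hfeas : ∀ i, g' i y' ≤ 0 := by
    intro i
    have h1 := (hconv i).2 (Set.mem_univ y) (Set.mem_univ w)
      (show 0 ≤ ρ / (ρ + δ) by positivity) (show 0 ≤ δ / (ρ + δ) by positivity) hab
    have h2 : g' i y ≤ δ := by
      have := (abs_le.1 (hclose i)).1
      linarith [hy i]
    have h3 : (ρ / (ρ + δ)) • g' i y + (δ / (ρ + δ)) • g' i w ≤
        ρ / (ρ + δ) * δ + δ / (ρ + δ) * (-ρ) := by
      simp only [smul_eq_mul]
      gcongr
      exact hw i
    have h4 : ρ / (ρ + δ) * δ + δ / (ρ + δ) * (-ρ) = 0 := by field_simp; ring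
    linarith
  refine ⟨y', hfeas, ?_⟩
  -- The displacement is measured against `y' - w`, not `y - w`: both `y'` and `w` are feasible for
  -- `g'`, so A bounds their distance, while `y` may lie outside.
  have h5 : y - y' = (δ / ρ) • (y' - w) := by
    have : (1 : ℝ) - ρ / (ρ + δ) = δ / (ρ + δ) := by linarith
    have e1 : y - y' = (δ / (ρ + δ)) • (y - w) := by
      rw [hy', ← this, smul_sub, sub_smul, sub_smul]
      simp only [one_smul]
      abel
    have e2 : y' - w = (ρ / (ρ + δ)) • (y - w) := by
      have : (1 : ℝ) - δ / (ρ + δ) = ρ / (ρ + δ) := by linarith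
      rw [hy', ← this, smul_sub, sub_smul, sub_smul]
      simp only [one_smul]
      abel
    rw [e1, e2, smul_smul]
    congr 1
    field_simp
  rw [h5, norm_smul, Real.norm_of_nonneg (by positivity)]
  have := hA y' hfeas
  calc δ / ρ * ‖y' - w‖ ≤ δ / ρ * A := by gcongr
    _ = A / ρ * δ := by ring

/-- Under Slater's condition strictly feasible points are dense among the feasible ones. -/
theorem feasible_subset_closure_strict {g : ι → E → ℝ}
    (hconv : ∀ i, ConvexOn ℝ Set.univ (g i)) {w : E} (hw : ∀ i, g i w < 0) :
    {y | ∀ i, g i y ≤ 0} ⊆ closure {y | ∀ i, g i y < 0} := by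
  intro y hy
  have hlim : Filter.Tendsto (fun r : ℝ ↦ (1 - r) • y + r • w) (nhdsWithin 0 (Set.Ioo 0 1))
      (nhds y) := by
    have : Continuous (fun r : ℝ ↦ (1 - r) • y + r • w) := by fun_prop
    have h := (this.tendsto 0).mono_left (nhdsWithin_le_nhds (s := Set.Ioo (0 : ℝ) 1))
    simpa using h
  have hne : (nhdsWithin (0 : ℝ) (Set.Ioo 0 1)).NeBot := by
    rw [← mem_closure_iff_nhdsWithin_neBot, closure_Ioo (by norm_num)]
    simp
  refine mem_closure_of_tendsto hlim ?_
  filter_upwards [self_mem_nhdsWithin] with r hr i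
  have h1 := (hconv i).2 (Set.mem_univ y) (Set.mem_univ w) (by linarith [hr.2] : 0 ≤ 1 - r)
    hr.1.le (by ring)
  have h2 : (1 - r) • g i y ≤ 0 := mul_nonpos_of_nonneg_of_nonpos (by linarith [hr.2]) (hy i)
  have h3 : r • g i w < 0 := mul_neg_of_pos_of_neg hr.1 (hw i)
  linarith

end Constraints

/-! ### Minimization over parametrized sets -/

section ParamInf

variable {Θ E : Type*} [MeasurableSpace Θ] [TopologicalSpace E] {O F : Θ → Set E} {φ : Θ → E → ℝ}

theorem bddBelow_image_of_compact {F : Set E} {φ : E → ℝ} (hF : IsCompact F)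
    (hφ : Continuous φ) : BddBelow (φ '' F) :=
  (hF.image hφ).bddBelow

/-- A strict sublevel set that meets F is open, so it meets O, and then it meets O at a point of D.
With D countable, events about the infimum become countable unions; F itself may contain no point of
D. -/
theorem sInf_image_lt_iff_dense {O F : Set E} {φ : E → ℝ} {D : Set E} (hD : Dense D)
    (hO : IsOpen O) (hOF : O ⊆ F) (hFO : F ⊆ closure O) (hF : IsCompact F) (hne : F.Nonempty)
    (hφ : Continuous φ) (a : ℝ) :
    sInf (φ '' F) < a ↔ ∃ y ∈ D, y ∈ O ∧ φ y < a := by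
  constructor
  · intro h
    obtain ⟨_, ⟨y, hy, rfl⟩, hya⟩ := exists_lt_of_csInf_lt (hne.image φ) h
    have hopen : IsOpen {z | φ z < a} := isOpen_lt hφ continuous_const
    obtain ⟨z, hz, hzO⟩ := mem_closure_iff.1 (hFO hy) _ hopen hya
    obtain ⟨w, hw, hwD⟩ := hD.inter_open_nonempty _ (hopen.inter hO) ⟨z, hz, hzO⟩
    exact ⟨w, hwD, hw.2, hw.1⟩
  · rintro ⟨y, -, hyO, hya⟩
    exact (csInf_le (bddBelow_image_of_compact hF hφ) ⟨y, hOF hyO, rfl⟩).trans_lt hya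

variable [TopologicalSpace.SeparableSpace E]

theorem measurable_sInf_image (hO : ∀ θ, IsOpen (O θ)) (hOF : ∀ θ, O θ ⊆ F θ)
    (hFO : ∀ θ, F θ ⊆ closure (O θ)) (hF : ∀ θ, IsCompact (F θ)) (hne : ∀ θ, (F θ).Nonempty)
    (hOm : ∀ y, MeasurableSet {θ | y ∈ O θ}) (hφc : ∀ θ, Continuous (φ θ))
    (hφm : ∀ y, Measurable (fun θ ↦ φ θ y)) :
    Measurable (fun θ ↦ sInf (φ θ '' F θ)) := by
  obtain ⟨D, hDc, hD⟩ := TopologicalSpace.exists_countable_dense E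
  refine measurable_of_Iio fun a ↦ ?_
  have : (fun θ ↦ sInf (φ θ '' F θ)) ⁻¹' Set.Iio a =
      ⋃ y ∈ D, {θ | y ∈ O θ} ∩ {θ | φ θ y < a} := by
    ext θ
    simp only [Set.mem_preimage, Set.mem_Iio, Set.mem_iUnion, Set.mem_inter_iff, Set.mem_ofPred_eq,
      exists_prop]
    exact sInf_image_lt_iff_dense hD (hO θ) (hOF θ) (hFO θ) (hF θ) (hne θ) (hφc θ) a
  rw [this]
  exact MeasurableSet.biUnion hDc fun y _ ↦
    (hOm y).inter (measurableSet_lt (hφm y) measurable_const)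

/-- Measurable selection of approximate minimizers. -/
theorem exists_measurable_selection [MeasurableSpace E] (hO : ∀ θ, IsOpen (O θ))
    (hOF : ∀ θ, O θ ⊆ F θ)
    (hFO : ∀ θ, F θ ⊆ closure (O θ)) (hF : ∀ θ, IsCompact (F θ)) (hne : ∀ θ, (F θ).Nonempty)
    (hOm : ∀ y, MeasurableSet {θ | y ∈ O θ}) (hφc : ∀ θ, Continuous (φ θ))
    (hφm : ∀ y, Measurable (fun θ ↦ φ θ y)) {ε : ℝ} (hε : 0 < ε) :
    ∃ σ : Θ → E, Measurable σ ∧ ∀ θ, σ θ ∈ F θ ∧ φ θ (σ θ) ≤ sInf (φ θ '' F θ) + ε := by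
  classical
  rcases isEmpty_or_nonempty Θ with hΘ | ⟨⟨θ₀⟩⟩
  · exact ⟨fun θ ↦ hΘ.elim θ, measurable_of_empty _, fun θ ↦ hΘ.elim θ⟩
  have hE : Nonempty E := ⟨(hne θ₀).some⟩
  have hm := measurable_sInf_image hO hOF hFO hF hne hOm hφc hφm
  -- The selection takes the first point of a dense sequence that is strictly feasible and
  -- ε-optimal. The slack ε is what makes such a point exist.
  let p : Θ → ℕ → Prop := fun θ n ↦ TopologicalSpace.denseSeq E n ∈ O θ ∧
    φ θ (TopologicalSpace.denseSeq E n) < sInf (φ θ '' F θ) + ε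
  have hp : ∀ θ, ∃ n, p θ n := by
    intro θ
    obtain ⟨_, ⟨n, rfl⟩, h⟩ := (sInf_image_lt_iff_dense
      (TopologicalSpace.denseRange_denseSeq E) (hO θ) (hOF θ) (hFO θ) (hF θ) (hne θ) (hφc θ) _).1
      (lt_add_of_pos_right _ hε)
    exact ⟨n, h⟩
  have hpm : ∀ n, MeasurableSet {θ | p θ n} := fun n ↦
    (hOm _).inter (measurableSet_lt (hφm _) (hm.add_const ε))
  refine ⟨fun θ ↦ TopologicalSpace.denseSeq E (Nat.find (hp θ)),
    (measurable_from_nat (f := TopologicalSpace.denseSeq E)).comp (measurable_find hp hpm),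
    fun θ ↦ ?_⟩
  have := Nat.find_spec (hp θ)
  exact ⟨hOF θ this.1, this.2.le⟩

/-- Solvability of a closed relation over a compact set is a measurable event. -/
theorem measurableSet_exists_le_zero {E : Type*} [TopologicalSpace E]
    [TopologicalSpace.PseudoMetrizableSpace E] [SecondCountableTopology E]
    {K : Set E} (hK : IsCompact K) {Φ : E → Θ → ℝ} (hc : ∀ θ, Continuous fun y ↦ Φ y θ)
    (hm : ∀ y, Measurable (Φ y)) : MeasurableSet {θ | ∃ y ∈ K, Φ y θ ≤ 0} := by
  obtain ⟨D, hDc, hD⟩ := TopologicalSpace.exists_countable_dense K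
  have : {θ | ∃ y ∈ K, Φ y θ ≤ 0} = ⋂ n : ℕ, ⋃ y ∈ D, {θ | Φ (y : E) θ < 1 / ((n : ℝ) + 1)} := by
    ext θ
    simp only [Set.mem_ofPred_eq, Set.mem_iInter, Set.mem_iUnion, exists_prop]
    constructor
    · rintro ⟨y, hyK, hy⟩ n
      have hopen : IsOpen {y : K | Φ (y : E) θ < 1 / ((n : ℝ) + 1)} :=
        isOpen_lt ((hc θ).comp continuous_subtype_val) continuous_const
      obtain ⟨w, hw, hwD⟩ := hD.inter_open_nonempty _ hopen
        ⟨⟨y, hyK⟩, hy.trans_lt (by positivity)⟩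
      exact ⟨w, hwD, hw⟩
    · intro h
      obtain ⟨y, hyD, -⟩ := h 0
      -- Points with values below every 1/(n+1) force the attained minimum over K to be nonpositive.
      obtain ⟨w, hwK, hw⟩ := hK.exists_isMinOn ⟨y, y.2⟩ (hc θ).continuousOn
      refine ⟨w, hwK, ?_⟩
      by_contra! hpos
      obtain ⟨n, hn⟩ := exists_nat_one_div_lt hpos
      obtain ⟨y, -, hy⟩ := h n
      have : Φ w θ ≤ Φ (y : E) θ := hw y.2
      linarith
  rw [this]
  exact MeasurableSet.iInter fun n ↦ MeasurableSet.biUnion hDc fun y _ ↦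
    measurableSet_lt (hm y) measurable_const

end ParamInf

/-- Marginal functions of two minimization problems are close when every feasible point of one has
a feasible point of the other of at most slightly larger cost. -/
theorem sInf_image_le_add {E E' : Type*} {F : Set E} {F' : Set E'} {φ : E → ℝ} {φ' : E' → ℝ}
    {a : ℝ} (hne : F'.Nonempty) (hb : BddBelow (φ '' F))
    (h : ∀ y' ∈ F', ∃ y ∈ F, φ y ≤ φ' y' + a) : sInf (φ '' F) ≤ sInf (φ' '' F') + a := by
  rw [← sub_le_iff_le_add]
  refine le_csInf (hne.image _) ?_
  rintro _ ⟨y', hy', rfl⟩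
  obtain ⟨y, hy, hle⟩ := h y' hy'
  have := csInf_le hb ⟨y, hy, rfl⟩
  linarith

/-! ### Integrals -/

section Integrals

variable {α : Type*} [MeasurableSpace α] {μ : Measure α} [IsProbabilityMeasure μ]

theorem integrable_of_abs_sub_le {f g : α → ℝ} {a : ℝ} (hg : AEStronglyMeasurable g μ)
    (h : ∀ x, |f x - g x| ≤ a) (hf : Integrable f μ) : Integrable g μ := by
  have h1 : Integrable (fun x ↦ |f x| + a) μ := hf.abs.add (integrable_const a)
  refine h1.mono' hg (Filter.Eventually.of_forall fun x ↦ ?_)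
  have := h x
  have h2 := abs_sub_abs_le_abs_sub (g x) (f x)
  rw [abs_sub_comm] at h2
  rw [Real.norm_eq_abs]
  linarith

/-- Integrals of uniformly close functions are close, also if the functions are not integrable. -/
theorem abs_integral_sub_integral_le {f g : α → ℝ} {a : ℝ} (hf : AEStronglyMeasurable f μ)
    (hg : AEStronglyMeasurable g μ) (ha : 0 ≤ a) (h : ∀ x, |f x - g x| ≤ a) :
    |∫ x, f x ∂μ - ∫ x, g x ∂μ| ≤ a := by
  by_cases hfi : Integrable f μ
  · have hgi := integrable_of_abs_sub_le hg h hfi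
    rw [← integral_sub hfi hgi]
    have := norm_integral_le_of_norm_le_const (μ := μ) (f := fun x ↦ f x - g x) (C := a)
      (Filter.Eventually.of_forall h)
    simpa using this
  -- Integrability passes between uniformly close functions, so here neither is integrable and both
  -- integrals are 0 by convention. This lets the cost to go be estimated without integrability at
  -- every state and history.
  · have hgi : ¬ Integrable g μ := fun hgi ↦
      hfi (integrable_of_abs_sub_le hf (fun x ↦ by rw [abs_sub_comm]; exact h x) hgi)
    rw [integral_undef hfi, integral_undef hgi]
    simpa using ha

end Integrals

/-! ### Kantorovich metric -/

section Kantorovich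

variable {n : ℕ} {μ ν : Measure (Vec n)} [IsProbabilityMeasure μ] [IsProbabilityMeasure ν]

theorem integrable_of_lipschitz {f : Vec n → ℝ} {L : ℝ} (hμ : Integrable (fun z ↦ ‖z‖) μ)
    (hf : ∀ z z', |f z - f z'| ≤ L * ‖z - z'‖) : Integrable f μ := by
  have hc : Continuous f := by
    have : LipschitzWith (Real.toNNReal L) f := by
      refine LipschitzWith.of_dist_le_mul fun z z' ↦ ?_
      rw [Real.dist_eq, dist_eq_norm]
      refine (hf z z').trans ?_
      gcongr
      exact Real.le_coe_toNNReal L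
    exact this.continuous
  have h1 : Integrable (fun z ↦ |f 0| + L * ‖z‖) μ := (integrable_const _).add (hμ.const_mul L)
  refine h1.mono' hc.aestronglyMeasurable (Filter.Eventually.of_forall fun z ↦ ?_)
  have := hf z 0
  have h2 := abs_sub_abs_le_abs_sub (f z) (f 0)
  rw [sub_zero] at this
  rw [Real.norm_eq_abs]
  linarith

/-- Without a bound the real supremum would default to 0. A 1-Lipschitz f lies between f(0) - ‖z‖
and f(0) + ‖z‖, and f(0) cancels because both measures have mass one. -/
theorem kantorovich_bddAbove (hμ : Integrable (fun z ↦ ‖z‖) μ) (hν : Integrable (fun z ↦ ‖z‖) ν) :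
    BddAbove {r : ℝ | ∃ f : Vec n → ℝ, LipschitzWith 1 f ∧ r = ∫ z, f z ∂μ - ∫ z, f z ∂ν} := by
  refine ⟨∫ z, ‖z‖ ∂μ + ∫ z, ‖z‖ ∂ν, ?_⟩
  rintro r ⟨f, hf, rfl⟩
  have hl : ∀ z z', |f z - f z'| ≤ 1 * ‖z - z'‖ := fun z z' ↦ by
    simpa [Real.dist_eq, dist_eq_norm] using hf.dist_le_mul z z'
  have h1 : ∫ z, f z ∂μ ≤ ∫ z, (f 0 + ‖z‖) ∂μ := by
    refine integral_mono (integrable_of_lipschitz hμ hl) ((integrable_const _).add hμ) fun z ↦ ?_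
    have := (abs_le.1 (hl z 0)).2
    simp only [sub_zero, one_mul] at this
    linarith
  have h2 : ∫ z, (f 0 - ‖z‖) ∂ν ≤ ∫ z, f z ∂ν := by
    refine integral_mono ((integrable_const _).sub hν) (integrable_of_lipschitz hν hl) fun z ↦ ?_
    have := (abs_le.1 (hl z 0)).1
    simp only [sub_zero, one_mul] at this
    linarith
  rw [integral_add (integrable_const _) hμ] at h1
  rw [integral_sub (integrable_const _) hν] at h2
  simp only [integral_const, probReal_univ, one_smul] at h1 h2
  linarith

theorem kantorovich_nonneg (hμ : Integrable (fun z ↦ ‖z‖) μ) (hν : Integrable (fun z ↦ ‖z‖) ν) :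
    0 ≤ kantorovich μ ν :=
  le_csSup (kantorovich_bddAbove hμ hν) ⟨fun _ ↦ 0, LipschitzWith.const' 0, by simp⟩

theorem integral_sub_integral_le_kantorovich (hμ : Integrable (fun z ↦ ‖z‖) μ)
    (hν : Integrable (fun z ↦ ‖z‖) ν) {f : Vec n → ℝ} {L : ℝ} (hL : 0 ≤ L)
    (hf : ∀ z z', |f z - f z'| ≤ L * ‖z - z'‖) :
    ∫ z, f z ∂μ - ∫ z, f z ∂ν ≤ L * kantorovich μ ν := by
  rcases hL.eq_or_lt with rfl | hL
  -- Modulus 0 does not allow rescaling to a 1-Lipschitz test function; there f is constant.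
  · have : ∀ z, f z = f 0 := fun z ↦ by
      have := hf z 0
      rw [zero_mul] at this
      linarith [abs_nonpos_iff.1 this]
    simp [this]
  have h1 : LipschitzWith 1 (fun z ↦ L⁻¹ * f z) := by
    refine LipschitzWith.of_dist_le_mul fun z z' ↦ ?_
    rw [Real.dist_eq, ← mul_sub, abs_mul, abs_of_pos (inv_pos.2 hL), dist_eq_norm]
    rw [inv_mul_le_iff₀ hL]
    simpa using hf z z'
  have h2 := le_csSup (kantorovich_bddAbove hμ hν) ⟨_, h1, rfl⟩
  rw [integral_const_mul, integral_const_mul, ← mul_sub, inv_mul_le_iff₀ hL] at h2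
  exact h2

theorem abs_integral_sub_integral_le_kantorovich (hμ : Integrable (fun z ↦ ‖z‖) μ)
    (hν : Integrable (fun z ↦ ‖z‖) ν) {f : Vec n → ℝ} {L : ℝ} (hL : 0 ≤ L)
    (hf : ∀ z z', |f z - f z'| ≤ L * ‖z - z'‖) :
    |∫ z, f z ∂μ - ∫ z, f z ∂ν| ≤ L * kantorovich μ ν := by
  refine abs_le.2 ⟨?_, integral_sub_integral_le_kantorovich hμ hν hL hf⟩
  have := integral_sub_integral_le_kantorovich hμ hν (f := fun z ↦ - f z) hL fun z z' ↦ by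
    rw [← abs_neg]
    convert hf z z' using 2
    ring
  rw [integral_neg, integral_neg] at this
  linarith

end Kantorovich

/-! ### Constants -/

namespace Moduli

variable (c : Moduli) {T : ℕ}

theorem LC_le_maxC {t : ℕ} (ht : t ≤ T) : c.LC t ≤ c.maxC T :=
  le_ciSup (f := fun t : Fin (T + 1) ↦ c.LC t) (Set.finite_range _).bddAbove
    ⟨t, Nat.lt_succ_of_le ht⟩

theorem LS_le_maxS {t : ℕ} (ht : t < T) : c.LS t ≤ c.maxS T :=
  le_ciSup (f := fun t : Fin T ↦ c.LS t) (Set.finite_range _).bddAbove ⟨t, ht⟩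

theorem maxC_nonneg : 0 ≤ c.maxC T := Real.iSup_nonneg fun _ ↦ c.LC_nonneg _

theorem maxS_nonneg : 0 ≤ c.maxS T := Real.iSup_nonneg fun _ ↦ c.LS_nonneg _

variable {c}

theorem LX_nonneg (hA : 0 ≤ c.A) (t : ℕ) : 0 ≤ c.LX t :=
  mul_nonneg (div_nonneg hA c.ρ_pos.le) (c.Lg_nonneg t)

theorem LVaux_nonneg (hA : 0 ≤ c.A) (k t : ℕ) : 0 ≤ c.LVaux T k t := by
  induction k generalizing t with
  | zero => exact le_rfl
  | succ k ih =>
    have := c.maxS_nonneg (T := T)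
    have := LX_nonneg hA t
    exact mul_nonneg (add_nonneg (c.LC_nonneg t) (ih _)) (by positivity)

variable (c)

theorem LV_last : c.LV T (T + 1) = 0 := by simp [LV, LVaux]

theorem LV_of_le {t : ℕ} (ht : t ≤ T) :
    c.LV T t = (c.LC t + c.LV T (t + 1)) * (c.maxS T + c.LX t + c.LX t * c.maxS T) := by
  have h : T + 1 - t = (T + 1 - (t + 1)) + 1 := by omega
  rw [LV, h, LVaux, LV]

variable (T) in
/-- Lipschitz modulus of the cost to go of stage `t` with respect to state and decision. -/
def LQ (t : ℕ) : ℝ := c.LC t + c.LV T (t + 1)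

end Moduli

/-! ### Feasible sets -/

namespace Model

variable (M : Model)

/-- Strictly feasible decisions of stage `t + 1`. -/
def strictFeas (t : ℕ) (s : Vec (M.dS (t + 1))) (x : Vec (M.dX t)) (h : M.Hist (t + 1)) :
    Set (Vec (M.dX (t + 1))) :=
  {y | ∀ i, M.g t i s y x h < 0}

/-- Optimal cost to go `v_{t+1}` as a function of `s_{t+1}`, `x_t` and `ξ_[t+1]`. -/
def nextVal (P : (t : ℕ) → Measure (Vec (M.dZ t))) (k t : ℕ) (s : Vec (M.dS (t + 1)))
    (x : Vec (M.dX t)) (h : M.Hist (t + 1)) : ℝ :=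
  sInf ((fun y ↦ M.costToGo P k (t + 1) s y h) '' M.feas t s x h)

/-- Cost of stage `t` plus expected optimal cost of the later stages, given `ζ_t = z`. -/
def stageVal (P : (t : ℕ) → Measure (Vec (M.dZ t))) (k t : ℕ) (s : Vec (M.dS t))
    (x : Vec (M.dX t)) (h : M.Hist t) (z : Vec (M.dZ t)) : ℝ :=
  M.C t s x h z + ∫ e, M.nextVal P k t (M.S t s x (M.last h) z) x (M.snoc h e) ∂(M.κ t h)

theorem costToGo_succ (P : (t : ℕ) → Measure (Vec (M.dZ t))) (k t : ℕ) (s : Vec (M.dS t))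
    (x : Vec (M.dX t)) (h : M.Hist t) :
    M.costToGo P (k + 1) t s x h = ∫ z, M.stageVal P k t s x h z ∂(P t) := rfl

theorem measurable_snoc {t : ℕ} :
    Measurable (fun p : M.Hist t × Vec (M.dE (t + 1)) ↦ M.snoc p.1 p.2) :=
  measurable_IicProdIoc.comp (measurable_fst.prodMk
    ((MeasurableEquiv.measurable _).comp measurable_snd))

theorem measurable_last {t : ℕ} : Measurable (M.last (t := t)) := measurable_pi_apply _

end Model

namespace Regular

variable {M : Model} {T : ℕ} {c : Moduli}

theorem isClosed_feas (hR : Regular M T c)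
    {t : ℕ} (ht : t < T) (s : Vec (M.dS (t + 1))) (x : Vec (M.dX t))
    (h : M.Hist (t + 1)) : IsClosed (M.feas t s x h) := by
  have : M.feas t s x h = ⋂ i, {y | M.g t i s y x h ≤ 0} := by
    ext; simp [Model.feas]
  rw [this]
  refine isClosed_iInter fun i ↦ isClosed_le ?_ continuous_const
  exact (hR.g_cont t ht i).comp (by fun_prop :
    Continuous fun y : Vec (M.dX (t + 1)) ↦ (s, y, x, h))

theorem isCompact_feas (hR : Regular M T c)
    {t : ℕ} (ht : t < T) (s : Vec (M.dS (t + 1))) (x : Vec (M.dX t))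
    (h : M.Hist (t + 1)) : IsCompact (M.feas t s x h) := by
  obtain ⟨B, hB, hsub⟩ := hR.bounded t ht
  exact Metric.isCompact_of_isClosed_isBounded (hR.isClosed_feas ht s x h)
    (hB.subset (hsub s x h))

theorem isOpen_strictFeas (hR : Regular M T c)
    {t : ℕ} (ht : t < T) (s : Vec (M.dS (t + 1))) (x : Vec (M.dX t))
    (h : M.Hist (t + 1)) : IsOpen (M.strictFeas t s x h) := by
  have : M.strictFeas t s x h = ⋂ i, {y | M.g t i s y x h < 0} := by
    ext; simp [Model.strictFeas]
  rw [this]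
  refine isOpen_iInter_of_finite fun i ↦ isOpen_lt ?_ continuous_const
  exact (hR.g_cont t ht i).comp (by fun_prop :
    Continuous fun y : Vec (M.dX (t + 1)) ↦ (s, y, x, h))

theorem _root_.MspMdp.Model.strictFeas_subset (t : ℕ) (s : Vec (M.dS (t + 1))) (x : Vec (M.dX t))
    (h : M.Hist (t + 1)) : M.strictFeas t s x h ⊆ M.feas t s x h := fun _ hy i ↦ (hy i).le

theorem nonempty_feas (hR : Regular M T c)
    {t : ℕ} (ht : t < T) (s : Vec (M.dS (t + 1))) (x : Vec (M.dX t))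
    (h : M.Hist (t + 1)) : (M.feas t s x h).Nonempty := by
  obtain ⟨y, hy⟩ := hR.slater t ht s x h
  exact ⟨y, fun i ↦ (hy i).trans (by linarith [c.ρ_pos])⟩

theorem feas_subset_closure (hR : Regular M T c)
    {t : ℕ} (ht : t < T) (s : Vec (M.dS (t + 1))) (x : Vec (M.dX t))
    (h : M.Hist (t + 1)) : M.feas t s x h ⊆ closure (M.strictFeas t s x h) := by
  obtain ⟨w, hw⟩ := hR.slater t ht s x h
  exact feasible_subset_closure_strict (g := fun i y ↦ M.g t i s y x h)
    (fun i ↦ hR.g_convex t ht i s x h)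
    (w := w) fun i ↦ (hw i).trans_lt (by linarith [c.ρ_pos])

/-- The sign of A is no axiom of `Moduli`: it comes from a nonempty feasible set, hence from the
existence of a stage after 0. At the last stage the constant `LV` is 0 whatever A is, which covers T
= 0. -/
theorem A_nonneg (hR : Regular M T c) {t : ℕ} (ht : t < T) : 0 ≤ c.A := by
  obtain ⟨y, hy⟩ := hR.nonempty_feas ht 0 0 0
  simpa using hR.diam_le t ht 0 0 0 y hy y hy

theorem LX_nonneg (hR : Regular M T c)
    {t : ℕ} (ht : t < T) (u : ℕ) : 0 ≤ c.LX u := Moduli.LX_nonneg (hR.A_nonneg ht) u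

theorem LV_nonneg (hR : Regular M T c) {t : ℕ} (ht : t ≤ T) : 0 ≤ c.LV T (t + 1) := by
  rcases ht.eq_or_lt with rfl | ht
  · rw [c.LV_last]
  · exact Moduli.LVaux_nonneg (hR.A_nonneg ht) _ _

theorem LQ_nonneg (hR : Regular M T c) {t : ℕ} (ht : t ≤ T) : 0 ≤ c.LQ T t :=
  add_nonneg (c.LC_nonneg t) (hR.LV_nonneg ht)

/-- For fixed `y` and history, moving (s, x) changes each constraint by at most Lg(‖s - s'‖ + ‖x -
x'‖). This is the δ of `exists_feasible_near`, with the Slater point taken at the target parameters.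
-/
theorem exists_feas_near (hR : Regular M T c)
    {t : ℕ} (ht : t < T) (s s' : Vec (M.dS (t + 1))) (x x' : Vec (M.dX t))
    (h : M.Hist (t + 1)) {y : Vec (M.dX (t + 1))} (hy : y ∈ M.feas t s x h) :
    ∃ y' ∈ M.feas t s' x' h, ‖y - y'‖ ≤ c.LX (t + 1) * (‖s - s'‖ + ‖x - x'‖) := by
  obtain ⟨w, hw⟩ := hR.slater t ht s' x' h
  have hwf : w ∈ M.feas t s' x' h := fun i ↦ (hw i).trans (by linarith [c.ρ_pos])
  have hδ : 0 ≤ c.Lg (t + 1) * (‖s - s'‖ + ‖x - x'‖) :=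
    mul_nonneg (c.Lg_nonneg _) (by positivity)
  obtain ⟨y', hy', hle⟩ := exists_feasible_near (g := fun i y ↦ M.g t i s y x h)
    (g' := fun i y ↦ M.g t i s' y x' h) c.ρ_pos hδ (fun i ↦ hR.g_convex t ht i s' x' h) hw
    (fun y hy ↦ hR.diam_le t ht s' x' h y hy w hwf)
    (fun i ↦ hR.g_lip t ht i s s' y x x' h) hy
  refine ⟨y', hy', hle.trans_eq ?_⟩
  rw [Moduli.LX]
  ring

/-- The optimal value of a Lipschitz function over the feasible set is Lipschitz. -/
theorem sInf_feas_le (hR : Regular M T c)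
    {t : ℕ} (ht : t < T) {s s' : Vec (M.dS (t + 1))} {x x' : Vec (M.dX t)}
    {h : M.Hist (t + 1)} {φ φ' : Vec (M.dX (t + 1)) → ℝ} (hφ : Continuous φ) {a L : ℝ}
    (hL : 0 ≤ L) (hlip : ∀ y y', φ y ≤ φ' y' + (a + L * ‖y' - y‖)) :
    sInf (φ '' M.feas t s x h) ≤ sInf (φ' '' M.feas t s' x' h) +
      (a + L * (c.LX (t + 1) * (‖s' - s‖ + ‖x' - x‖))) := by
  refine sInf_image_le_add (hR.nonempty_feas ht _ _ _)
    (bddBelow_image_of_compact (hR.isCompact_feas ht _ _ _) hφ) fun y' hy' ↦ ?_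
  obtain ⟨y, hy, hle⟩ := hR.exists_feas_near ht s' s x' x h hy'
  refine ⟨y, hy, (hlip y y').trans ?_⟩
  gcongr

/-- The number `a` absorbs the difference of the objectives, L the displacement of the decision. The
same lemma thus serves for changed parameters, for changed laws and for the auxiliary dynamic
program. -/
theorem abs_sInf_feas_sub_le (hR : Regular M T c) {t : ℕ} (ht : t < T) {s s' : Vec (M.dS (t + 1))}
    {x x' : Vec (M.dX t)} {h : M.Hist (t + 1)} {φ φ' : Vec (M.dX (t + 1)) → ℝ}
    (hφ : Continuous φ) (hφ' : Continuous φ') {a L : ℝ} (hL : 0 ≤ L)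
    (hlip : ∀ y y', |φ y - φ' y'| ≤ a + L * ‖y - y'‖) :
    |sInf (φ '' M.feas t s x h) - sInf (φ' '' M.feas t s' x' h)| ≤
      a + L * (c.LX (t + 1) * (‖s - s'‖ + ‖x - x'‖)) := by
  have h1 := hR.sInf_feas_le (φ' := φ') ht (s := s) (s' := s') (x := x) (x' := x') (h := h) hφ
    (a := a) hL fun y y' ↦ by
      have := (abs_le.1 (hlip y y')).2
      rw [norm_sub_rev y' y]
      linarith
  have h2 := hR.sInf_feas_le (φ' := φ) ht (s := s') (s' := s) (x := x') (x' := x) (h := h) hφ'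
    (a := a) hL fun y y' ↦ by
      have := (abs_le.1 (hlip y' y)).1
      linarith
  rw [norm_sub_rev s' s, norm_sub_rev x' x] at h1
  exact abs_le.2 ⟨by linarith, by linarith⟩

section ParamFeas

variable {Θ : Type*} [MeasurableSpace Θ] {t : ℕ} {s : Θ → Vec (M.dS (t + 1))}
  {x : Θ → Vec (M.dX t)} {h : Θ → M.Hist (t + 1)} {φ : Θ → Vec (M.dX (t + 1)) → ℝ}

theorem measurableSet_strictFeas (hR : Regular M T c) (ht : t < T) (hs : Measurable s)
    (hx : Measurable x) (hh : Measurable h) (y : Vec (M.dX (t + 1))) :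
    MeasurableSet {θ | y ∈ M.strictFeas t (s θ) (x θ) (h θ)} := by
  have : {θ | y ∈ M.strictFeas t (s θ) (x θ) (h θ)} =
      ⋂ i, {θ | M.g t i (s θ) y (x θ) (h θ) < 0} := by
    ext; simp [Model.strictFeas]
  rw [this]
  refine MeasurableSet.iInter fun i ↦ measurableSet_lt ?_ measurable_const
  exact (hR.g_cont t ht i).measurable.comp
    (hs.prodMk (measurable_const.prodMk (hx.prodMk hh)))

theorem measurable_sInf_feas (hR : Regular M T c)
    (ht : t < T) (hs : Measurable s) (hx : Measurable x)
    (hh : Measurable h) (hφc : ∀ θ, Continuous (φ θ)) (hφm : ∀ y, Measurable (fun θ ↦ φ θ y)) :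
    Measurable (fun θ ↦ sInf (φ θ '' M.feas t (s θ) (x θ) (h θ))) :=
  measurable_sInf_image (fun _ ↦ hR.isOpen_strictFeas ht _ _ _)
    (fun _ ↦ M.strictFeas_subset t _ _ _) (fun _ ↦ hR.feas_subset_closure ht _ _ _)
    (fun _ ↦ hR.isCompact_feas ht _ _ _) (fun _ ↦ hR.nonempty_feas ht _ _ _)
    (hR.measurableSet_strictFeas ht hs hx hh) hφc hφm

theorem exists_measurable_selection_feas (hR : Regular M T c)
    (ht : t < T) (hs : Measurable s) (hx : Measurable x)
    (hh : Measurable h) (hφc : ∀ θ, Continuous (φ θ)) (hφm : ∀ y, Measurable (fun θ ↦ φ θ y))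
    {ε : ℝ} (hε : 0 < ε) :
    ∃ σ : Θ → Vec (M.dX (t + 1)), Measurable σ ∧ ∀ θ, σ θ ∈ M.feas t (s θ) (x θ) (h θ) ∧
      φ θ (σ θ) ≤ sInf (φ θ '' M.feas t (s θ) (x θ) (h θ)) + ε :=
  exists_measurable_selection (fun _ ↦ hR.isOpen_strictFeas ht _ _ _)
    (fun _ ↦ M.strictFeas_subset t _ _ _) (fun _ ↦ hR.feas_subset_closure ht _ _ _)
    (fun _ ↦ hR.isCompact_feas ht _ _ _) (fun _ ↦ hR.nonempty_feas ht _ _ _)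
    (hR.measurableSet_strictFeas ht hs hx hh) hφc hφm hε

end ParamFeas

end Regular

/-! ### Regularity of the cost to go -/

namespace Model

variable (M : Model)

/-- `f` is Lipschitz with modulus `L` in state and decision, uniformly in the history, and jointly
measurable. -/
structure LipMeas {t : ℕ} (L : ℝ) (f : Vec (M.dS t) → Vec (M.dX t) → M.Hist t → ℝ) : Prop where
  lip : ∀ s s' x x' h, |f s x h - f s' x' h| ≤ L * (‖s - s'‖ + ‖x - x'‖)
  meas : Measurable (fun p : Vec (M.dS t) × Vec (M.dX t) × M.Hist t ↦ f p.1 p.2.1 p.2.2)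

theorem LipMeas.continuous_right {M : Model} {t : ℕ} {L : ℝ}
    {f : Vec (M.dS t) → Vec (M.dX t) → M.Hist t → ℝ} (hf : M.LipMeas L f) (s : Vec (M.dS t))
    (h : M.Hist t) : Continuous (fun x ↦ f s x h) := by
  have : LipschitzWith (Real.toNNReal L) (fun x ↦ f s x h) := by
    refine LipschitzWith.of_dist_le_mul fun x x' ↦ ?_
    rw [Real.dist_eq, dist_eq_norm]
    refine (hf.lip s s x x' h).trans ?_
    rw [sub_self, norm_zero, zero_add]
    gcongr
    exact Real.le_coe_toNNReal L
  exact this.continuous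

end Model

namespace Regular

variable {M : Model} {T : ℕ} {c : Moduli} {P P' : (t : ℕ) → Measure (Vec (M.dZ t))}

/-- The state acts twice, through the cost to go and through the feasible set; the previous decision
acts only through the feasible set. -/
theorem abs_nextVal_sub_le (hR : Regular M T c) {k t : ℕ} (ht : t < T)
    (hQ : M.LipMeas (c.LQ T (t + 1)) (M.costToGo P k (t + 1))) (s s' : Vec (M.dS (t + 1)))
    (x x' : Vec (M.dX t)) (h : M.Hist (t + 1)) :
    |M.nextVal P k t s x h - M.nextVal P k t s' x' h| ≤
      c.LQ T (t + 1) * (‖s - s'‖ + c.LX (t + 1) * (‖s - s'‖ + ‖x - x'‖)) := by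
  have h1 := hR.abs_sInf_feas_sub_le ht (s := s) (s' := s') (x := x) (x' := x') (h := h)
    (hQ.continuous_right s h) (hQ.continuous_right s' h) (a := c.LQ T (t + 1) * ‖s - s'‖)
    (hR.LQ_nonneg ht) fun y y' ↦ (hQ.lip s s' y y' h).trans_eq (by ring)
  exact h1.trans_eq (by ring)

theorem measurable_nextVal (hR : Regular M T c) {k t : ℕ} (ht : t < T) {L : ℝ}
    (hQ : M.LipMeas L (M.costToGo P k (t + 1))) :
    Measurable (fun p : Vec (M.dS (t + 1)) × Vec (M.dX t) × M.Hist (t + 1) ↦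
      M.nextVal P k t p.1 p.2.1 p.2.2) := by
  have hm (y : Vec (M.dX (t + 1))) : Measurable
      (fun p : Vec (M.dS (t + 1)) × Vec (M.dX t) × M.Hist (t + 1) ↦
        M.costToGo P k (t + 1) p.1 y p.2.2) :=
    hQ.meas.comp (f := fun p : Vec (M.dS (t + 1)) × Vec (M.dX t) × M.Hist (t + 1) ↦
      (p.1, y, p.2.2)) (by fun_prop)
  simp only [Model.nextVal]
  exact hR.measurable_sInf_feas (Θ := Vec (M.dS (t + 1)) × Vec (M.dX t) × M.Hist (t + 1)) ht
    (s := fun p ↦ p.1) (x := fun p ↦ p.2.1) (h := fun p ↦ p.2.2)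
    measurable_fst (measurable_fst.comp measurable_snd) (measurable_snd.comp measurable_snd)
    (fun p ↦ hQ.continuous_right _ _) hm

theorem norm_S_sub_le (hR : Regular M T c) {t : ℕ} (ht : t < T) (s s' : Vec (M.dS t))
    (x x' : Vec (M.dX t)) (e : Vec (M.dE t)) (z z' : Vec (M.dZ t)) :
    ‖M.S t s x e z - M.S t s' x' e z'‖ ≤ c.maxS T * (‖s - s'‖ + ‖x - x'‖ + ‖z - z'‖) :=
  (hR.S_lip t ht s s' x x' e z z').trans (by gcongr; exact c.LS_le_maxS ht)

theorem measurable_nextVal_comp (hR : Regular M T c) {k t : ℕ} (ht : t < T) {L : ℝ}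
    (hQ : M.LipMeas L (M.costToGo P k (t + 1))) :
    Measurable (fun p : (Vec (M.dS t) × Vec (M.dX t) × M.Hist t × Vec (M.dZ t)) ×
        Vec (M.dE (t + 1)) ↦
      M.nextVal P k t (M.S t p.1.1 p.1.2.1 (M.last p.1.2.2.1) p.1.2.2.2) p.1.2.1
        (M.snoc p.1.2.2.1 p.2)) := by
  refine (hR.measurable_nextVal ht hQ).comp (Measurable.prodMk ?_ (Measurable.prodMk ?_ ?_))
  · refine (hR.S_cont t ht).measurable.comp (f := fun p : (Vec (M.dS t) × Vec (M.dX t) × M.Hist t ×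
      Vec (M.dZ t)) × Vec (M.dE (t + 1)) ↦ (p.1.1, p.1.2.1, M.last p.1.2.2.1, p.1.2.2.2)) ?_
    have := M.measurable_last (t := t)
    fun_prop
  · fun_prop
  · exact M.measurable_snoc.comp (by fun_prop : Measurable fun p : (Vec (M.dS t) × Vec (M.dX t) ×
      M.Hist t × Vec (M.dZ t)) × Vec (M.dE (t + 1)) ↦ (p.1.2.2.1, p.2))

theorem measurable_nextVal_section (hR : Regular M T c) {k t : ℕ} (ht : t < T) {L : ℝ}
    (hQ : M.LipMeas L (M.costToGo P k (t + 1))) (s : Vec (M.dS t)) (x : Vec (M.dX t))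
    (h : M.Hist t) (z : Vec (M.dZ t)) : Measurable (fun e ↦
      M.nextVal P k t (M.S t s x (M.last h) z) x (M.snoc h e)) :=
  (hR.measurable_nextVal_comp ht hQ).comp (f := fun e ↦ ((s, x, h, z), e)) (by fun_prop)

theorem measurable_stageVal (hR : Regular M T c) {k t : ℕ} (ht : t < T) {L : ℝ}
    (hQ : M.LipMeas L (M.costToGo P k (t + 1))) :
    Measurable (fun p : Vec (M.dS t) × Vec (M.dX t) × M.Hist t × Vec (M.dZ t) ↦
      M.stageVal P k t p.1 p.2.1 p.2.2.1 p.2.2.2) := by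
  refine (hR.C_cont t ht.le).measurable.add ?_
  have h1 := (hR.measurable_nextVal_comp ht hQ).stronglyMeasurable
  let κ' : Kernel (Vec (M.dS t) × Vec (M.dX t) × M.Hist t × Vec (M.dZ t)) (Vec (M.dE (t + 1))) :=
    (M.κ t).comap (fun p ↦ p.2.2.1) (by fun_prop)
  exact (h1.integral_kernel_prod_right' (κ := κ')).measurable

/-- The next state moves by at most `maxS` times the total displacement, while the decision also
shifts the next feasible set directly. Collecting the coefficient of ‖s - s'‖ + ‖x - x'‖ reproduces
the recursion for L_t; the coefficient of ‖z - z'‖ lacks the bare term `LX`. -/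
theorem abs_stageVal_sub_le (hR : Regular M T c) {k t : ℕ} (ht : t < T)
    (hQ : M.LipMeas (c.LQ T (t + 1)) (M.costToGo P k (t + 1))) (s s' : Vec (M.dS t))
    (x x' : Vec (M.dX t)) (h : M.Hist t) (z z' : Vec (M.dZ t)) :
    |M.stageVal P k t s x h z - M.stageVal P k t s' x' h z'| ≤
      c.LQ T t * (‖s - s'‖ + ‖x - x'‖) +
        (c.LC t + c.LQ T (t + 1) * (c.maxS T + c.LX (t + 1) * c.maxS T)) * ‖z - z'‖ := by
  have hL := hR.LQ_nonneg (t := t + 1) ht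
  have hX := hR.LX_nonneg ht (t + 1)
  have hS := c.maxS_nonneg (T := T)
  set a := ‖s - s'‖ + ‖x - x'‖ with ha
  set b := ‖z - z'‖ with hb
  have ha0 : 0 ≤ a := by positivity
  have hxa : ‖x - x'‖ ≤ a := by rw [ha]; linarith [norm_nonneg (s - s')]
  have h1 : |∫ e, M.nextVal P k t (M.S t s x (M.last h) z) x (M.snoc h e) ∂(M.κ t h) -
      ∫ e, M.nextVal P k t (M.S t s' x' (M.last h) z') x' (M.snoc h e) ∂(M.κ t h)| ≤
      c.LQ T (t + 1) * (c.maxS T * (a + b) + c.LX (t + 1) * (c.maxS T * (a + b) + a)) := by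
    refine abs_integral_sub_integral_le
      (hR.measurable_nextVal_section ht hQ s x h z).aestronglyMeasurable
      (hR.measurable_nextVal_section ht hQ s' x' h z').aestronglyMeasurable (by positivity)
      fun e ↦ ?_
    refine (hR.abs_nextVal_sub_le ht hQ _ _ _ _ _).trans ?_
    have := hR.norm_S_sub_le ht s s' x x' (M.last h) z z'
    rw [← ha, ← hb] at this
    gcongr
  have h2 := hR.C_lip t ht.le s s' x x' h z z'
  rw [← ha, ← hb] at h2
  have h3 : c.LQ T t = c.LC t + c.LQ T (t + 1) *
      (c.maxS T + c.LX (t + 1) + c.LX (t + 1) * c.maxS T) := by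
    rw [Moduli.LQ, c.LV_of_le (show t + 1 ≤ T from ht), Moduli.LQ]
  rw [Model.stageVal, Model.stageVal, add_sub_add_comm]
  refine (abs_add_le _ _).trans ((add_le_add h2 h1).trans_eq ?_)
  rw [h3]
  ring

variable [∀ t, IsProbabilityMeasure (P t)] [∀ t, IsProbabilityMeasure (P' t)]

/-- Lipschitz continuity and measurability go through one backward induction, because measurability
of a minimum over uncountably many decisions uses continuity in the decision. -/
theorem lipMeas_costToGo (hR : Regular M T c)
    {k t : ℕ} (hk : t + k = T) : M.LipMeas (c.LQ T t) (M.costToGo P k t) := by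
  induction k generalizing t with
  | zero =>
    obtain rfl : t = T := by omega
    have hLQ : c.LQ t t = c.LC t := by rw [Moduli.LQ, c.LV_last, add_zero]
    have hm (s x h) : Measurable (M.C t s x h) :=
      (hR.C_cont t le_rfl).measurable.comp (f := fun z ↦ (s, x, h, z)) (by fun_prop)
    refine ⟨fun s s' x x' h ↦ ?_, ?_⟩
    · rw [hLQ]
      refine abs_integral_sub_integral_le (hm s x h).aestronglyMeasurable
        (hm s' x' h).aestronglyMeasurable (mul_nonneg (c.LC_nonneg t) (by positivity)) fun z ↦ ?_
      simpa using hR.C_lip t le_rfl s s' x x' h z z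
    · have h1 : Measurable (fun p : (Vec (M.dS t) × Vec (M.dX t) × M.Hist t) × Vec (M.dZ t) ↦
          M.C t p.1.1 p.1.2.1 p.1.2.2 p.2) :=
        (hR.C_cont t le_rfl).measurable.comp (f := fun p : (Vec (M.dS t) × Vec (M.dX t) ×
          M.Hist t) × Vec (M.dZ t) ↦ (p.1.1, p.1.2.1, p.1.2.2, p.2)) (by fun_prop)
      exact (h1.stronglyMeasurable.integral_prod_right' (ν := P t)).measurable
  | succ k ih =>
    have ht : t < T := by omega
    have hQ := ih (t := t + 1) (by omega)
    have hm := hR.measurable_stageVal ht hQ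
    refine ⟨fun s s' x x' h ↦ ?_, ?_⟩
    · simp only [Model.costToGo_succ]
      refine abs_integral_sub_integral_le
        (hm.comp (f := fun z ↦ (s, x, h, z)) (by fun_prop)).aestronglyMeasurable
        (hm.comp (f := fun z ↦ (s', x', h, z)) (by fun_prop)).aestronglyMeasurable
        (mul_nonneg (hR.LQ_nonneg ht.le) (by positivity)) fun z ↦ ?_
      simpa using hR.abs_stageVal_sub_le ht hQ s s' x x' h z z
    · simp only [Model.costToGo_succ]
      have h1 : Measurable (fun p : (Vec (M.dS t) × Vec (M.dX t) × M.Hist t) × Vec (M.dZ t) ↦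
          M.stageVal P k t p.1.1 p.1.2.1 p.1.2.2 p.2) :=
        hm.comp (f := fun p : (Vec (M.dS t) × Vec (M.dX t) ×
          M.Hist t) × Vec (M.dZ t) ↦ (p.1.1, p.1.2.1, p.1.2.2, p.2)) (by fun_prop)
      exact (h1.stronglyMeasurable.integral_prod_right' (ν := P t)).measurable

/-! ### Dependence of the optimal value on the distributions -/

/-- Only LC at stages t and t + 1 is enlarged to its maximum; `LV` at t + 2 enters unchanged. -/
theorem stageVal_modulus_le (hR : Regular M T c) {t : ℕ} (ht : t < T) :
    c.LC t + c.LQ T (t + 1) * (c.maxS T + c.LX (t + 1) * c.maxS T) ≤ c.Lhat T (t + 1) := by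
  have hX := hR.LX_nonneg ht (t + 1)
  have hS := c.maxS_nonneg (T := T)
  have h1 := c.LC_le_maxC ht.le
  have h2 := c.LC_le_maxC (T := T) (t := t + 1) ht
  have h3 : c.LC (t + 1) * (c.maxS T + c.LX (t + 1) * c.maxS T) ≤
      c.maxC T * (c.maxS T + c.LX (t + 1) * c.maxS T) := by gcongr
  rw [Moduli.Lhat, Moduli.LQ]
  linarith

theorem Lhat_nonneg (hR : Regular M T c) {t : ℕ} (ht : t < T) : 0 ≤ c.Lhat T (t + 1) := by
  have hX := hR.LX_nonneg ht (t + 1)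
  have hS := c.maxS_nonneg (T := T)
  have hL := hR.LQ_nonneg (t := t + 1) ht
  have := c.LC_nonneg t
  exact le_trans (by positivity) (hR.stageVal_modulus_le ht)

/-- Bound for the influence of the distributions of stages `t, …, T` on the cost to go. -/
def _root_.MspMdp.costErr {M : Model} (T : ℕ) (c : Moduli)
    (P P' : (t : ℕ) → Measure (Vec (M.dZ t))) (t : ℕ) : ℝ :=
  ∑ j ∈ Finset.Ico t T, c.Lhat T (j + 1) * kantorovich (P j) (P' j) +
    c.maxC T * kantorovich (P T) (P' T)

theorem costErr_nonneg (hR : Regular M T c) (hP : ∀ t ≤ T, Integrable (fun z ↦ ‖z‖) (P t))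
    (hP' : ∀ t ≤ T, Integrable (fun z ↦ ‖z‖) (P' t)) (t : ℕ) : 0 ≤ costErr T c P P' t := by
  refine add_nonneg (Finset.sum_nonneg fun j hj ↦ ?_)
    (mul_nonneg c.maxC_nonneg (kantorovich_nonneg (hP T le_rfl) (hP' T le_rfl)))
  have hj := (Finset.mem_Ico.1 hj).2
  exact mul_nonneg (hR.Lhat_nonneg hj) (kantorovich_nonneg (hP j hj.le) (hP' j hj.le))

theorem abs_nextVal_sub_nextVal_le (hR : Regular M T c) {k t : ℕ} (hk : t + 1 + k = T) {a : ℝ}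
    (s : Vec (M.dS (t + 1))) (x : Vec (M.dX t)) (h : M.Hist (t + 1))
    (ha : ∀ y, |M.costToGo P k (t + 1) s y h - M.costToGo P' k (t + 1) s y h| ≤ a) :
    |M.nextVal P k t s x h - M.nextVal P' k t s x h| ≤ a := by
  have ht : t < T := by omega
  have hQ := hR.lipMeas_costToGo (P := P) hk
  have hQ' := hR.lipMeas_costToGo (P := P') hk
  have h1 := hR.abs_sInf_feas_sub_le ht (s := s) (s' := s) (x := x) (x' := x) (h := h)
    (hQ.continuous_right s h) (hQ'.continuous_right s h) (a := a)
    (hR.LQ_nonneg (t := t + 1) ht) fun y y' ↦ by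
      have h2 := hQ'.lip s s y y' h
      rw [sub_self, norm_zero, zero_add] at h2
      have := abs_sub_le (M.costToGo P k (t + 1) s y h) (M.costToGo P' k (t + 1) s y h)
        (M.costToGo P' k (t + 1) s y' h)
      linarith [ha y]
  simpa [Model.nextVal] using h1

/-- An intermediate quantity keeps the integrand built from P but integrates it against P'_t. The
first difference is a Lipschitz function tested against two laws; the second is a difference of
integrands, controlled uniformly by induction. -/
theorem abs_costToGo_sub_le (hR : Regular M T c) (hP : ∀ t ≤ T, Integrable (fun z ↦ ‖z‖) (P t))
    (hP' : ∀ t ≤ T, Integrable (fun z ↦ ‖z‖) (P' t)) {k t : ℕ} (hk : t + k = T)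
    (s : Vec (M.dS t)) (x : Vec (M.dX t)) (h : M.Hist t) :
    |M.costToGo P k t s x h - M.costToGo P' k t s x h| ≤ costErr T c P P' t := by
  induction k generalizing t with
  | zero =>
    obtain rfl : t = T := by omega
    simp only [costErr, Finset.Ico_self, Finset.sum_empty, zero_add]
    refine abs_integral_sub_integral_le_kantorovich (hP t le_rfl) (hP' t le_rfl) c.maxC_nonneg
      fun z z' ↦ ?_
    have := hR.C_lip t le_rfl s s x x h z z'
    simp only [sub_self, norm_zero, zero_add] at this
    exact this.trans (by gcongr; exact c.LC_le_maxC le_rfl)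
  | succ k ih =>
    have ht : t < T := by omega
    have hk' : t + 1 + k = T := by omega
    have hQ := hR.lipMeas_costToGo (P := P) hk'
    have hQ' := hR.lipMeas_costToGo (P := P') hk'
    have hz : ∀ z z', |M.stageVal P k t s x h z - M.stageVal P k t s x h z'| ≤
        c.Lhat T (t + 1) * ‖z - z'‖ := fun z z' ↦ by
      have := hR.abs_stageVal_sub_le ht hQ s s x x h z z'
      simp only [sub_self, norm_zero, zero_add, mul_zero] at this
      exact this.trans (by gcongr; exact hR.stageVal_modulus_le ht)
    have h1 := abs_integral_sub_integral_le_kantorovich (hP t ht.le) (hP' t ht.le)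
      (hR.Lhat_nonneg ht) hz
    have hm := hR.measurable_stageVal ht hQ
    have hm' := hR.measurable_stageVal ht hQ'
    have h2 : |∫ z, M.stageVal P k t s x h z ∂(P' t) - ∫ z, M.stageVal P' k t s x h z ∂(P' t)| ≤
        costErr T c P P' (t + 1) := by
      refine abs_integral_sub_integral_le
        (hm.comp (f := fun z ↦ (s, x, h, z)) (by fun_prop)).aestronglyMeasurable
        (hm'.comp (f := fun z ↦ (s, x, h, z)) (by fun_prop)).aestronglyMeasurable
        (hR.costErr_nonneg hP hP' _) fun z ↦ ?_
      -- The immediate costs coincide and cancel, so only the later values differ.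
      rw [Model.stageVal, Model.stageVal, add_sub_add_left_eq_sub]
      exact abs_integral_sub_integral_le
        (hR.measurable_nextVal_section ht hQ s x h z).aestronglyMeasurable
        (hR.measurable_nextVal_section ht hQ' s x h z).aestronglyMeasurable
        (hR.costErr_nonneg hP hP' _) fun e ↦
          hR.abs_nextVal_sub_nextVal_le hk' _ _ _ fun y ↦ ih hk' _ _ _
    simp only [Model.costToGo_succ]
    have h3 : costErr T c P P' t =
        c.Lhat T (t + 1) * kantorovich (P t) (P' t) + costErr T c P P' (t + 1) := by
      rw [costErr, costErr, Finset.sum_eq_sum_Ico_succ_bot ht, add_assoc]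
    rw [h3]
    exact (abs_sub_le _ _ _).trans (add_le_add h1 h2)

theorem abs_optVal_sub_le (hR : Regular M T c) (hP : ∀ t ≤ T, Integrable (fun z ↦ ‖z‖) (P t))
    (hP' : ∀ t ≤ T, Integrable (fun z ↦ ‖z‖) (P' t)) :
    |M.optVal T P - M.optVal T P'| ≤ costErr T c P P' 0 := by
  have hd := fun x ↦ hR.abs_costToGo_sub_le hP hP' (zero_add T) M.s₀ x M.ξ₀
  have hb (Q : (t : ℕ) → Measure (Vec (M.dZ t))) [∀ t, IsProbabilityMeasure (Q t)] :
      BddBelow ((fun x ↦ M.costToGo Q T 0 M.s₀ x M.ξ₀) '' M.X₀) :=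
    bddBelow_image_of_compact hR.X₀_compact
      ((hR.lipMeas_costToGo (P := Q) (zero_add T)).continuous_right _ _)
  have h1 := sInf_image_le_add (a := costErr T c P P' 0) hR.X₀_nonempty (hb P)
    (φ' := fun x ↦ M.costToGo P' T 0 M.s₀ x M.ξ₀)
    fun y hy ↦ ⟨y, hy, by linarith [(abs_le.1 (hd y)).2]⟩
  have h2 := sInf_image_le_add (a := costErr T c P P' 0) hR.X₀_nonempty (hb P')
    (φ' := fun x ↦ M.costToGo P T 0 M.s₀ x M.ξ₀)
    fun y hy ↦ ⟨y, hy, by linarith [(abs_le.1 (hd y)).1]⟩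
  exact abs_le.2 ⟨by unfold Model.optVal; linarith, by unfold Model.optVal; linarith⟩

end Regular

/-! ### One-step disintegration of the law of `(ξ, ζ)` -/

namespace Model

variable (M : Model)

/-- Realizations `(ξ, ζ)`. -/
abbrev Path : Type := M.ExoPath × M.EndoPath

variable {M}

/-- Two realizations have the same `ξ_[t]` and the same `ζ_0, …, ζ_{t-1}`. -/
def Agree (t : ℕ) (ω ω' : M.Path) : Prop :=
  (∀ i ≤ t, ω.1 i = ω'.1 i) ∧ ∀ i < t, ω.2 i = ω'.2 i

theorem Agree.mono {t u : ℕ} (h : t ≤ u) {ω ω' : M.Path} (ha : Agree u ω ω') : Agree t ω ω' :=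
  ⟨fun i hi ↦ ha.1 i (hi.trans h), fun i hi ↦ ha.2 i (hi.trans_le h)⟩

theorem agree_refl (t : ℕ) (ω : M.Path) : Agree t ω ω := ⟨fun _ _ ↦ rfl, fun _ _ ↦ rfl⟩

/-- `f` is a function of `ξ_[t]` and `ζ_0, …, ζ_{t-1}`. -/
def Nonanticipative {α : Type*} (t : ℕ) (f : M.Path → α) : Prop :=
  ∀ ω ω', Agree t ω ω' → f ω = f ω'

theorem Nonanticipative.mono {α : Type*} {t u : ℕ} (h : t ≤ u) {f : M.Path → α}
    (hf : Nonanticipative t f) : Nonanticipative u f := fun ω ω' ha ↦ hf ω ω' (ha.mono h)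

theorem Agree.hist_eq {t : ℕ} {ω ω' : M.Path} (h : Agree t ω ω') :
    M.hist t ω.1 = M.hist t ω'.1 := by
  ext1 i
  exact h.1 i (Finset.mem_Iic.1 i.2)

/-- Replacement of `ξ_{t+1}` and `ζ_t`. -/
def extend (t : ℕ) (ω : M.Path) (p : Vec (M.dE (t + 1)) × Vec (M.dZ t)) : M.Path :=
  (Function.update ω.1 (t + 1) p.1, Function.update ω.2 t p.2)

theorem agree_extend (t : ℕ) (ω : M.Path) (p : Vec (M.dE (t + 1)) × Vec (M.dZ t)) :
    Agree t (extend t ω p) ω :=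
  ⟨fun i hi ↦ Function.update_of_ne (by omega) _ _,
    fun i hi ↦ Function.update_of_ne (by omega) _ _⟩

theorem Agree.extend {t : ℕ} {ω ω' : M.Path} (h : Agree t ω ω')
    (p : Vec (M.dE (t + 1)) × Vec (M.dZ t)) :
    Agree (t + 1) (Model.extend t ω p) (Model.extend t ω' p) := by
  constructor
  · intro i hi
    rcases eq_or_ne i (t + 1) with rfl | hne
    · simp [Model.extend]
    · simpa [Model.extend, hne] using h.1 i (by omega)
  · intro i hi
    rcases eq_or_ne i t with rfl | hne
    · simp [Model.extend]
    · simpa [Model.extend, hne] using h.2 i (by omega)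

theorem measurable_update_prod {ι : Type*} [DecidableEq ι] {X : ι → Type*}
    [∀ i, MeasurableSpace (X i)] (i : ι) :
    Measurable (fun p : (∀ i, X i) × X i ↦ Function.update p.1 i p.2) := by
  refine measurable_pi_iff.2 fun j ↦ ?_
  rcases eq_or_ne j i with rfl | hne
  · simpa using measurable_snd
  · simp only [ne_eq, hne, not_false_eq_true, Function.update_of_ne]
    fun_prop

theorem measurable_extend (t : ℕ) :
    Measurable (fun q : M.Path × (Vec (M.dE (t + 1)) × Vec (M.dZ t)) ↦ extend t q.1 q.2) :=
  ((measurable_update_prod (t + 1)).comp (f := fun q : M.Path × (Vec (M.dE (t + 1)) ×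
      Vec (M.dZ t)) ↦ (q.1.1, q.2.1)) (by fun_prop)).prodMk
    ((measurable_update_prod t).comp (f := fun q : M.Path × (Vec (M.dE (t + 1)) ×
      Vec (M.dZ t)) ↦ (q.1.2, q.2.2)) (by fun_prop))

theorem measurable_hist (t : ℕ) : Measurable (M.hist t) := Finset.measurable_restrict _

theorem snoc_hist (t : ℕ) (ξ : M.ExoPath) (e : Vec (M.dE (t + 1))) :
    M.snoc (M.hist t ξ) e = M.hist (t + 1) (Function.update ξ (t + 1) e) := by
  ext1 ⟨i, hi⟩
  have hi' := Finset.mem_Iic.1 hi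
  rcases eq_or_ne i (t + 1) with rfl | hne
  · simp [snoc, hist, IicProdIoc, MeasurableEquiv.piSingleton]
  · have : i ≤ t := by omega
    simp [snoc, hist, IicProdIoc, this, hne]

/-- Distribution of `(ξ_{t+1}, ζ_t)` given `ξ_[t]`. -/
def stepKernel (P : (t : ℕ) → Measure (Vec (M.dZ t))) (t : ℕ) :
    Kernel M.Path (Vec (M.dE (t + 1)) × Vec (M.dZ t)) :=
  ((M.κ t).comap (fun ω : M.Path ↦ M.hist t ω.1) ((measurable_hist t).comp measurable_fst)) ×ₖ
    Kernel.const _ (P t)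

/-- Realizations with `ξ_i`, `i > t`, and `ζ_i`, `i ≥ t`, replaced by zero. -/
def trunc (t : ℕ) (ω : M.Path) : M.Path :=
  (fun i ↦ if i ≤ t then ω.1 i else 0, fun i ↦ if i < t then ω.2 i else 0)

theorem agree_trunc (t : ℕ) (ω : M.Path) : Agree t (trunc t ω) ω :=
  ⟨fun i hi ↦ by simp [trunc, hi], fun i hi ↦ by simp [trunc, hi]⟩

/-- Extension of a history by zero. -/
def padExo {t : ℕ} (h : M.Hist t) : M.ExoPath :=
  fun i ↦ if hi : i ≤ t then h ⟨i, Finset.mem_Iic.2 hi⟩ else 0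

theorem measurable_padExo {t : ℕ} : Measurable (padExo (M := M) (t := t)) := by
  refine measurable_pi_iff.2 fun i ↦ ?_
  by_cases hi : i ≤ t
  · simp only [padExo, hi, dite_true]
    exact measurable_pi_apply _
  · simp only [padExo, hi, dite_false]
    exact measurable_const

/-- Extension of `ζ_0, …, ζ_{t-1}` by zero. -/
def padEndo {t : ℕ} (z : (i : Finset.Iio t) → Vec (M.dZ i)) : M.EndoPath :=
  fun i ↦ if hi : i < t then z ⟨i, Finset.mem_Iio.2 hi⟩ else 0

theorem measurable_padEndo {t : ℕ} : Measurable (padEndo (M := M) (t := t)) := by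
  refine measurable_pi_iff.2 fun i ↦ ?_
  by_cases hi : i < t
  · simp only [padEndo, hi, dite_true]
    exact measurable_pi_apply _
  · simp only [padEndo, hi, dite_false]
    exact measurable_const

theorem trunc_eq_pad (t : ℕ) (ω : M.Path) :
    trunc t ω = (padExo (M.hist t ω.1), padEndo ((Finset.Iio t).restrict ω.2)) := by
  ext1
  · ext1 i
    by_cases hi : i ≤ t <;> simp [trunc, padExo, hist, hi]
  · ext1 i
    by_cases hi : i < t <;> simp [trunc, padEndo, hi]

theorem measurable_restrict_Iio (t : ℕ) :
    Measurable (fun ζ : M.EndoPath ↦ padEndo ((Finset.Iio t).restrict ζ)) :=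
  measurable_padEndo.comp (Finset.measurable_restrict _)

theorem measurable_trunc (t : ℕ) : Measurable (trunc (M := M) t) := by
  simp only [funext (trunc_eq_pad t)]
  exact (measurable_padExo.comp ((measurable_hist t).comp measurable_fst)).prodMk
    ((measurable_restrict_Iio t).comp measurable_snd)

/-- Independent resampling of one coordinate preserves a product measure. Finite boxes determine the
measure, and on them the resampled coordinate contributes the factor it had before. -/
theorem lintegral_infinitePi_update {ι : Type*} [DecidableEq ι] {X : ι → Type*}
    [∀ i, MeasurableSpace (X i)] (μ : (i : ι) → Measure (X i)) [∀ i, IsProbabilityMeasure (μ i)]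
    (i : ι) {f : (∀ i, X i) → ENNReal} (hf : Measurable f) :
    ∫⁻ x, ∫⁻ z, f (Function.update x i z) ∂(μ i) ∂(Measure.infinitePi μ) =
      ∫⁻ x, f x ∂(Measure.infinitePi μ) := by
  have hm := measurable_update_prod (X := X) i
  have h : ((Measure.infinitePi μ).prod (μ i)).map (fun p ↦ Function.update p.1 i p.2) =
      Measure.infinitePi μ := by
    refine Measure.eq_infinitePi _ fun s t ht ↦ ?_
    rw [Measure.map_apply hm (MeasurableSet.pi s.countable_toSet fun i _ ↦ ht i)]
    by_cases hi : i ∈ s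
    · have : (fun p : (∀ i, X i) × X i ↦ Function.update p.1 i p.2) ⁻¹' (Set.pi s t) =
          (Set.pi (s.erase i) t) ×ˢ (t i) := by
        ext p
        simp only [Set.mem_preimage, Set.mem_pi, Finset.mem_coe, Set.mem_prod, Finset.mem_erase]
        constructor
        · intro h
          refine ⟨fun j hj ↦ by simpa [hj.1] using h j hj.2, by simpa using h i hi⟩
        · rintro ⟨h1, h2⟩ j hj
          rcases eq_or_ne j i with rfl | hne
          · simpa using h2
          · simpa [hne] using h1 j ⟨hne, hj⟩
      rw [this, Measure.prod_prod, Measure.infinitePi_pi _ fun i _ ↦ ht i,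
        Finset.prod_erase_mul _ _ hi]
    · have : (fun p : (∀ i, X i) × X i ↦ Function.update p.1 i p.2) ⁻¹' (Set.pi s t) =
          (Set.pi s t) ×ˢ Set.univ := by
        ext p
        simp only [Set.mem_preimage, Set.mem_pi, Finset.mem_coe, Set.mem_prod, Set.mem_univ,
          and_true]
        refine forall₂_congr fun j hj ↦ ?_
        rw [Function.update_of_ne (by rintro rfl; exact hi hj)]
      rw [this, Measure.prod_prod, Measure.infinitePi_pi _ fun i _ ↦ ht i, measure_univ, mul_one]
  conv_rhs => rw [← h]
  rw [lintegral_map hf hm]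
  exact (lintegral_prod _ (hf.comp hm).aemeasurable).symm

instance : IsProbabilityMeasure M.exoLaw := by unfold exoLaw; infer_instance

theorem lintegral_exoLaw_hist (t : ℕ) {F : M.Hist (t + 1) → ENNReal} (hF : Measurable F) :
    ∫⁻ ξ, ∫⁻ e, F (M.snoc (M.hist t ξ) e) ∂(M.κ t (M.hist t ξ)) ∂M.exoLaw =
      ∫⁻ ξ, F (M.hist (t + 1) ξ) ∂M.exoLaw := by
  have h1 := Kernel.partialTraj_compProd_eq_map_traj (X := fun i ↦ Vec (M.dE i)) (κ := M.κ)
    (Nat.zero_le t) (x₀ := M.ξ₀)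
  rw [← Kernel.traj_map_frestrictLe_apply] at h1
  have hm : Measurable (fun p : M.Hist t × Vec (M.dE (t + 1)) ↦ F (M.snoc p.1 p.2)) :=
    hF.comp M.measurable_snoc
  have h2 : ∀ ξ : M.ExoPath, M.hist (t + 1) ξ = M.snoc (M.hist t ξ) (ξ (t + 1)) := fun ξ ↦ by
    rw [snoc_hist, Function.update_eq_self]
  have hfr : (Preorder.frestrictLe (π := fun i ↦ Vec (M.dE i)) t) = M.hist t := rfl
  rw [hfr] at h1
  have h3 := congrArg (fun μ ↦ ∫⁻ p : M.Hist t × Vec (M.dE (t + 1)), F (M.snoc p.1 p.2) ∂μ) h1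
  rw [Measure.lintegral_compProd hm, lintegral_map (hm.lintegral_kernel_prod_right')
    (measurable_hist t), lintegral_map hm
      ((measurable_hist t).prodMk (measurable_pi_apply (t + 1)))] at h3
  simp only [h2]
  exact h3

variable (P : (t : ℕ) → Measure (Vec (M.dZ t))) [∀ t, IsProbabilityMeasure (P t)]

instance (t : ℕ) : IsMarkovKernel (stepKernel P t) := by unfold stepKernel; infer_instance

instance : IsProbabilityMeasure (M.law P) := by unfold law; infer_instance

theorem stepKernel_apply (t : ℕ) (ω : M.Path) :
    stepKernel P t ω = (M.κ t (M.hist t ω.1)).prod (P t) := by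
  rw [stepKernel, Kernel.prod_apply, Kernel.comap_apply, Kernel.const_apply]

/-- Tower property for the pair (ξ_{t+1}, ζ_t). The coordinates of ξ beyond t + 1 are not redrawn
from the new ξ_{t+1}, which is harmless because `f` does not see them. Resampling ζ_t needs only
independence. -/
theorem lintegral_law_extend (t : ℕ) {f : M.Path → ENNReal} (hf : Measurable f)
    (hna : Nonanticipative (t + 1) f) :
    ∫⁻ ω, ∫⁻ p, f (extend t ω p) ∂(stepKernel P t ω) ∂(M.law P) = ∫⁻ ω, f ω ∂(M.law P) := by
  have hfe := hf.comp (measurable_extend (M := M) t)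
  have hF : ∀ ω : M.Path, f ω = f (padExo (M.hist (t + 1) ω.1), ω.2) := fun ω ↦ by
    refine hna _ _ ⟨fun i hi ↦ ?_, fun i hi ↦ rfl⟩
    simp [padExo, hist, hi]
  have hG : Measurable fun h : M.Hist (t + 1) ↦
      ∫⁻ ζ, f (padExo h, ζ) ∂(Measure.infinitePi P) := by
    refine Measurable.lintegral_prod_right' (f := fun p : M.Hist (t + 1) × M.EndoPath ↦
      f (padExo p.1, p.2)) ?_
    exact hf.comp ((measurable_padExo.comp measurable_fst).prodMk measurable_snd)
  have hL : ∫⁻ ω, f ω ∂(M.law P) =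
      ∫⁻ ξ, ∫⁻ ζ, f (padExo (M.hist (t + 1) ξ), ζ) ∂(Measure.infinitePi P) ∂M.exoLaw := by
    rw [law, lintegral_prod _ hf.aemeasurable]
    simp only [← hF (_, _)]
  rw [hL, ← lintegral_exoLaw_hist t hG, law, lintegral_prod]
  · refine lintegral_congr fun ξ ↦ ?_
    have h1 : ∀ ζ : M.EndoPath, ∫⁻ p, f (extend t (ξ, ζ) p) ∂(stepKernel P t (ξ, ζ)) =
        ∫⁻ e, ∫⁻ z, f (Function.update ξ (t + 1) e, Function.update ζ t z) ∂(P t)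
          ∂(M.κ t (M.hist t ξ)) := fun ζ ↦ by
      rw [stepKernel_apply, lintegral_prod]
      · rfl
      · exact (hfe.comp (f := fun p ↦ ((ξ, ζ), p)) (by fun_prop)).aemeasurable
    simp only [h1]
    -- With ξ_{t+1} fixed outside, ζ_t is resampled inside the product law of ζ.
    rw [lintegral_lintegral_swap]
    · refine lintegral_congr fun e ↦ ?_
      rw [lintegral_infinitePi_update P t (f := fun ζ ↦ f (Function.update ξ (t + 1) e, ζ))
        (hf.comp (by fun_prop))]
      refine lintegral_congr fun ζ ↦ ?_
      rw [hF, snoc_hist]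
    · refine Measurable.aemeasurable ?_
      refine Measurable.lintegral_prod_right' (f := fun q : (M.EndoPath × Vec (M.dE (t + 1))) ×
        Vec (M.dZ t) ↦ f (Function.update ξ (t + 1) q.1.2, Function.update q.1.1 t q.2)) ?_
      exact hfe.comp (f := fun q : (M.EndoPath × Vec (M.dE (t + 1))) ×
        Vec (M.dZ t) ↦ ((ξ, q.1.1), (q.1.2, q.2))) (by fun_prop)
  · exact (hfe.lintegral_kernel_prod_right' (κ := stepKernel P t)).aemeasurable

/-- Equality of pushforwards transfers integrability and Bochner integrals at once, which the
identity for nonnegative functions alone would not. -/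
theorem map_law_eq (t : ℕ) {α : Type*} [MeasurableSpace α] {f : M.Path → α} (hf : Measurable f)
    (hna : Nonanticipative (t + 1) f) :
    ((M.law P) ⊗ₘ (stepKernel P t)).map (fun q ↦ f (extend t q.1 q.2)) = (M.law P).map f := by
  ext s hs
  have hfe := hf.comp (measurable_extend (M := M) t)
  have h := lintegral_law_extend P t (f := fun ω ↦ s.indicator 1 (f ω))
    ((measurable_one.indicator hs).comp hf) fun ω ω' ha ↦ by simp only [hna ω ω' ha]
  have hi : Measurable (s.indicator (1 : α → ENNReal)) := measurable_one.indicator hs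
  rw [← Measure.lintegral_compProd
    (f := fun q : M.Path × (Vec (M.dE (t + 1)) × Vec (M.dZ t)) ↦
      s.indicator 1 (f (extend t q.1 q.2))) (hi.comp hfe)] at h
  rw [← lintegral_map (f := s.indicator 1) (g := fun q : M.Path × (Vec (M.dE (t + 1)) ×
    Vec (M.dZ t)) ↦ f (extend t q.1 q.2)) hi hfe, ← lintegral_map (f := s.indicator 1) hi hf,
    lintegral_indicator_one hs, lintegral_indicator_one hs] at h
  exact h

variable {t : ℕ} {f : M.Path → ℝ}

theorem integrable_extend_iff (hf : Measurable f) (hna : Nonanticipative (t + 1) f) :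
    Integrable (fun q : M.Path × _ ↦ f (extend t q.1 q.2)) ((M.law P) ⊗ₘ (stepKernel P t)) ↔
      Integrable f (M.law P) := by
  have h1 := integrable_map_measure (μ := (M.law P) ⊗ₘ (stepKernel P t))
    (f := fun q ↦ f (extend t q.1 q.2)) (g := fun r : ℝ ↦ r)
    measurable_id.aestronglyMeasurable (hf.comp (measurable_extend t)).aemeasurable
  have h2 := integrable_map_measure (μ := M.law P) (f := f) (g := fun r : ℝ ↦ r)
    measurable_id.aestronglyMeasurable hf.aemeasurable
  rw [map_law_eq P t hf hna] at h1
  exact h1.symm.trans h2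

theorem integral_extend (hf : Measurable f) (hna : Nonanticipative (t + 1) f)
    (hi : Integrable f (M.law P)) :
    ∫ ω, ∫ p, f (extend t ω p) ∂(stepKernel P t ω) ∂(M.law P) = ∫ ω, f ω ∂(M.law P) := by
  rw [← Measure.integral_compProd (f := fun q : M.Path × (Vec (M.dE (t + 1)) × Vec (M.dZ t)) ↦
    f (extend t q.1 q.2)) ((integrable_extend_iff P hf hna).2 hi)]
  have h1 := integral_map (μ := (M.law P) ⊗ₘ (stepKernel P t)) (f := fun r : ℝ ↦ r)
    (φ := fun q ↦ f (extend t q.1 q.2)) (hf.comp (measurable_extend t)).aemeasurable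
    measurable_id.aestronglyMeasurable
  rw [map_law_eq P t hf hna, integral_map (f := fun r : ℝ ↦ r) hf.aemeasurable
    measurable_id.aestronglyMeasurable] at h1
  exact h1.symm

theorem integrable_integral_extend (hf : Measurable f) (hna : Nonanticipative (t + 1) f)
    (hi : Integrable f (M.law P)) :
    Integrable (fun ω ↦ ∫ p, f (extend t ω p) ∂(stepKernel P t ω)) (M.law P) :=
  Integrable.integral_compProd (κ := Kernel.const Unit (M.law P))
    (η := Kernel.prodMkLeft Unit (stepKernel P t)) (a := ()) ((integrable_extend_iff P hf hna).2 hi)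

theorem ae_integrable_extend (hf : Measurable f) (hna : Nonanticipative (t + 1) f)
    (hi : Integrable f (M.law P)) :
    ∀ᵐ ω ∂(M.law P), Integrable (fun p ↦ f (extend t ω p)) (stepKernel P t ω) := by
  have h := (integrable_extend_iff P hf hna).2 hi
  exact ((Measure.integrable_compProd_iff h.1).1 h).1

/-- A nonanticipative event has probability zero if it has so conditionally. -/
theorem ae_of_ae_extend {p : M.Path → Prop} (hp : MeasurableSet {ω | p ω})
    (hna : Nonanticipative (t + 1) p)
    (h : ∀ᵐ ω ∂(M.law P), ∀ᵐ q ∂(stepKernel P t ω), p (extend t ω q)) :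
    ∀ᵐ ω ∂(M.law P), p ω := by
  have hi : Measurable ({ω | p ω}ᶜ.indicator (1 : M.Path → ENNReal)) :=
    measurable_one.indicator hp.compl
  have h1 := lintegral_law_extend P t hi fun ω ω' ha ↦ by
    have : ω ∈ {ω | p ω}ᶜ ↔ ω' ∈ {ω | p ω}ᶜ := by
      simp only [Set.mem_compl_iff, Set.mem_ofPred_eq, hna ω ω' ha]
    by_cases h' : ω' ∈ {ω | p ω}ᶜ
    · rw [Set.indicator_of_mem h', Set.indicator_of_mem (this.2 h')]
      rfl
    · rw [Set.indicator_of_notMem h', Set.indicator_of_notMem (mt this.1 h')]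
  rw [lintegral_indicator_one hp.compl] at h1
  rw [ae_iff]
  refine h1.symm.trans ?_
  rw [lintegral_eq_zero_iff' (Measurable.aemeasurable ?_)]
  · filter_upwards [h] with ω hω
    refine (lintegral_eq_zero_iff' (Measurable.aemeasurable ?_)).2 ?_
    · exact hi.comp ((measurable_extend t).comp (f := fun q ↦ (ω, q)) (by fun_prop))
    · filter_upwards [hω] with q hq
      simp [hq]
  · exact (hi.comp (measurable_extend t)).lintegral_kernel_prod_right' (κ := stepKernel P t)

theorem ae_hist_zero : ∀ᵐ ω ∂(M.law P), M.hist 0 ω.1 = M.ξ₀ := by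
  have h1 : ∀ᵐ ξ ∂M.exoLaw, M.hist 0 ξ = M.ξ₀ := by
    have h2 := Kernel.traj_map_frestrictLe_apply (X := fun i ↦ Vec (M.dE i)) (κ := M.κ) 0 0 M.ξ₀
    rw [Kernel.partialTraj_self, Kernel.id_apply] at h2
    refine ae_of_ae_map (measurable_hist 0).aemeasurable (p := fun h ↦ h = M.ξ₀) ?_
    have hfr : (Preorder.frestrictLe (π := fun i ↦ Vec (M.dE i)) 0) = M.hist 0 := rfl
    rw [hfr] at h2
    rw [exoLaw, h2, ae_dirac_eq]
    rfl
  exact Measure.quasiMeasurePreserving_fst.ae h1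

/-- Up to stage `t` the law of `(ξ, ζ)` only depends on the distributions of `ζ_0, …, ζ_{t-1}`. -/
theorem map_trunc_law_congr {P' : (t : ℕ) → Measure (Vec (M.dZ t))}
    [∀ t, IsProbabilityMeasure (P' t)] (hPP' : ∀ i < t, P i = P' i) :
    (M.law P).map (trunc t) = (M.law P').map (trunc t) := by
  let a : M.ExoPath → M.ExoPath := fun ξ i ↦ if i ≤ t then ξ i else 0
  -- Truncation acts coordinatewise, so it maps a product law to a product law; beyond t both
  -- families of marginals collapse to the point mass at 0.
  let b : (i : ℕ) → Vec (M.dZ i) → Vec (M.dZ i) := fun i z ↦ if i < t then z else 0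
  have ha : Measurable a := measurable_pi_iff.2 fun i ↦ by
    by_cases hi : i ≤ t
    · simp only [a, hi, if_true]
      exact measurable_pi_apply i
    · simp only [a, hi, if_false]
      exact measurable_const
  have hb : ∀ i, Measurable (b i) := fun i ↦ by
    by_cases hi : i < t
    · simp only [b, hi, if_true]
      exact measurable_id
    · simp only [b, hi, if_false]
      exact measurable_const
  have hb' : Measurable (fun (ζ : M.EndoPath) i ↦ b i (ζ i)) := by fun_prop
  have htr : trunc (M := M) t = Prod.map a (fun ζ i ↦ b i (ζ i)) := rfl
  have h : (fun i ↦ (P i).map (b i)) = fun i ↦ (P' i).map (b i) := by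
    ext1 i
    by_cases hi : i < t
    · rw [hPP' i hi]
    · have : b i = fun _ ↦ 0 := by simp [b, hi]
      simp [this]
  rw [htr, law, law, ← Measure.map_prod_map _ _ ha hb', ← Measure.map_prod_map _ _ ha hb',
    Measure.infinitePi_map_pi _ hb, Measure.infinitePi_map_pi _ hb, h]

/-- The couplings prescribe marginals only up to the horizon. This moves almost sure statements to
any product law with the same relevant marginals. -/
theorem ae_law_congr {P' : (t : ℕ) → Measure (Vec (M.dZ t))} [∀ t, IsProbabilityMeasure (P' t)]
    {p : M.Path → Prop} (hp : MeasurableSet {ω | p ω}) (hna : Nonanticipative t p)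
    (hPP' : ∀ i < t, P i = P' i) (h : ∀ᵐ ω ∂(M.law P), p ω) : ∀ᵐ ω ∂(M.law P'), p ω := by
  have key (Q : (t : ℕ) → Measure (Vec (M.dZ t))) [∀ t, IsProbabilityMeasure (Q t)] :
      (∀ᵐ ω ∂((M.law Q).map (trunc t)), p ω) ↔ ∀ᵐ ω ∂(M.law Q), p ω := by
    rw [ae_map_iff (measurable_trunc t).aemeasurable hp]
    exact Filter.eventually_congr (Filter.Eventually.of_forall fun ω ↦
      iff_of_eq (hna _ _ (agree_trunc t ω)))
  rw [← key, ← map_trunc_law_congr P hPP', key]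
  exact h

end Model

/-! ### Optimality gaps along realizations -/

namespace Moduli

variable (c : Moduli) (T : ℕ)

/-- Lipschitz modulus of the state of stage `t` with respect to earlier decisions and endogenous
variables. -/
def stateLip : ℕ → ℝ
  | 0 => 0
  | t + 1 => c.maxS T * (stateLip t + 2)

/-- Lipschitz modulus of the optimality gap of stage `t`. -/
def gapLip : ℕ → ℝ
  | 0 => c.LQ T 0
  | u + 1 => c.LQ T (u + 1) * (c.stateLip T (u + 1) + 1) +
      c.LQ T (u + 1) * (c.stateLip T (u + 1) + c.LX (u + 1) * (c.stateLip T (u + 1) + 1))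

theorem stateLip_nonneg (t : ℕ) : 0 ≤ c.stateLip T t := by
  induction t with
  | zero => exact le_rfl
  | succ t ih => exact mul_nonneg c.maxS_nonneg (by linarith)

end Moduli

namespace Model

variable {M : Model}

/-- Equal `ξ_[t]`, and `ζ_0, …, ζ_{t-1}` at distance at most `r`. -/
def Near (t : ℕ) (r : ℝ) (ω ω' : M.Path) : Prop :=
  (∀ i ≤ t, ω.1 i = ω'.1 i) ∧ ∀ i < t, ‖ω.2 i - ω'.2 i‖ ≤ r

theorem Near.mono {t u : ℕ} (h : t ≤ u) {r r' : ℝ} (hr : r ≤ r') {ω ω' : M.Path}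
    (ha : Near u r ω ω') : Near t r' ω ω' :=
  ⟨fun i hi ↦ ha.1 i (hi.trans h), fun i hi ↦ (ha.2 i (hi.trans_le h)).trans hr⟩

theorem Near.hist_eq {t : ℕ} {r : ℝ} {ω ω' : M.Path} (h : Near t r ω ω') :
    M.hist t ω.1 = M.hist t ω'.1 := by
  ext1 i
  exact h.1 i (Finset.mem_Iic.1 i.2)

theorem Agree.near {t : ℕ} {ω ω' : M.Path} (h : Agree t ω ω') {r : ℝ} (hr : 0 ≤ r) :
    Near t r ω ω' := ⟨h.1, fun i hi ↦ by simpa [h.2 i hi] using hr⟩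

theorem near_refl (t : ℕ) {r : ℝ} (hr : 0 ≤ r) (ω : M.Path) : Near t r ω ω :=
  ⟨fun _ _ ↦ rfl, fun i _ ↦ by simpa using hr⟩

/-- Distance of the decisions of stages `0, …, t`. -/
def prefixDist (t : ℕ) (x x' : M.DecPath) : ℝ :=
  dist ((Finset.Iic t).restrict x) ((Finset.Iic t).restrict x')

theorem prefixDist_nonneg (t : ℕ) (x x' : M.DecPath) : 0 ≤ prefixDist t x x' := dist_nonneg

theorem prefixDist_le_iff {t : ℕ} {x x' : M.DecPath} {r : ℝ} (hr : 0 ≤ r) :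
    prefixDist t x x' ≤ r ↔ ∀ j ≤ t, ‖x j - x' j‖ ≤ r := by
  rw [prefixDist, dist_pi_le_iff hr]
  constructor
  · intro h j hj
    rw [← dist_eq_norm]
    exact h ⟨j, Finset.mem_Iic.2 hj⟩
  · intro h j
    rw [dist_eq_norm]
    exact h j (Finset.mem_Iic.1 j.2)

theorem norm_sub_le_prefixDist {t j : ℕ} (hj : j ≤ t) (x x' : M.DecPath) :
    ‖x j - x' j‖ ≤ prefixDist t x x' :=
  (prefixDist_le_iff (prefixDist_nonneg t x x')).1 le_rfl j hj

theorem prefixDist_update_le (u : ℕ) (x x' : M.DecPath) (y y' : Vec (M.dX (u + 1))) :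
    prefixDist (u + 1) (Function.update x (u + 1) y) (Function.update x' (u + 1) y') ≤
      prefixDist u x x' + ‖y - y'‖ := by
  rw [prefixDist_le_iff (add_nonneg (prefixDist_nonneg _ _ _) (norm_nonneg _))]
  intro j hj
  rcases eq_or_ne j (u + 1) with rfl | hne
  · simpa using prefixDist_nonneg u x x'
  · rw [Function.update_of_ne hne, Function.update_of_ne hne]
    have := norm_sub_le_prefixDist (show j ≤ u by omega) x x'
    linarith [norm_nonneg (y - y')]

theorem continuous_prefixDist_left (t : ℕ) (x' : M.DecPath) :
    Continuous fun x ↦ prefixDist t x x' := by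
  unfold prefixDist
  have : Continuous fun x : M.DecPath ↦ (Finset.Iic t).restrict x :=
    continuous_pi fun i ↦ continuous_apply (i : ℕ)
  fun_prop

/-- Infinite decision paths carry the product topology; `prefixDist` is a continuous pseudometric on
them, so estimates in finitely many coordinates still give continuity. -/
theorem continuous_of_prefix_lipschitz {t : ℕ} {K : ℝ} {E : Type*} [NormedAddCommGroup E]
    {f : M.DecPath → E} (h : ∀ x x', ‖f x - f x'‖ ≤ K * prefixDist t x x') : Continuous f := by
  refine continuous_iff_continuousAt.2 fun x' ↦ ?_
  refine tendsto_iff_norm_sub_tendsto_zero.2 (squeeze_zero (fun _ ↦ norm_nonneg _)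
    (fun x ↦ h x x') ?_)
  have h1 : Filter.Tendsto (fun x ↦ K * prefixDist t x x') (nhds x')
      (nhds (K * prefixDist t x' x')) :=
    ((continuous_prefixDist_left t x').tendsto x').const_mul K
  simpa [prefixDist] using h1

variable (P P' : (t : ℕ) → Measure (Vec (M.dZ t))) (T : ℕ)

/-- Cost to go of stage `t` along a realization. -/
def pathCost (t : ℕ) (x : M.DecPath) (ω : M.Path) : ℝ :=
  M.costToGo P (T - t) t (M.state x ω.1 ω.2 t) (x t) (M.hist t ω.1)

/-- Optimal cost to go of stage `u + 1` along a realization. -/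
def pathVal (u : ℕ) (x : M.DecPath) (ω : M.Path) : ℝ :=
  M.nextVal P (T - (u + 1)) u (M.state x ω.1 ω.2 (u + 1)) (x u) (M.hist (u + 1) ω.1)

/-- Feasible set of stage `u + 1` along a realization. -/
def pathFeas (u : ℕ) (x : M.DecPath) (ω : M.Path) : Set (Vec (M.dX (u + 1))) :=
  M.feas u (M.state x ω.1 ω.2 (u + 1)) (x u) (M.hist (u + 1) ω.1)

/-- Suboptimality of the decision of stage `t` given the earlier ones. -/
def gap : ℕ → M.DecPath → M.Path → ℝ
  | 0, x, _ => M.costToGo P T 0 M.s₀ (x 0) M.ξ₀ - M.optVal T P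
  | u + 1, x, ω => pathCost P T (u + 1) x ω - pathVal P T u x ω

/-- The decisions of stages `0, …, t` are feasible and optimal along a realization. -/
def IsOpt (t : ℕ) (x : M.DecPath) (ω : M.Path) : Prop :=
  (x 0 ∈ M.X₀ ∧ gap P T 0 x ω ≤ 0) ∧
    ∀ u < t, x (u + 1) ∈ pathFeas u x ω ∧ gap P T (u + 1) x ω ≤ 0

variable {P T} in
theorem IsOpt.mono {t u : ℕ} (h : t ≤ u) {x : M.DecPath} {ω : M.Path}
    (hx : IsOpt P T u x ω) : IsOpt P T t x ω := ⟨hx.1, fun j hj ↦ hx.2 j (hj.trans_le h)⟩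

end Model

/-! ### Lipschitz dependence of states, feasible sets and gaps on decisions and realizations -/

namespace Regular

variable {M : Model} {T : ℕ} {c : Moduli} {P P' : (t : ℕ) → Measure (Vec (M.dZ t))}

theorem norm_state_sub_le (hR : Regular M T c) {t : ℕ} (ht : t ≤ T) {r : ℝ}
    {x x' : M.DecPath} {ω ω' : M.Path} (hω : Near t r ω ω') (hx : ∀ j < t, ‖x j - x' j‖ ≤ r) :
    ‖M.state x ω.1 ω.2 t - M.state x' ω'.1 ω'.2 t‖ ≤ c.stateLip T t * r := by
  induction t with
  | zero => simp [Model.state, Moduli.stateLip]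
  | succ t ih =>
    have h1 := ih (by omega) (hω.mono (by omega) le_rfl) fun j hj ↦ hx j (by omega)
    simp only [Model.state]
    rw [hω.1 t (by omega)]
    refine (hR.norm_S_sub_le ht _ _ _ _ _ _ _).trans ?_
    have h2 := hx t (by omega)
    have h3 := hω.2 t (by omega)
    -- The summand 2 in `stateLip` accounts for x_t and ζ_t, each displaced by at most r.
    have : c.stateLip T (t + 1) * r = c.maxS T * (c.stateLip T t * r + r + r) := by
      rw [Moduli.stateLip]; ring
    rw [this]
    have := c.maxS_nonneg (T := T)
    gcongr

/-- Causality is the Lipschitz estimate with r = 0; the same trick proves `gap_congr`. -/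
theorem state_congr (hR : Regular M T c) {t : ℕ} (ht : t ≤ T) {x x' : M.DecPath} {ω ω' : M.Path}
    (hω : Agree t ω ω') (hx : ∀ j < t, x j = x' j) :
    M.state x ω.1 ω.2 t = M.state x' ω'.1 ω'.2 t := by
  have := hR.norm_state_sub_le ht (x := x) (x' := x') (hω.near le_rfl)
    fun j hj ↦ by simp [hx j hj]
  rw [mul_zero] at this
  exact sub_eq_zero.1 (norm_le_zero_iff.1 this)

theorem pathFeas_congr (hR : Regular M T c) {u : ℕ} (hu : u < T) {x x' : M.DecPath}
    {ω ω' : M.Path} (hω : Agree (u + 1) ω ω') (hx : ∀ j ≤ u, x j = x' j) :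
    pathFeas u x ω = pathFeas u x' ω' := by
  rw [pathFeas, pathFeas, hR.state_congr (show u + 1 ≤ T from hu) hω
    (fun j hj ↦ hx j (by omega)), hx u le_rfl, hω.hist_eq]

theorem exists_pathFeas_near (hR : Regular M T c) {u : ℕ} (hu : u < T) {r : ℝ}
    {x x' : M.DecPath} {ω ω' : M.Path} (hω : Near (u + 1) r ω ω')
    (hx : ∀ j ≤ u, ‖x j - x' j‖ ≤ r) {y : Vec (M.dX (u + 1))} (hy : y ∈ pathFeas u x ω) :
    ∃ y' ∈ pathFeas u x' ω', ‖y - y'‖ ≤ c.LX (u + 1) * (c.stateLip T (u + 1) + 1) * r := by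
  have h1 := hR.norm_state_sub_le (show u + 1 ≤ T from hu) hω fun j hj ↦ hx j (by omega)
  rw [pathFeas, hω.hist_eq] at hy
  obtain ⟨y', hy', hle⟩ := hR.exists_feas_near hu _ (M.state x' ω'.1 ω'.2 (u + 1)) _ (x' u) _ hy
  refine ⟨y', hy', hle.trans ?_⟩
  rw [mul_assoc]
  have := hR.LX_nonneg hu (u + 1)
  gcongr
  linarith [hx u le_rfl]

theorem nonempty_pathFeas (hR : Regular M T c) {u : ℕ} (hu : u < T) (x : M.DecPath)
    (ω : M.Path) : (pathFeas u x ω).Nonempty := hR.nonempty_feas hu _ _ _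

theorem isCompact_pathFeas (hR : Regular M T c) {u : ℕ} (hu : u < T) (x : M.DecPath)
    (ω : M.Path) : IsCompact (pathFeas u x ω) := hR.isCompact_feas hu _ _ _

/-- Feasible decisions of all stages are uniformly bounded. -/
theorem exists_bound (hR : Regular M T c) : ∃ R : ℝ, 0 ≤ R ∧ (∀ x ∈ M.X₀, ‖x‖ ≤ R) ∧
    ∀ u < T, ∀ (x : M.DecPath) (ω : M.Path), ∀ y ∈ pathFeas u x ω, ‖y‖ ≤ R := by
  obtain ⟨R₀, hR₀⟩ := hR.X₀_compact.isBounded.exists_norm_le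
  have h1 : ∀ u, ∃ r, 0 ≤ r ∧ (u < T → ∀ (x : M.DecPath) (ω : M.Path), ∀ y ∈ pathFeas u x ω,
      ‖y‖ ≤ r) := by
    intro u
    by_cases hu : u < T
    · obtain ⟨B, hB, hsub⟩ := hR.bounded u hu
      obtain ⟨r, hr⟩ := hB.exists_norm_le
      exact ⟨max r 0, le_max_right _ _, fun _ x ω y hy ↦
        (hr y (hsub _ _ _ hy)).trans (le_max_left _ _)⟩
    · exact ⟨0, le_rfl, fun h ↦ absurd h hu⟩
  choose r hr0 hr using h1
  have hs : 0 ≤ ∑ u ∈ Finset.range T, r u := Finset.sum_nonneg fun u _ ↦ hr0 u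
  refine ⟨max R₀ 0 + ∑ u ∈ Finset.range T, r u, by positivity, fun x hx ↦ ?_,
    fun u hu x ω y hy ↦ ?_⟩
  · have := hR₀ x hx
    have := le_max_left R₀ 0
    linarith
  · have h2 := hr u hu x ω y hy
    have h3 := Finset.single_le_sum (f := r) (fun u _ ↦ hr0 u) (Finset.mem_range.2 hu)
    have := le_max_right R₀ 0
    linarith

variable [∀ t, IsProbabilityMeasure (P t)] [∀ t, IsProbabilityMeasure (P' t)]

theorem continuous_pathCost_update (hR : Regular M T c) {u : ℕ} (hu : u < T) (x : M.DecPath)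
    (ω : M.Path) : Continuous fun y ↦ M.costToGo P (T - (u + 1)) (u + 1)
      (M.state x ω.1 ω.2 (u + 1)) y (M.hist (u + 1) ω.1) :=
  (hR.lipMeas_costToGo (by omega)).continuous_right _ _

theorem pathVal_le (hR : Regular M T c) {u : ℕ} (hu : u < T) {x : M.DecPath} {ω : M.Path}
    {y : Vec (M.dX (u + 1))} (hy : y ∈ pathFeas u x ω) :
    pathVal P T u x ω ≤ M.costToGo P (T - (u + 1)) (u + 1) (M.state x ω.1 ω.2 (u + 1)) y
      (M.hist (u + 1) ω.1) :=
  csInf_le (bddBelow_image_of_compact (hR.isCompact_pathFeas hu x ω)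
    (hR.continuous_pathCost_update hu x ω)) ⟨y, hy, rfl⟩

theorem exists_eq_pathVal (hR : Regular M T c) {u : ℕ} (hu : u < T) (x : M.DecPath)
    (ω : M.Path) : ∃ y ∈ pathFeas u x ω, M.costToGo P (T - (u + 1)) (u + 1)
      (M.state x ω.1 ω.2 (u + 1)) y (M.hist (u + 1) ω.1) = pathVal P T u x ω := by
  obtain ⟨y, hy, h⟩ := (hR.isCompact_pathFeas hu x ω).exists_sInf_image_eq
    (hR.nonempty_pathFeas hu x ω) (hR.continuous_pathCost_update (P := P) hu x ω).continuousOn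
  exact ⟨y, hy, h.symm⟩

theorem gap_succ_nonneg (hR : Regular M T c) {u : ℕ} (hu : u < T) {x : M.DecPath} {ω : M.Path}
    (hx : x (u + 1) ∈ pathFeas u x ω) : 0 ≤ gap P T (u + 1) x ω :=
  sub_nonneg.2 (hR.pathVal_le hu hx)

/-- The chosen decision and a minimizer lie in one set of diameter at most A. Hence gaps of feasible
decisions are bounded even where costs are not, which makes them integrable. -/
theorem gap_succ_le (hR : Regular M T c) {u : ℕ} (hu : u < T) {x : M.DecPath} {ω : M.Path}
    (hx : x (u + 1) ∈ pathFeas u x ω) : gap P T (u + 1) x ω ≤ c.LQ T (u + 1) * c.A := by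
  obtain ⟨y, hy, h⟩ := hR.exists_eq_pathVal (P := P) hu x ω
  rw [gap, ← h, pathCost]
  have h1 := (hR.lipMeas_costToGo (P := P) (k := T - (u + 1)) (t := u + 1) (by omega)).lip
    (M.state x ω.1 ω.2 (u + 1)) (M.state x ω.1 ω.2 (u + 1)) (x (u + 1)) y (M.hist (u + 1) ω.1)
  rw [sub_self, norm_zero, zero_add] at h1
  refine (le_abs_self _).trans (h1.trans ?_)
  have := hR.LQ_nonneg (t := u + 1) hu
  gcongr
  exact hR.diam_le u hu _ _ _ _ hx _ hy

theorem gap_zero_nonneg (hR : Regular M T c) {x : M.DecPath} {ω : M.Path} (hx : x 0 ∈ M.X₀) :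
    0 ≤ gap P T 0 x ω :=
  sub_nonneg.2 (csInf_le (bddBelow_image_of_compact hR.X₀_compact
    ((hR.lipMeas_costToGo (P := P) (zero_add T)).continuous_right _ _)) ⟨_, hx, rfl⟩)

theorem abs_pathCost_sub_le (hR : Regular M T c) {t : ℕ} (ht : t ≤ T) {r : ℝ}
    {x x' : M.DecPath} {ω ω' : M.Path} (hω : Near t r ω ω') (hx : ∀ j ≤ t, ‖x j - x' j‖ ≤ r) :
    |pathCost P T t x ω - pathCost P T t x' ω'| ≤ c.LQ T t * (c.stateLip T t + 1) * r := by
  rw [pathCost, pathCost, hω.hist_eq]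
  refine ((hR.lipMeas_costToGo (P := P) (by omega)).lip _ _ _ _ _).trans ?_
  have h1 := hR.norm_state_sub_le ht hω fun j hj ↦ hx j (by omega)
  have := hR.LQ_nonneg ht
  rw [mul_assoc]
  gcongr
  linarith [hx t le_rfl]

theorem abs_pathVal_sub_le (hR : Regular M T c) {u : ℕ} (hu : u < T) {r : ℝ}
    {x x' : M.DecPath} {ω ω' : M.Path} (hω : Near (u + 1) r ω ω')
    (hx : ∀ j ≤ u, ‖x j - x' j‖ ≤ r) :
    |pathVal P T u x ω - pathVal P T u x' ω'| ≤ c.LQ T (u + 1) *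
      (c.stateLip T (u + 1) + c.LX (u + 1) * (c.stateLip T (u + 1) + 1)) * r := by
  rw [pathVal, pathVal, hω.hist_eq]
  refine (hR.abs_nextVal_sub_le hu (hR.lipMeas_costToGo (by omega)) _ _ _ _ _).trans ?_
  have h1 := hR.norm_state_sub_le (show u + 1 ≤ T from hu) hω fun j hj ↦ hx j (by omega)
  have h2 := hR.LQ_nonneg (t := u + 1) hu
  have h3 := hR.LX_nonneg hu (u + 1)
  have h4 := hx u le_rfl
  calc _ ≤ c.LQ T (u + 1) * (c.stateLip T (u + 1) * r +
        c.LX (u + 1) * (c.stateLip T (u + 1) * r + r)) := by gcongr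
    _ = _ := by ring

theorem gapLip_nonneg (hR : Regular M T c) {t : ℕ} (ht : t ≤ T) : 0 ≤ c.gapLip T t := by
  cases t with
  | zero => exact hR.LQ_nonneg ht
  | succ u =>
    have h2 := hR.LQ_nonneg (t := u + 1) ht
    have h3 := hR.LX_nonneg ht (u + 1)
    have h4 := c.stateLip_nonneg T (u + 1)
    rw [Moduli.gapLip]
    positivity

theorem abs_gap_sub_le (hR : Regular M T c) {t : ℕ} (ht : t ≤ T) {r : ℝ}
    {x x' : M.DecPath} {ω ω' : M.Path} (hω : Near t r ω ω') (hx : ∀ j ≤ t, ‖x j - x' j‖ ≤ r) :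
    |gap P T t x ω - gap P T t x' ω'| ≤ c.gapLip T t * r := by
  cases t with
  | zero =>
    rw [gap, gap, sub_sub_sub_cancel_right]
    refine ((hR.lipMeas_costToGo (P := P) (zero_add T)).lip _ _ _ _ _).trans ?_
    rw [sub_self, norm_zero, zero_add]
    exact mul_le_mul_of_nonneg_left (hx 0 le_rfl) (hR.LQ_nonneg ht)
  | succ u =>
    have h1 := hR.abs_pathCost_sub_le (P := P) ht hω hx
    have h2 := hR.abs_pathVal_sub_le (P := P) ht hω fun j hj ↦ hx j (by omega)
    rw [gap, gap, Moduli.gapLip, add_mul, sub_sub_sub_comm]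
    exact (abs_sub _ _).trans (add_le_add h1 h2)

theorem gap_congr (hR : Regular M T c) {t : ℕ} (ht : t ≤ T) {x x' : M.DecPath} {ω ω' : M.Path}
    (hω : Agree t ω ω') (hx : ∀ j ≤ t, x j = x' j) : gap P T t x ω = gap P T t x' ω' := by
  have := hR.abs_gap_sub_le (P := P) ht (x := x) (x' := x') (hω.near le_rfl)
    fun j hj ↦ by simp [hx j hj]
  rw [mul_zero] at this
  exact sub_eq_zero.1 (abs_nonpos_iff.1 this)

/-- The factor 2 arises because a cost to go and its minimum each move by at most the error of the
stage, which is largest at stage 0. -/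
theorem abs_gap_sub_gap_le (hR : Regular M T c) (hP : ∀ t ≤ T, Integrable (fun z ↦ ‖z‖) (P t))
    (hP' : ∀ t ≤ T, Integrable (fun z ↦ ‖z‖) (P' t)) {t : ℕ} (ht : t ≤ T) (x : M.DecPath)
    (ω : M.Path) : |gap P T t x ω - gap P' T t x ω| ≤ 2 * costErr T c P P' 0 := by
  cases t with
  | zero =>
    have h1 := hR.abs_costToGo_sub_le hP hP' (zero_add T) M.s₀ (x 0) M.ξ₀
    have h2 := hR.abs_optVal_sub_le hP hP'
    rw [gap, gap, sub_sub_sub_comm]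
    refine (abs_sub _ _).trans ?_
    linarith
  | succ u =>
    have hmono : costErr T c P P' (u + 1) ≤ costErr T c P P' 0 := by
      unfold costErr
      refine add_le_add (Finset.sum_le_sum_of_subset_of_nonneg
        (Finset.Ico_subset_Ico_left (Nat.zero_le _)) fun j hj _ ↦ ?_) le_rfl
      have hj := (Finset.mem_Ico.1 hj).2
      exact mul_nonneg (hR.Lhat_nonneg hj) (kantorovich_nonneg (hP j hj.le) (hP' j hj.le))
    have hd (y : Vec (M.dX (u + 1))) := hR.abs_costToGo_sub_le hP hP'
      (show u + 1 + (T - (u + 1)) = T by omega) (M.state x ω.1 ω.2 (u + 1)) y (M.hist (u + 1) ω.1)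
    have h1 := hd (x (u + 1))
    have h2 := hR.abs_nextVal_sub_nextVal_le
      (show u + 1 + (T - (u + 1)) = T by omega) (M.state x ω.1 ω.2 (u + 1)) (x u)
      (M.hist (u + 1) ω.1) hd
    have h3 := abs_sub (pathCost P T (u + 1) x ω - pathCost P' T (u + 1) x ω)
      (pathVal P T u x ω - pathVal P' T u x ω)
    rw [gap, gap, sub_sub_sub_comm]
    refine h3.trans ((add_le_add h1 h2).trans ?_)
    linarith

/-! ### Optimal decisions -/

theorem isOpt_congr (hR : Regular M T c) {t : ℕ} (ht : t ≤ T) {x x' : M.DecPath} {ω ω' : M.Path}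
    (hω : Agree t ω ω') (hx : ∀ j ≤ t, x j = x' j) : IsOpt P T t x ω ↔ IsOpt P T t x' ω' := by
  have h0 : gap P T 0 x ω = gap P T 0 x' ω' :=
    hR.gap_congr (Nat.zero_le T) (hω.mono (Nat.zero_le t)) fun j hj ↦ hx j (by omega)
  rw [IsOpt, IsOpt, h0, hx 0 (Nat.zero_le t)]
  refine and_congr Iff.rfl (forall₂_congr fun u hu ↦ ?_)
  rw [hx (u + 1) hu, hR.gap_congr (show u + 1 ≤ T by omega) (hω.mono hu)
    fun j hj ↦ hx j (by omega),
    hR.pathFeas_congr (show u < T by omega) (hω.mono hu) fun j hj ↦ hx j (by omega)]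

theorem exists_gap_update_eq_zero (hR : Regular M T c) {u : ℕ} (hu : u < T) (x : M.DecPath)
    (ω : M.Path) :
    ∃ y ∈ pathFeas u x ω, gap P T (u + 1) (Function.update x (u + 1) y) ω = 0 := by
  obtain ⟨y, hy, h⟩ := hR.exists_eq_pathVal (P := P) hu x ω
  have hup : ∀ j ≤ u, Function.update x (u + 1) y j = x j :=
    fun j hj ↦ Function.update_of_ne (by omega) _ _
  have hst := hR.state_congr (show u + 1 ≤ T from hu) (agree_refl _ ω)
    (fun j hj ↦ hup j (by omega))
  refine ⟨y, hy, ?_⟩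
  rw [gap, pathCost, hst, pathVal, hst, hup u le_rfl, Function.update_self, h, pathVal, sub_self]

theorem exists_isOpt_succ (hR : Regular M T c) {t : ℕ} (ht : t < T) {x : M.DecPath} {ω : M.Path}
    (hx : IsOpt P T t x ω) : ∃ y, IsOpt P T (t + 1) (Function.update x (t + 1) y) ω := by
  obtain ⟨y, hy, h⟩ := hR.exists_gap_update_eq_zero (P := P) ht x ω
  have hag : ∀ j ≤ t, Function.update x (t + 1) y j = x j := fun j hj ↦
    Function.update_of_ne (by omega) _ _
  have h1 := (hR.isOpt_congr (P := P) ht.le (agree_refl t ω) hag).2 hx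
  refine ⟨y, h1.1, fun u hu ↦ ?_⟩
  rcases Nat.lt_succ_iff_lt_or_eq.1 hu with hu | rfl
  · exact h1.2 u hu
  · rw [hR.pathFeas_congr ht (agree_refl _ ω) hag, Function.update_self]
    exact ⟨hy, h.le⟩

theorem exists_isOpt (hR : Regular M T c) {t : ℕ} (ht : t ≤ T) (ω : M.Path) :
    ∃ x, IsOpt P T t x ω := by
  induction t with
  | zero =>
    obtain ⟨y, hy, h⟩ := hR.X₀_compact.exists_sInf_image_eq hR.X₀_nonempty
      ((hR.lipMeas_costToGo (P := P) (zero_add T)).continuous_right M.s₀ M.ξ₀).continuousOn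
    refine ⟨Function.update 0 0 y, ⟨by simpa using hy, ?_⟩, fun u hu ↦ by omega⟩
    rw [gap, Model.optVal, h]
    simp
  | succ t ih =>
    obtain ⟨x, hx⟩ := ih (by omega)
    obtain ⟨y, hy⟩ := hR.exists_isOpt_succ ht hx
    exact ⟨_, hy⟩

/-- A feasible decision beats all feasible alternatives exactly when its cost is at most the
infimum, provided the image is nonempty and bounded below. -/
theorem optSet_eq (hR : Regular M T c) (ω : M.Path) :
    M.optSet T P ω.1 ω.2 = (Finset.Iic T).restrict '' {x | IsOpt P T T x ω} := by
  rw [Model.optSet]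
  congr 1
  ext x
  simp only [Set.mem_ofPred_eq, IsOpt]
  refine and_congr (and_congr_right fun hx ↦ ?_) (forall₂_congr fun u hu ↦
    and_congr_right fun hx ↦ ?_)
  · rw [gap, sub_nonpos, Model.optVal, le_csInf_iff
      (bddBelow_image_of_compact hR.X₀_compact
        ((hR.lipMeas_costToGo (P := P) (zero_add T)).continuous_right _ _))
      (hR.X₀_nonempty.image _)]
    simp
  · rw [gap, sub_nonpos, pathVal, Model.nextVal, ← pathFeas, le_csInf_iff
      (bddBelow_image_of_compact (hR.isCompact_pathFeas hu x ω)
        (hR.continuous_pathCost_update hu x ω)) ((hR.nonempty_pathFeas hu x ω).image _)]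
    simp [pathCost]

end Regular

/-! ### Measurability along realizations and distance to the optimal decisions -/

namespace Model

variable {M : Model} (P : (t : ℕ) → Measure (Vec (M.dZ t))) (T : ℕ)

/-- Total violation of the optimality conditions of stages `0, …, t`. -/
def excess (t : ℕ) (x : M.DecPath) (ω : M.Path) : ℝ :=
  max (gap P T 0 x ω) 0 + ∑ u ∈ Finset.range t,
    ((∑ i, max (M.g u i (M.state x ω.1 ω.2 (u + 1)) (x (u + 1)) (x u) (M.hist (u + 1) ω.1)) 0) +
      max (gap P T (u + 1) x ω) 0)

/-- One scalar inequality, continuous in the decisions and measurable in the realization, replaces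
the list of conditions. Membership in X₀ has no constraint function and is handled by the compact
`box`. -/
theorem isOpt_iff_excess {t : ℕ} {x : M.DecPath} {ω : M.Path} :
    IsOpt P T t x ω ↔ x 0 ∈ M.X₀ ∧ excess P T t x ω ≤ 0 := by
  have hmax : ∀ r : ℝ, max r 0 = 0 ↔ r ≤ 0 := fun r ↦ max_eq_right_iff
  have hin : ∀ u, 0 ≤ ∑ i, max (M.g u i (M.state x ω.1 ω.2 (u + 1)) (x (u + 1)) (x u)
      (M.hist (u + 1) ω.1)) 0 := fun u ↦ Finset.sum_nonneg fun i _ ↦ le_max_right _ _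
  have hnn : ∀ u ∈ Finset.range t, 0 ≤ (∑ i, max (M.g u i (M.state x ω.1 ω.2 (u + 1))
      (x (u + 1)) (x u) (M.hist (u + 1) ω.1)) 0) + max (gap P T (u + 1) x ω) 0 :=
    fun u _ ↦ add_nonneg (hin u) (le_max_right _ _)
  have hex : excess P T t x ω ≤ 0 ↔ excess P T t x ω = 0 := by
    refine ⟨fun h ↦ le_antisymm h ?_, fun h ↦ h.le⟩
    exact add_nonneg (le_max_right _ _) (Finset.sum_nonneg hnn)
  rw [hex, excess, add_eq_zero_iff_of_nonneg (le_max_right _ _) (Finset.sum_nonneg hnn), hmax,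
    Finset.sum_eq_zero_iff_of_nonneg hnn, IsOpt, and_assoc]
  refine and_congr_right fun _ ↦ and_congr_right fun _ ↦ ?_
  simp only [Finset.mem_range]
  refine forall₂_congr fun u _ ↦ ?_
  rw [add_eq_zero_iff_of_nonneg (hin u) (le_max_right _ _), hmax,
    Finset.sum_eq_zero_iff_of_nonneg fun i _ ↦ le_max_right _ _]
  simp only [hmax, Finset.mem_univ, true_imp_iff]
  rfl

/-- Decision paths that are bounded by `R` and start in `X₀`. -/
def box (M : Model) (R : ℝ) : Set M.DecPath :=
  Set.pi Set.univ fun j ↦ match j with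
    | 0 => M.X₀
    | j + 1 => Metric.closedBall (0 : Vec (M.dX (j + 1))) R

/-- The decisions of stages `0, …, t`, continued by zero. -/
def cut (t : ℕ) (x : M.DecPath) : M.DecPath := fun j ↦ if j ≤ t then x j else 0

theorem cut_of_le {t j : ℕ} (hj : j ≤ t) (x : M.DecPath) : cut t x j = x j := by simp [cut, hj]

/-- Distance from the optimal decisions of stages `0, …, t`. -/
def optDist (t : ℕ) (x : M.DecPath) (ω : M.Path) : ℝ :=
  Metric.infDist ((Finset.Iic t).restrict x) ((Finset.Iic t).restrict '' {y | IsOpt P T t y ω})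

theorem optDist_nonneg (t : ℕ) (x : M.DecPath) (ω : M.Path) : 0 ≤ optDist P T t x ω :=
  Metric.infDist_nonneg

theorem optDist_le_prefixDist {t : ℕ} {x y : M.DecPath} {ω : M.Path} (hy : IsOpt P T t y ω) :
    optDist P T t x ω ≤ prefixDist t x y :=
  Metric.infDist_le_dist_of_mem ⟨y, hy, rfl⟩

theorem optDist_le_add (t : ℕ) (x x' : M.DecPath) (ω : M.Path) :
    optDist P T t x ω ≤ optDist P T t x' ω + prefixDist t x x' :=
  Metric.infDist_le_infDist_add_dist

theorem prefixDist_comm (t : ℕ) (x x' : M.DecPath) : prefixDist t x x' = prefixDist t x' x :=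
  dist_comm _ _

theorem abs_optDist_sub_le (t : ℕ) (x x' : M.DecPath) (ω : M.Path) :
    |optDist P T t x ω - optDist P T t x' ω| ≤ prefixDist t x x' := by
  have h1 := optDist_le_add P T t x x' ω
  have h2 := optDist_le_add P T t x' x ω
  rw [prefixDist_comm] at h2
  exact abs_le.2 ⟨by linarith, by linarith⟩

end Model

namespace Regular

variable {M : Model} {T : ℕ} {c : Moduli} {P : (t : ℕ) → Measure (Vec (M.dZ t))}

theorem measurable_state (hR : Regular M T c) {t : ℕ} (ht : t ≤ T) :
    Measurable fun p : M.DecPath × M.Path ↦ M.state p.1 p.2.1 p.2.2 t := by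
  induction t with
  | zero => exact measurable_const
  | succ t ih =>
    have h1 := ih (by omega)
    simp only [Model.state]
    exact (hR.S_cont t ht).measurable.comp (f := fun p : M.DecPath × M.Path ↦
      (M.state p.1 p.2.1 p.2.2 t, p.1 t, p.2.1 t, p.2.2 t)) (by fun_prop)

theorem measurable_hist_path (t : ℕ) : Measurable fun p : M.DecPath × M.Path ↦ M.hist t p.2.1 :=
  (measurable_hist t).comp (by fun_prop)

theorem continuous_state (hR : Regular M T c) {t : ℕ} (ht : t ≤ T) (ω : M.Path) :
    Continuous fun x : M.DecPath ↦ M.state x ω.1 ω.2 t :=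
  continuous_of_prefix_lipschitz (t := t) (K := c.stateLip T t) fun x x' ↦
    hR.norm_state_sub_le ht (near_refl t (prefixDist_nonneg t x x') ω) fun _ hj ↦
      norm_sub_le_prefixDist hj.le x x'

theorem isCompact_box (hR : Regular M T c) (R : ℝ) : IsCompact (M.box R) := by
  refine isCompact_univ_pi fun j ↦ ?_
  cases j with
  | zero => exact hR.X₀_compact
  | succ j => exact isCompact_closedBall 0 R

/-- Optimality up to stage t leaves later coordinates free, so they may be set to 0; this puts some
representative of every optimal prefix into one compact set. -/
theorem cut_mem_box {R : ℝ} (hR0 : 0 ≤ R)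
    (hb : ∀ u < T, ∀ (x : M.DecPath) (ω : M.Path), ∀ y ∈ pathFeas u x ω, ‖y‖ ≤ R)
    {t : ℕ} (ht : t ≤ T) {x : M.DecPath} {ω : M.Path} (hx : IsOpt P T t x ω) :
    cut t x ∈ M.box R := by
  intro j _
  cases j with
  | zero =>
    rw [cut_of_le (Nat.zero_le t)]
    exact hx.1.1
  | succ j =>
    change cut t x (j + 1) ∈ Metric.closedBall 0 R
    by_cases hj : j + 1 ≤ t
    · rw [cut_of_le hj, mem_closedBall_zero_iff]
      exact hb j (by omega) x ω _ (hx.2 j hj).1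
    · simpa [cut, hj] using hR0

variable [∀ t, IsProbabilityMeasure (P t)]

theorem measurable_pathCost (hR : Regular M T c) {t : ℕ} (ht : t ≤ T) :
    Measurable fun p : M.DecPath × M.Path ↦ pathCost P T t p.1 p.2 := by
  have h1 := hR.measurable_state ht
  have h2 := measurable_hist_path (M := M) t
  exact (hR.lipMeas_costToGo (P := P) (show t + (T - t) = T by omega)).meas.comp
    (f := fun p : M.DecPath × M.Path ↦ (M.state p.1 p.2.1 p.2.2 t, p.1 t, M.hist t p.2.1))
    (by fun_prop)

theorem measurable_pathVal (hR : Regular M T c) {u : ℕ} (hu : u < T) :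
    Measurable fun p : M.DecPath × M.Path ↦ pathVal P T u p.1 p.2 := by
  have h1 := hR.measurable_state (show u + 1 ≤ T from hu)
  have h2 := measurable_hist_path (M := M) (u + 1)
  exact (hR.measurable_nextVal hu (hR.lipMeas_costToGo (P := P)
    (show u + 1 + (T - (u + 1)) = T by omega))).comp
    (f := fun p : M.DecPath × M.Path ↦
      (M.state p.1 p.2.1 p.2.2 (u + 1), p.1 u, M.hist (u + 1) p.2.1)) (by fun_prop)

theorem measurable_gap (hR : Regular M T c) {t : ℕ} (ht : t ≤ T) :
    Measurable fun p : M.DecPath × M.Path ↦ gap P T t p.1 p.2 := by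
  cases t with
  | zero =>
    refine Measurable.sub_const ?_ _
    exact (hR.lipMeas_costToGo (P := P) (zero_add T)).meas.comp
      (f := fun p : M.DecPath × M.Path ↦ (M.s₀, p.1 0, M.ξ₀)) (by fun_prop)
  | succ u => exact (hR.measurable_pathCost ht).sub (hR.measurable_pathVal ht)

theorem continuous_gap (hR : Regular M T c) {t : ℕ} (ht : t ≤ T) (ω : M.Path) :
    Continuous fun x : M.DecPath ↦ gap P T t x ω :=
  continuous_of_prefix_lipschitz (t := t) (K := c.gapLip T t) fun x x' ↦
    hR.abs_gap_sub_le ht (near_refl t (prefixDist_nonneg t x x') ω) fun _ hj ↦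
      norm_sub_le_prefixDist hj x x'

theorem measurable_excess (hR : Regular M T c) {t : ℕ} (ht : t ≤ T) :
    Measurable fun p : M.DecPath × M.Path ↦ excess P T t p.1 p.2 := by
  refine ((hR.measurable_gap (Nat.zero_le T)).max measurable_const).add
    (Finset.measurable_fun_sum _ fun u hu ↦ ?_)
  have hu : u + 1 ≤ T := by have := Finset.mem_range.1 hu; omega
  refine (Finset.measurable_fun_sum _ fun i _ ↦ ?_).add
    ((hR.measurable_gap hu).max measurable_const)
  refine Measurable.max ?_ measurable_const
  have h1 := hR.measurable_state hu
  have h2 := measurable_hist_path (M := M) (u + 1)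
  exact (hR.g_cont u hu i).measurable.comp (f := fun p : M.DecPath × M.Path ↦
    (M.state p.1 p.2.1 p.2.2 (u + 1), p.1 (u + 1), p.1 u, M.hist (u + 1) p.2.1)) (by fun_prop)

theorem continuous_excess (hR : Regular M T c) {t : ℕ} (ht : t ≤ T) (ω : M.Path) :
    Continuous fun x : M.DecPath ↦ excess P T t x ω := by
  refine ((hR.continuous_gap (Nat.zero_le T) ω).max continuous_const).add
    (continuous_finsetSum _ fun u hu ↦ ?_)
  have hu : u + 1 ≤ T := by have := Finset.mem_range.1 hu; omega
  refine (continuous_finsetSum _ fun i _ ↦ ?_).add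
    ((hR.continuous_gap hu ω).max continuous_const)
  refine Continuous.max ?_ continuous_const
  have h1 := hR.continuous_state hu ω
  exact (hR.g_cont u hu i).comp (f := fun x : M.DecPath ↦
    (M.state x ω.1 ω.2 (u + 1), x (u + 1), x u, M.hist (u + 1) ω.1)) (by fun_prop)

/-- Existence of optimal decisions with a further property that is closed in the decisions is a
measurable event. -/
theorem measurableSet_exists_isOpt (hR : Regular M T c) {t : ℕ} (ht : t ≤ T)
    {Ψ : M.DecPath → M.Path → ℝ} (hc : ∀ ω, Continuous fun x ↦ Ψ x ω)
    (hm : ∀ x, Measurable (Ψ x)) (hcut : ∀ x ω, Ψ (cut t x) ω = Ψ x ω) :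
    MeasurableSet {ω | ∃ x, IsOpt P T t x ω ∧ Ψ x ω ≤ 0} := by
  obtain ⟨R, hR0, -, hb⟩ := hR.exists_bound
  -- The search is confined to a compact box independent of ω. By `hcut` the condition Ψ survives
  -- the zeroing of later coordinates.
  have : {ω | ∃ x, IsOpt P T t x ω ∧ Ψ x ω ≤ 0} =
      {ω | ∃ x ∈ M.box R, max (excess P T t x ω) (Ψ x ω) ≤ 0} := by
    ext ω
    constructor
    · rintro ⟨x, hx, hΨ⟩
      refine ⟨cut t x, cut_mem_box hR0 hb ht hx, max_le ?_ (by rwa [hcut])⟩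
      exact ((isOpt_iff_excess P T).1 ((hR.isOpt_congr (P := P) ht
        (agree_refl t ω) fun j hj ↦ cut_of_le hj x).2 hx)).2
    · rintro ⟨x, hx, hle⟩
      exact ⟨x, (isOpt_iff_excess P T).2 ⟨hx 0 (Set.mem_univ 0), (le_max_left _ _).trans hle⟩,
        (le_max_right _ _).trans hle⟩
  rw [this]
  refine measurableSet_exists_le_zero (hR.isCompact_box R)
    (Φ := fun x ω ↦ max (excess P T t x ω) (Ψ x ω))
    (fun ω ↦ (hR.continuous_excess ht ω).max (hc ω)) fun x ↦ Measurable.max ?_ (hm x)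
  exact (hR.measurable_excess ht).comp (f := fun ω : M.Path ↦ (x, ω)) (by fun_prop)

theorem optDist_lt_iff (hR : Regular M T c) {t : ℕ} (ht : t ≤ T) {x : M.DecPath} {ω : M.Path}
    {r : ℝ} : optDist P T t x ω < r ↔ ∃ y, IsOpt P T t y ω ∧ prefixDist t x y < r := by
  have hne : ((Finset.Iic t).restrict '' {y : M.DecPath | IsOpt P T t y ω}).Nonempty :=
    Set.Nonempty.image _ (hR.exists_isOpt ht ω)
  rw [optDist, Metric.infDist_lt_iff hne]
  simp [prefixDist]

theorem measurable_optDist (hR : Regular M T c) {t : ℕ} (ht : t ≤ T) (x : M.DecPath) :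
    Measurable (optDist P T t x) := by
  refine measurable_of_Iio fun r ↦ ?_
  -- The strict inequality is exhausted by closed ones with slack 1/(n+1), to which
  -- `measurableSet_exists_isOpt` applies.
  have : optDist P T t x ⁻¹' Set.Iio r = ⋃ n : ℕ, {ω | ∃ y, IsOpt P T t y ω ∧
      prefixDist t y x - (r - 1 / ((n : ℝ) + 1)) ≤ 0} := by
    ext ω
    simp only [Set.mem_preimage, Set.mem_Iio, Set.mem_iUnion, Set.mem_ofPred_eq]
    rw [hR.optDist_lt_iff ht]
    constructor
    · rintro ⟨y, hy, hlt⟩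
      obtain ⟨n, hn⟩ := exists_nat_one_div_lt (sub_pos.2 hlt)
      exact ⟨n, y, hy, by rw [prefixDist_comm]; linarith⟩
    · rintro ⟨n, y, hy, hle⟩
      refine ⟨y, hy, ?_⟩
      have : 0 < 1 / ((n : ℝ) + 1) := by positivity
      rw [prefixDist_comm]
      linarith
  rw [this]
  refine MeasurableSet.iUnion fun n ↦ hR.measurableSet_exists_isOpt ht
    (Ψ := fun y _ ↦ prefixDist t y x - (r - 1 / ((n : ℝ) + 1)))
    (fun ω ↦ (continuous_prefixDist_left t x).sub continuous_const)
    (fun y ↦ measurable_const) fun y ω ↦ ?_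
  have : (Finset.Iic t).restrict (cut t y) = (Finset.Iic t).restrict y :=
    funext fun j ↦ cut_of_le (Finset.mem_Iic.1 j.2) y
  rw [prefixDist, this, prefixDist]

theorem measurable_optDist_uncurry (hR : Regular M T c) {t : ℕ} (ht : t ≤ T) :
    Measurable fun p : M.DecPath × M.Path ↦ optDist P T t p.1 p.2 :=
  measurable_uncurry_of_continuous_of_measurable (u := optDist P T t)
    (fun ω ↦ continuous_of_prefix_lipschitz (t := t) (K := 1) fun x x' ↦ by
      simpa using abs_optDist_sub_le P T t x x' ω) (hR.measurable_optDist ht)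

theorem optDist_congr (hR : Regular M T c) {t : ℕ} (ht : t ≤ T) {x x' : M.DecPath}
    {ω ω' : M.Path} (hω : Agree t ω ω') (hx : ∀ j ≤ t, x j = x' j) :
    optDist P T t x ω = optDist P T t x' ω' := by
  have h1 : {y | IsOpt P T t y ω} = {y | IsOpt P T t y ω'} :=
    Set.ext fun y ↦ hR.isOpt_congr ht hω fun _ _ ↦ rfl
  have h2 : (Finset.Iic t).restrict x = (Finset.Iic t).restrict x' :=
    funext fun j ↦ hx j (Finset.mem_Iic.1 j.2)
  rw [optDist, optDist, h1, h2]

/-- Initial segments of optimal decisions are optimal, and dropping a coordinate does not increase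
the distance. -/
theorem optDist_le_succ (hR : Regular M T c) {t : ℕ} (ht : t < T) (x : M.DecPath) (ω : M.Path) :
    optDist P T t x ω ≤ optDist P T (t + 1) x ω := by
  refine le_of_forall_gt fun r hr ↦ ?_
  obtain ⟨y, hy, hlt⟩ := (hR.optDist_lt_iff ht).1 hr
  refine (hR.optDist_lt_iff ht.le).2 ⟨y, hy.mono (Nat.le_succ t), lt_of_le_of_lt ?_ hlt⟩
  rw [prefixDist_le_iff (prefixDist_nonneg _ _ _)]
  exact fun j hj ↦ norm_sub_le_prefixDist (by omega) x y

end Regular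

/-! ### Dynamic programming for the growth condition -/

namespace Model

variable {M : Model} (P : (t : ℕ) → Measure (Vec (M.dZ t))) (T : ℕ)

/-- Properties of value functions of stage `u`, before the decision of stage `u + 1`. -/
structure IsValueFun (u : ℕ) (L B : ℝ) (f : M.DecPath → M.Path → ℝ) : Prop where
  neg_le : ∀ x ω, -B ≤ f x ω
  nonpos : ∀ x ω, f x ω ≤ 0
  lip : ∀ x x' ω, |f x ω - f x' ω| ≤ L * prefixDist u x x'
  meas : Measurable fun p : M.DecPath × M.Path ↦ f p.1 p.2
  nonanticipative : ∀ x, Nonanticipative (u + 1) (f x)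

/-- Gap of the decision `y` at stage `u + 1` plus expected later value. -/
def gapObj (f : M.DecPath → M.Path → ℝ) (u : ℕ) (x : M.DecPath) (ω : M.Path)
    (y : Vec (M.dX (u + 1))) : ℝ :=
  gap P T (u + 1) (Function.update x (u + 1) y) ω +
    ∫ p, f (Function.update x (u + 1) y) (extend (u + 1) ω p) ∂(stepKernel P (u + 1) ω)

/-- Infimum over policies of the expected gaps of stages `u + 1, …, u + k` minus `β` times the
truncated distance from the optimal decisions. -/
def growthVal (β B : ℝ) : ℕ → ℕ → M.DecPath → M.Path → ℝ
  | 0, _, x, ω => -(β * min (optDist P T T x ω) B)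
  | k + 1, u, x, ω => sInf (gapObj P T (growthVal β B k (u + 1)) u x ω '' pathFeas u x ω)

variable {P T}

theorem IsValueFun.measurable_right {u : ℕ} {L B : ℝ} {f : M.DecPath → M.Path → ℝ}
    (hf : IsValueFun u L B f) (x : M.DecPath) : Measurable (f x) :=
  hf.meas.comp (f := fun ω ↦ (x, ω)) (by fun_prop)

theorem IsValueFun.measurable_extend {u t : ℕ} {L B : ℝ} {f : M.DecPath → M.Path → ℝ}
    (hf : IsValueFun u L B f) (x : M.DecPath) (ω : M.Path) :
    Measurable fun p ↦ f x (extend t ω p) :=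
  (hf.measurable_right x).comp ((Model.measurable_extend t).comp (f := fun p ↦ (ω, p))
    (by fun_prop))

theorem IsValueFun.integrable {u t : ℕ} {L B : ℝ} {f : M.DecPath → M.Path → ℝ}
    (hf : IsValueFun u L B f) (x : M.DecPath) (ω : M.Path) {μ : Measure _} [IsFiniteMeasure μ] :
    Integrable (fun p ↦ f x (extend t ω p)) μ :=
  Integrable.of_bound (hf.measurable_extend x ω).aestronglyMeasurable B
    (Filter.Eventually.of_forall fun p ↦ by
      rw [Real.norm_eq_abs, abs_le]
      have h1 := hf.neg_le x (extend t ω p)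
      have h2 := hf.nonpos x (extend t ω p)
      exact ⟨h1, by linarith⟩)

theorem IsValueFun.neg_le_integral {u t : ℕ} {L B : ℝ} {f : M.DecPath → M.Path → ℝ}
    (hf : IsValueFun u L B f) (x : M.DecPath) (ω : M.Path) {μ : Measure _}
    [IsProbabilityMeasure μ] : -B ≤ ∫ p, f x (extend t ω p) ∂μ := by
  have h := integral_mono (μ := μ) (integrable_const (-B)) (hf.integrable (t := t) x ω)
    fun p ↦ hf.neg_le x (extend t ω p)
  simpa using h

end Model

namespace Regular

variable {M : Model} {T : ℕ} {c : Moduli} {P : (t : ℕ) → Measure (Vec (M.dZ t))}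
  [∀ t, IsProbabilityMeasure (P t)]

section Step

variable {u : ℕ} {L B : ℝ} {f : M.DecPath → M.Path → ℝ}

theorem abs_gapObj_sub_le (hR : Regular M T c) (hu : u < T) (hL : 0 ≤ L)
    (hf : IsValueFun (u + 1) L B f) (x x' : M.DecPath) (ω : M.Path) (y y' : Vec (M.dX (u + 1))) :
    |gapObj P T f u x ω y - gapObj P T f u x' ω y'| ≤
      (c.gapLip T (u + 1) + L) * (prefixDist u x x' + ‖y - y'‖) := by
  set X := Function.update x (u + 1) y
  set X' := Function.update x' (u + 1) y'
  have hd : prefixDist (u + 1) X X' ≤ prefixDist u x x' + ‖y - y'‖ :=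
    prefixDist_update_le u x x' y y'
  have hd0 := prefixDist_nonneg (u + 1) X X'
  have h1 : |gap P T (u + 1) X ω - gap P T (u + 1) X' ω| ≤
      c.gapLip T (u + 1) * prefixDist (u + 1) X X' :=
    hR.abs_gap_sub_le (show u + 1 ≤ T from hu) (near_refl _ hd0 ω) fun _ hj ↦
      norm_sub_le_prefixDist hj X X'
  have h2 := abs_integral_sub_integral_le (μ := stepKernel P (u + 1) ω)
    (hf.measurable_extend (t := u + 1) X ω).aestronglyMeasurable
    (hf.measurable_extend (t := u + 1) X' ω).aestronglyMeasurable
    (mul_nonneg hL hd0) fun p ↦ hf.lip X X' (extend (u + 1) ω p)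
  rw [gapObj, gapObj, add_sub_add_comm]
  refine (abs_add_le _ _).trans ((add_le_add h1 h2).trans ?_)
  rw [← add_mul]
  have := hR.gapLip_nonneg (show u + 1 ≤ T from hu)
  gcongr

theorem continuous_gapObj (hR : Regular M T c) (hu : u < T) (hL : 0 ≤ L)
    (hf : IsValueFun (u + 1) L B f) (x : M.DecPath) (ω : M.Path) :
    Continuous (gapObj P T f u x ω) := by
  have : LipschitzWith (Real.toNNReal (c.gapLip T (u + 1) + L)) (gapObj P T f u x ω) := by
    refine LipschitzWith.of_dist_le_mul fun y y' ↦ ?_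
    rw [Real.dist_eq, dist_eq_norm]
    have h := hR.abs_gapObj_sub_le (P := P) hu hL hf x x ω y y'
    rw [prefixDist, dist_self, zero_add] at h
    refine h.trans ?_
    gcongr
    exact Real.le_coe_toNNReal _
  exact this.continuous

theorem measurable_gapObj (hR : Regular M T c) (hu : u < T)
    (hf : IsValueFun (u + 1) L B f) (y : Vec (M.dX (u + 1))) :
    Measurable fun p : M.DecPath × M.Path ↦ gapObj P T f u p.1 p.2 y := by
  have hup : Measurable fun x : M.DecPath ↦ Function.update x (u + 1) y :=
    (measurable_update_prod (u + 1)).comp (f := fun x : M.DecPath ↦ (x, y)) (by fun_prop)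
  refine Measurable.add ?_ ?_
  · exact (hR.measurable_gap (show u + 1 ≤ T from hu)).comp
      (f := fun p : M.DecPath × M.Path ↦ (Function.update p.1 (u + 1) y, p.2)) (by fun_prop)
  · have h1 : Measurable fun q : (M.DecPath × M.Path) × (Vec (M.dE (u + 1 + 1)) ×
        Vec (M.dZ (u + 1))) ↦ f (Function.update q.1.1 (u + 1) y) (extend (u + 1) q.1.2 q.2) := by
      refine hf.meas.comp (Measurable.prodMk (hup.comp (by fun_prop)) ?_)
      exact (Model.measurable_extend (u + 1)).comp (f := fun q : (M.DecPath × M.Path) ×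
        (Vec (M.dE (u + 1 + 1)) × Vec (M.dZ (u + 1))) ↦ (q.1.2, q.2)) (by fun_prop)
    exact (h1.stronglyMeasurable.integral_kernel_prod_right'
      (κ := (stepKernel P (u + 1)).comap Prod.snd measurable_snd)).measurable

theorem stepKernel_congr {t : ℕ} {ω ω' : M.Path} (h : Agree t ω ω') :
    stepKernel P t ω = stepKernel P t ω' := by
  rw [stepKernel_apply, stepKernel_apply, h.hist_eq]

theorem gapObj_congr (hR : Regular M T c) (hu : u < T) (hf : IsValueFun (u + 1) L B f)
    (hL : 0 ≤ L) {x x' : M.DecPath} (hx : ∀ j ≤ u, x j = x' j)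
    {ω ω' : M.Path} (h : Agree (u + 1) ω ω') (y : Vec (M.dX (u + 1))) :
    gapObj P T f u x ω y = gapObj P T f u x' ω' y := by
  have h0 : gapObj P T f u x ω y = gapObj P T f u x' ω y := by
    have h1 := hR.abs_gapObj_sub_le (P := P) hu hL hf x x' ω y y
    have h2 : prefixDist u x x' = 0 := le_antisymm
      ((prefixDist_le_iff le_rfl).2 fun j hj ↦ by simp [hx j hj]) (prefixDist_nonneg _ _ _)
    rw [h2, sub_self, norm_zero, add_zero, mul_zero] at h1
    exact sub_eq_zero.1 (abs_nonpos_iff.1 h1)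
  rw [h0, gapObj, gapObj, hR.gap_congr (show u + 1 ≤ T from hu) h fun _ _ ↦ rfl,
    stepKernel_congr h]
  congr 1
  exact integral_congr_ae (Filter.Eventually.of_forall fun p ↦
    hf.nonanticipative _ _ _ (h.extend p))

/-- One step of the dynamic programming recursion preserves regularity. -/
theorem isValueFun_step (hR : Regular M T c) (hu : u < T) (hL : 0 ≤ L)
    (hf : IsValueFun (u + 1) L B f) :
    ∃ L', 0 ≤ L' ∧ IsValueFun u L' B fun x ω ↦ sInf (gapObj P T f u x ω '' pathFeas u x ω) := by
  have hK : 0 ≤ c.gapLip T (u + 1) + L :=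
    add_nonneg (hR.gapLip_nonneg (show u + 1 ≤ T from hu)) hL
  have hX := hR.LX_nonneg hu (u + 1)
  have hS := c.stateLip_nonneg T (u + 1)
  have hbdd : ∀ x ω, BddBelow (gapObj P T f u x ω '' pathFeas u x ω) := fun x ω ↦
    bddBelow_image_of_compact (hR.isCompact_pathFeas hu x ω) (hR.continuous_gapObj hu hL hf x ω)
  have hup : ∀ (x : M.DecPath) y, ∀ j ≤ u, Function.update x (u + 1) y j = x j :=
    fun x y j hj ↦ Function.update_of_ne (by omega) _ _
  refine ⟨(c.gapLip T (u + 1) + L) * (1 + c.LX (u + 1) * (c.stateLip T (u + 1) + 1)),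
    by positivity, ⟨fun x ω ↦ ?_, fun x ω ↦ ?_, fun x x' ω ↦ ?_, ?_, fun x ω ω' h ↦ ?_⟩⟩
  -- Gaps of feasible decisions are nonnegative, so the lower bound of `f` is inherited with the
  -- same B.
  · refine le_csInf ((hR.nonempty_pathFeas hu x ω).image _) ?_
    rintro _ ⟨y, hy, rfl⟩
    have h1 : 0 ≤ gap P T (u + 1) (Function.update x (u + 1) y) ω := by
      refine hR.gap_succ_nonneg hu ?_
      rw [Function.update_self, hR.pathFeas_congr hu (agree_refl _ ω) (hup x y)]
      exact hy
    have h2 := hf.neg_le_integral (t := u + 1) (Function.update x (u + 1) y) ω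
      (μ := stepKernel P (u + 1) ω)
    rw [gapObj]
    linarith
  -- A decision with zero gap keeps the value nonpositive.
  · obtain ⟨y, hy, h1⟩ := hR.exists_gap_update_eq_zero (P := P) hu x ω
    refine (csInf_le (hbdd x ω) ⟨y, hy, rfl⟩).trans ?_
    rw [gapObj, h1, zero_add]
    exact integral_nonpos fun p ↦ hf.nonpos _ _
  · have h1 := hR.abs_sInf_feas_sub_le hu (s := M.state x ω.1 ω.2 (u + 1))
      (s' := M.state x' ω.1 ω.2 (u + 1)) (x := x u) (x' := x' u) (h := M.hist (u + 1) ω.1)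
      (hR.continuous_gapObj (P := P) hu hL hf x ω) (hR.continuous_gapObj (P := P) hu hL hf x' ω)
      (a := (c.gapLip T (u + 1) + L) * prefixDist u x x') hK
      fun y y' ↦ (hR.abs_gapObj_sub_le hu hL hf x x' ω y y').trans_eq (by ring)
    have hd := prefixDist_nonneg u x x'
    have h2 := hR.norm_state_sub_le (show u + 1 ≤ T from hu) (near_refl (u + 1) hd ω)
      fun j hj ↦ norm_sub_le_prefixDist (show j ≤ u by omega) x x'
    have h3 := norm_sub_le_prefixDist (le_refl u) x x'
    refine h1.trans ?_
    calc _ ≤ (c.gapLip T (u + 1) + L) * prefixDist u x x' + (c.gapLip T (u + 1) + L) *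
          (c.LX (u + 1) * (c.stateLip T (u + 1) * prefixDist u x x' + prefixDist u x x')) := by
            gcongr
      _ = _ := by ring
  · refine hR.measurable_sInf_feas (Θ := M.DecPath × M.Path) hu
      (s := fun p ↦ M.state p.1 p.2.1 p.2.2 (u + 1)) (x := fun p ↦ p.1 u)
      (h := fun p ↦ M.hist (u + 1) p.2.1) (φ := fun p y ↦ gapObj P T f u p.1 p.2 y)
      (hR.measurable_state hu) (by fun_prop) (measurable_hist_path (u + 1))
      (fun p ↦ hR.continuous_gapObj hu hL hf _ _) (hR.measurable_gapObj hu hf)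
  · have h1 : gapObj P T f u x ω = gapObj P T f u x ω' :=
      funext fun y ↦ hR.gapObj_congr hu hf hL (fun _ _ ↦ rfl) h y
    simp only [h1, hR.pathFeas_congr hu h fun _ _ ↦ rfl]

end Step

variable {β B : ℝ}

theorem isValueFun_growthVal (hR : Regular M T c) (hβ : 0 ≤ β) (hB : 0 ≤ B) {k u : ℕ}
    (hk : u + k = T) : ∃ L, 0 ≤ L ∧ IsValueFun u L (β * B) (growthVal P T β B k u) := by
  induction k generalizing u with
  | zero =>
    obtain rfl : u = T := by omega
    -- Truncating the distance at B is what bounds all value functions, so that they are integrable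
    -- under every kernel.
    refine ⟨β, hβ, ⟨fun x ω ↦ ?_, fun x ω ↦ ?_, fun x x' ω ↦ ?_, ?_, fun x ω ω' h ↦ ?_⟩⟩
    · have : min (optDist P u u x ω) B ≤ B := min_le_right _ _
      rw [growthVal]
      gcongr
    · have : 0 ≤ min (optDist P u u x ω) B := le_min (optDist_nonneg _ _ _ _ _) hB
      rw [growthVal, neg_nonpos]
      positivity
    · rw [growthVal, growthVal, ← neg_sub', abs_neg, ← mul_sub, abs_mul, abs_of_nonneg hβ]
      gcongr
      refine (abs_inf_sub_inf_le_abs _ _ _).trans (abs_optDist_sub_le P u u x x' ω)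
    · exact (((hR.measurable_optDist_uncurry le_rfl).min measurable_const).const_mul β).neg
    · rw [growthVal, growthVal, hR.optDist_congr le_rfl (h.mono (Nat.le_succ u)) fun _ _ ↦ rfl]
  | succ k ih =>
    obtain ⟨L, hL, hf⟩ := ih (u := u + 1) (by omega)
    exact hR.isValueFun_step (by omega) hL hf

theorem growthVal_succ_le (hR : Regular M T c) (hβ : 0 ≤ β) (hB : 0 ≤ B) {k u : ℕ}
    (hk : u + (k + 1) = T) {x : M.DecPath} {ω : M.Path} (hx : x (u + 1) ∈ pathFeas u x ω) :
    growthVal P T β B (k + 1) u x ω ≤ gap P T (u + 1) x ω +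
      ∫ p, growthVal P T β B k (u + 1) x (extend (u + 1) ω p) ∂(stepKernel P (u + 1) ω) := by
  obtain ⟨L, hL, hf⟩ := hR.isValueFun_growthVal (P := P) (u := u + 1) (k := k) hβ hB (by omega)
  have h := csInf_le (bddBelow_image_of_compact (hR.isCompact_pathFeas (by omega) x ω)
    (hR.continuous_gapObj (P := P) (by omega) hL hf x ω)) ⟨_, hx, rfl⟩
  rw [gapObj, Function.update_eq_self] at h
  exact h

/-- One may continue with zero gaps. The prefix already has its distance from the optimal prefixes,
and later stages can only increase it. -/
theorem growthVal_le (hR : Regular M T c) (hβ : 0 ≤ β) (hB : 0 ≤ B) {k u : ℕ}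
    (hk : u + k = T) (x : M.DecPath) (ω : M.Path) :
    growthVal P T β B k u x ω ≤ -(β * min (optDist P T u x ω) B) := by
  induction k generalizing u x ω with
  | zero =>
    obtain rfl : u = T := by omega
    exact le_rfl
  | succ k ih =>
    have hu : u < T := by omega
    obtain ⟨L, hL, hf⟩ := hR.isValueFun_growthVal (P := P) (u := u + 1) (k := k) hβ hB (by omega)
    obtain ⟨y, hy, h1⟩ := hR.exists_gap_update_eq_zero (P := P) hu x ω
    have hup : ∀ j ≤ u, Function.update x (u + 1) y j = x j :=
      fun j hj ↦ Function.update_of_ne (by omega) _ _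
    refine (csInf_le (bddBelow_image_of_compact (hR.isCompact_pathFeas hu x ω)
      (hR.continuous_gapObj (P := P) hu hL hf x ω)) ⟨y, hy, rfl⟩).trans ?_
    rw [gapObj, h1, zero_add]
    set X := Function.update x (u + 1) y with hX
    have h2 : ∀ p, growthVal P T β B k (u + 1) X (extend (u + 1) ω p) ≤
        -(β * min (optDist P T u x ω) B) := by
      intro p
      refine (ih (by omega) X (extend (u + 1) ω p)).trans ?_
      rw [hR.optDist_congr (show u + 1 ≤ T from hu) (agree_extend (u + 1) ω p) fun _ _ ↦ rfl]
      have h3 := hR.optDist_le_succ (P := P) hu X ω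
      rw [hR.optDist_congr (P := P) hu.le (agree_refl u ω) hup] at h3
      gcongr
    have h4 := integral_mono (μ := stepKernel P (u + 1) ω) (hf.integrable (t := u + 1) X ω)
      (integrable_const _) h2
    simpa using h4

end Regular

/-! ### Expected cost of a policy in terms of its gaps -/

namespace Model

variable {M : Model}

theorem Policy.path_congr (x : M.Policy) {t : ℕ} {ω ω' : M.Path} (h : Agree t ω ω') {j : ℕ}
    (hj : j ≤ t) : x.path ω.1 ω.2 j = x.path ω'.1 ω'.2 j := by
  have h1 : (Finset.Iio j).restrict ω.2 = (Finset.Iio j).restrict ω'.2 :=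
    funext fun i ↦ h.2 i ((Finset.mem_Iio.1 i.2).trans_le hj)
  rw [Policy.path, Policy.path, (h.mono hj).hist_eq, h1]

theorem Policy.measurable_path (x : M.Policy) : Measurable fun ω : M.Path ↦ x.path ω.1 ω.2 :=
  measurable_pi_iff.2 fun t ↦ (x.measurable t).comp
    (((measurable_hist t).comp measurable_fst).prodMk
      ((Finset.measurable_restrict _).comp measurable_snd))

end Model

namespace Regular

variable {M : Model} {T : ℕ} {c : Moduli} {P : (t : ℕ) → Measure (Vec (M.dZ t))}

/-- The Bellman recursion in terms of realizations: replacing ξ_{u+1} and ζ_u leaves state and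
decision of stage u unchanged because the policy is nonanticipative. -/
theorem pathCost_of_lt (hR : Regular M T c) {u : ℕ} (hu : u < T) (x : M.Policy) (ω : M.Path) :
    pathCost P T u (x.path ω.1 ω.2) ω =
      ∫ z, (M.C u (M.state (x.path ω.1 ω.2) ω.1 ω.2 u) (x.path ω.1 ω.2 u) (M.hist u ω.1) z +
        ∫ e, pathVal P T u (x.path (extend u ω (e, z)).1 (extend u ω (e, z)).2)
          (extend u ω (e, z)) ∂(M.κ u (M.hist u ω.1))) ∂(P u) := by
  rw [pathCost, show T - u = (T - (u + 1)) + 1 by omega, Model.costToGo_succ]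
  refine integral_congr_ae (Filter.Eventually.of_forall fun z ↦ ?_)
  simp only [Model.stageVal]
  congr 2
  ext e
  have ha := agree_extend u ω (e, z)
  rw [pathVal, Model.state, hR.state_congr hu.le ha fun j hj ↦ x.path_congr ha hj.le,
    x.path_congr ha le_rfl, ha.1 u le_rfl]
  simp only [Model.extend, Function.update_self, snoc_hist]
  rfl

variable [∀ t, IsProbabilityMeasure (P t)]

theorem measurable_stageCost (hR : Regular M T c) {t : ℕ} (ht : t ≤ T) (x : M.Policy) :
    Measurable fun ω : M.Path ↦ M.stageCost (x.path ω.1 ω.2) ω.1 ω.2 t := by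
  have hX := x.measurable_path
  have h1 := (hR.measurable_state ht).comp (hX.prodMk measurable_id)
  have h2 := (measurable_pi_apply t).comp hX
  have h3 : Measurable fun ω : M.Path ↦ M.hist t ω.1 := (measurable_hist t).comp measurable_fst
  exact (hR.C_cont t ht).measurable.comp (h1.prodMk (h2.prodMk (h3.prodMk
    ((measurable_pi_apply t).comp measurable_snd))))

theorem stageCost_extend (hR : Regular M T c) {t : ℕ} (ht : t ≤ T) (x : M.Policy) (ω : M.Path)
    (p : Vec (M.dE (t + 1)) × Vec (M.dZ t)) :
    M.stageCost (x.path (extend t ω p).1 (extend t ω p).2) (extend t ω p).1 (extend t ω p).2 t =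
      M.C t (M.state (x.path ω.1 ω.2) ω.1 ω.2 t) (x.path ω.1 ω.2 t) (M.hist t ω.1) p.2 := by
  have ha := agree_extend t ω p
  rw [Model.stageCost, hR.state_congr ht ha fun j hj ↦ x.path_congr ha hj.le,
    x.path_congr ha le_rfl, ha.hist_eq]
  simp [Model.extend]

theorem nonanticipative_stageCost (hR : Regular M T c) {t : ℕ} (ht : t ≤ T) (x : M.Policy) :
    Nonanticipative (t + 1) fun ω : M.Path ↦ M.stageCost (x.path ω.1 ω.2) ω.1 ω.2 t := by
  intro ω ω' h
  have h' := h.mono (Nat.le_succ t)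
  simp only [Model.stageCost]
  rw [hR.state_congr ht h' fun j hj ↦ x.path_congr h' hj.le, x.path_congr h' le_rfl, h'.hist_eq,
    h.2 t (Nat.lt_succ_self t)]

/-- All feasible policies have integrable costs if one of them has. -/
theorem integrable_stageCost (hR : Regular M T c) (hP : FiniteCost M T P) {x : M.Policy}
    (hx : x.IsFeasible T) {t : ℕ} (ht : t ≤ T) :
    Integrable (fun ω : M.Path ↦ M.stageCost (x.path ω.1 ω.2) ω.1 ω.2 t) (M.law P) := by
  obtain ⟨x', hx', h_int⟩ := hP.policy
  obtain ⟨R, hR0, hb0, hb⟩ := hR.exists_bound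
  have hbd : ∀ (z : M.Policy), z.IsFeasible T → ∀ ω : M.Path, ∀ j ≤ T,
      ‖z.path ω.1 ω.2 j‖ ≤ R := by
    intro z hz ω j hj
    cases j with
    | zero => exact hb0 _ (hz ω.1 ω.2).1
    | succ u => exact hb u hj (z.path ω.1 ω.2) ω _ ((hz ω.1 ω.2).2 u hj)
  refine integrable_of_abs_sub_le (f := fun ω : M.Path ↦ M.stageCost (x'.path ω.1 ω.2) ω.1 ω.2 t)
    (a := c.LC t * (c.stateLip T t * (2 * R) + 2 * R))
    (hR.measurable_stageCost ht x).aestronglyMeasurable (fun ω ↦ ?_) (h_int t ht)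
  -- Two feasible policies stay within 2R of each other along the same realization. Their states,
  -- hence their stage costs, then differ by a constant at most.
  have hd : ∀ j ≤ T, ‖x'.path ω.1 ω.2 j - x.path ω.1 ω.2 j‖ ≤ 2 * R := fun j hj ↦ by
    have := norm_sub_le (x'.path ω.1 ω.2 j) (x.path ω.1 ω.2 j)
    have := hbd x hx ω j hj
    have := hbd x' hx' ω j hj
    linarith
  have h1 := hR.norm_state_sub_le ht (near_refl t (by positivity : 0 ≤ 2 * R) ω)
    fun j hj ↦ hd j (by omega)
  refine (hR.C_lip t ht _ _ _ _ _ _ _).trans ?_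
  have := c.LC_nonneg t
  rw [sub_self, norm_zero, add_zero]
  gcongr
  exact hd t ht

/-- Expected cost to go of a stage in terms of the cost of the stage and the later value `w`. -/
theorem integral_pathCost (hR : Regular M T c) (hP : FiniteCost M T P) {x : M.Policy}
    (hx : x.IsFeasible T) {t : ℕ} (ht : t ≤ T) {w : M.Path → ℝ} (hwm : Measurable w)
    (hwn : Nonanticipative (t + 1) w) (hwi : Integrable w (M.law P))
    (hw : ∀ ω : M.Path, pathCost P T t (x.path ω.1 ω.2) ω =
      ∫ z, (M.C t (M.state (x.path ω.1 ω.2) ω.1 ω.2 t) (x.path ω.1 ω.2 t) (M.hist t ω.1) z +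
        ∫ e, w (extend t ω (e, z)) ∂(M.κ t (M.hist t ω.1))) ∂(P t)) :
    Integrable (fun ω : M.Path ↦ pathCost P T t (x.path ω.1 ω.2) ω) (M.law P) ∧
      ∫ ω : M.Path, pathCost P T t (x.path ω.1 ω.2) ω ∂(M.law P) =
        ∫ ω : M.Path, M.stageCost (x.path ω.1 ω.2) ω.1 ω.2 t ∂(M.law P) + ∫ ω, w ω ∂(M.law P) := by
  have hci := hR.integrable_stageCost hP hx ht
  set f : M.Path → ℝ := fun ω ↦ M.stageCost (x.path ω.1 ω.2) ω.1 ω.2 t + w ω with hf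
  have hfm : Measurable f := (hR.measurable_stageCost ht x).add hwm
  have hfn : Nonanticipative (t + 1) f := fun ω ω' h ↦ by
    have := hR.nonanticipative_stageCost ht x ω ω' h
    simp only at this
    simp only [hf, this, hwn ω ω' h]
  have hfi : Integrable f (M.law P) := hci.add hwi
  have hae : (fun ω : M.Path ↦ pathCost P T t (x.path ω.1 ω.2) ω) =ᵐ[M.law P]
      fun ω ↦ ∫ p, f (extend t ω p) ∂(stepKernel P t ω) := by
    filter_upwards [ae_integrable_extend P hfm hfn hfi, ae_integrable_extend P hwm hwn hwi]
      with ω h1 h2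
    rw [stepKernel_apply] at h1 h2 ⊢
    -- The nested problem averages over ζ_t outside and ξ_{t+1} inside. Fubini needs conditional
    -- integrability, which holds only for almost every realization.
    rw [hw ω, integral_prod_symm _ h1]
    refine integral_congr_ae ?_
    filter_upwards [h2.prod_left_ae] with z hz
    simp only [hf, hR.stageCost_extend ht x ω]
    rw [integral_add (integrable_const _) hz]
    simp
  refine ⟨(integrable_congr hae).2 (integrable_integral_extend P hfm hfn hfi), ?_⟩
  rw [integral_congr_ae hae, integral_extend P hfm hfn hfi, integral_add hci hwi]

theorem integrable_gap_succ (hR : Regular M T c) {x : M.Policy} (hx : x.IsFeasible T) {u : ℕ}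
    (hu : u < T) :
    Integrable (fun ω : M.Path ↦ gap P T (u + 1) (x.path ω.1 ω.2) ω) (M.law P) := by
  have hm := (hR.measurable_gap (P := P) (show u + 1 ≤ T from hu)).comp
    (x.measurable_path.prodMk measurable_id)
  refine Integrable.of_bound hm.aestronglyMeasurable (c.LQ T (u + 1) * c.A)
    (Filter.Eventually.of_forall fun ω ↦ ?_)
  have hf : x.path ω.1 ω.2 (u + 1) ∈ pathFeas u (x.path ω.1 ω.2) ω := (hx ω.1 ω.2).2 u hu
  have h1 := hR.gap_succ_nonneg (P := P) hu hf
  rw [Real.norm_eq_abs, abs_of_nonneg h1]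
  exact hR.gap_succ_le hu hf

theorem nonanticipative_pathVal (hR : Regular M T c) {u : ℕ} (hu : u < T) (x : M.Policy) :
    Nonanticipative (u + 1) fun ω : M.Path ↦ pathVal P T u (x.path ω.1 ω.2) ω := by
  intro ω ω' h
  have := hR.abs_pathVal_sub_le (P := P) hu (x := x.path ω.1 ω.2) (x' := x.path ω'.1 ω'.2)
    (h.near le_rfl) fun j hj ↦ by simp [x.path_congr h (show j ≤ u + 1 by omega)]
  rw [mul_zero] at this
  exact sub_eq_zero.1 (abs_nonpos_iff.1 this)

theorem integrable_pathVal_of_pathCost (hR : Regular M T c) {x : M.Policy}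
    (hx : x.IsFeasible T) {u : ℕ} (hu : u < T)
    (h : Integrable (fun ω : M.Path ↦ pathCost P T (u + 1) (x.path ω.1 ω.2) ω) (M.law P)) :
    Integrable (fun ω : M.Path ↦ pathVal P T u (x.path ω.1 ω.2) ω) (M.law P) := by
  refine (h.sub (hR.integrable_gap_succ hx hu)).congr (Filter.Eventually.of_forall fun ω ↦ ?_)
  simp [gap]

theorem integral_pathCost_last (hR : Regular M T c) (hP : FiniteCost M T P) {x : M.Policy}
    (hx : x.IsFeasible T) :
    Integrable (fun ω : M.Path ↦ pathCost P T T (x.path ω.1 ω.2) ω) (M.law P) ∧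
      ∫ ω : M.Path, pathCost P T T (x.path ω.1 ω.2) ω ∂(M.law P) =
        ∫ ω : M.Path, M.stageCost (x.path ω.1 ω.2) ω.1 ω.2 T ∂(M.law P) := by
  have h := hR.integral_pathCost hP hx le_rfl (w := fun _ ↦ 0) measurable_const
    (fun _ _ _ ↦ rfl) (integrable_const 0) fun ω ↦ by simp [pathCost, Model.costToGo]
  simpa using h

theorem integral_pathCost_of_lt (hR : Regular M T c) (hP : FiniteCost M T P) {x : M.Policy}
    (hx : x.IsFeasible T) {u : ℕ} (hu : u < T)
    (h : Integrable (fun ω : M.Path ↦ pathCost P T (u + 1) (x.path ω.1 ω.2) ω) (M.law P)) :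
    Integrable (fun ω : M.Path ↦ pathCost P T u (x.path ω.1 ω.2) ω) (M.law P) ∧
      ∫ ω : M.Path, pathCost P T u (x.path ω.1 ω.2) ω ∂(M.law P) =
        ∫ ω : M.Path, M.stageCost (x.path ω.1 ω.2) ω.1 ω.2 u ∂(M.law P) +
          ∫ ω : M.Path, pathVal P T u (x.path ω.1 ω.2) ω ∂(M.law P) := by
  have hm := (hR.measurable_pathVal (P := P) hu).comp (x.measurable_path.prodMk measurable_id)
  simp only [Function.comp_def, id] at hm
  have hn := hR.nonanticipative_pathVal (P := P) hu x
  have hi := hR.integrable_pathVal_of_pathCost hx hu h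
  have hw := hR.pathCost_of_lt (P := P) hu x
  generalize hv : (fun ω : M.Path ↦ pathVal P T u (x.path ω.1 ω.2) ω) = w at hm hn hi
  have hv' : ∀ ω : M.Path, pathVal P T u (x.path ω.1 ω.2) ω = w ω := congrFun hv
  simp only [hv'] at hw ⊢
  exact hR.integral_pathCost hP hx hu.le hm hn hi hw

theorem integrable_pathCost (hR : Regular M T c) (hP : FiniteCost M T P) {x : M.Policy}
    (hx : x.IsFeasible T) {k t : ℕ} (hk : t + k = T) :
    Integrable (fun ω : M.Path ↦ pathCost P T t (x.path ω.1 ω.2) ω) (M.law P) := by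
  induction k generalizing t with
  | zero =>
    obtain rfl : t = T := by omega
    exact (hR.integral_pathCost_last hP hx).1
  | succ k ih => exact (hR.integral_pathCost_of_lt hP hx (by omega) (ih (by omega))).1

/-- The expected cost of a feasible policy exceeds the optimal value by its expected gaps. -/
theorem expCost_sub_optVal (hR : Regular M T c) (hP : FiniteCost M T P) {x : M.Policy}
    (hx : x.IsFeasible T) : M.expCost T P x - M.optVal T P =
      ∑ t ∈ Finset.range (T + 1), ∫ ω : M.Path, gap P T t (x.path ω.1 ω.2) ω ∂(M.law P) := by
  have h_int : ∀ t ≤ T, Integrable (fun ω : M.Path ↦ pathCost P T t (x.path ω.1 ω.2) ω) (M.law P) :=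
    fun t ht ↦ hR.integrable_pathCost hP hx (Nat.add_sub_of_le ht)
  have h0 : ∫ ω : M.Path, gap P T 0 (x.path ω.1 ω.2) ω ∂(M.law P) =
      ∫ ω : M.Path, pathCost P T 0 (x.path ω.1 ω.2) ω ∂(M.law P) - M.optVal T P := by
    have hae : (fun ω : M.Path ↦ gap P T 0 (x.path ω.1 ω.2) ω) =ᵐ[M.law P]
        fun ω ↦ pathCost P T 0 (x.path ω.1 ω.2) ω - M.optVal T P := by
      -- The gap of stage 0 uses the fixed ξ₀, the path cost the first entry of the realization;
      -- they agree almost surely.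
      filter_upwards [ae_hist_zero P] with ω hω
      rw [gap, pathCost, hω]
      rfl
    rw [integral_congr_ae hae, integral_sub (h_int 0 (Nat.zero_le T)) (integrable_const _)]
    simp
  have h1 : ∀ u ∈ Finset.range T, ∫ ω : M.Path, gap P T (u + 1) (x.path ω.1 ω.2) ω ∂(M.law P) =
      ∫ ω : M.Path, pathCost P T (u + 1) (x.path ω.1 ω.2) ω ∂(M.law P) -
        ∫ ω : M.Path, pathVal P T u (x.path ω.1 ω.2) ω ∂(M.law P) := fun u hu ↦ by
    have hu := Finset.mem_range.1 hu
    exact integral_sub (h_int (u + 1) hu)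
      (hR.integrable_pathVal_of_pathCost hx hu (h_int (u + 1) hu))
  have h2 : ∀ u ∈ Finset.range T,
      ∫ ω : M.Path, M.stageCost (x.path ω.1 ω.2) ω.1 ω.2 u ∂(M.law P) =
      ∫ ω : M.Path, pathCost P T u (x.path ω.1 ω.2) ω ∂(M.law P) -
        ∫ ω : M.Path, pathVal P T u (x.path ω.1 ω.2) ω ∂(M.law P) := fun u hu ↦ by
    have hu := Finset.mem_range.1 hu
    rw [(hR.integral_pathCost_of_lt hP hx hu (h_int (u + 1) hu)).2]
    ring
  rw [Model.expCost, integral_finsetSum _ fun t ht ↦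
    hR.integrable_stageCost hP hx (Nat.lt_succ_iff.1 (Finset.mem_range.1 ht)),
    Finset.sum_range_succ, Finset.sum_congr rfl h2, ← (hR.integral_pathCost_last hP hx).2,
    Finset.sum_range_succ' _ T, Finset.sum_congr rfl h1, h0, Finset.sum_sub_distrib,
    Finset.sum_sub_distrib]
  -- Splitting off either the last or the first term of the same sum performs the telescoping.
  have h3 := Finset.sum_range_succ (fun t ↦ ∫ ω : M.Path, pathCost P T t (x.path ω.1 ω.2) ω
    ∂(M.law P)) T
  rw [Finset.sum_range_succ'] at h3
  linarith

end Regular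

/-! ### Consequences of the growth condition -/

namespace Model

variable {M : Model}

/-- Decisions generated from `x` by decision rules `σ`: after stage `u`, the coordinates
`1, …, u` have been chosen by the rules. -/
def rulePath (σ : (u : ℕ) → M.DecPath × M.Path → Vec (M.dX (u + 1))) (x : M.DecPath) :
    ℕ → M.Path → M.DecPath
  | 0, _ => x
  | u + 1, ω => Function.update (rulePath σ x u ω) (u + 1) (σ u (rulePath σ x u ω, trunc (u + 1) ω))

variable {σ : (u : ℕ) → M.DecPath × M.Path → Vec (M.dX (u + 1))} {x : M.DecPath}

theorem measurable_rulePath (hσ : ∀ u, Measurable (σ u)) (u : ℕ) :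
    Measurable (rulePath σ x u) := by
  induction u with
  | zero => exact measurable_const
  | succ u ih =>
    exact (measurable_update_prod (u + 1)).comp (ih.prodMk ((hσ u).comp
      (ih.prodMk (measurable_trunc (u + 1)))))

theorem trunc_congr {t : ℕ} {ω ω' : M.Path} (h : Agree t ω ω') : trunc t ω = trunc t ω' := by
  ext1
  · ext1 i
    by_cases hi : i ≤ t <;> simp [trunc, hi, h.1]
  · ext1 i
    by_cases hi : i < t <;> simp [trunc, hi, h.2]

/-- The rules are arbitrary functions of a whole realization; feeding them the truncated one is what
makes the resulting path nonanticipative. -/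
theorem nonanticipative_rulePath (u : ℕ) : Nonanticipative u (rulePath σ x u) := by
  induction u with
  | zero => exact fun _ _ _ ↦ rfl
  | succ u ih =>
    intro ω ω' h
    rw [rulePath, rulePath, ih ω ω' (h.mono (Nat.le_succ u)), trunc_congr h]

theorem rulePath_apply {u j : ℕ} (hj : j ≤ u) (ω : M.Path) :
    rulePath σ x u ω j = rulePath σ x j ω j := by
  induction u with
  | zero => obtain rfl : j = 0 := by omega
            rfl
  | succ u ih =>
    rcases hj.eq_or_lt with rfl | hlt
    · rfl
    · rw [rulePath, Function.update_of_ne (by omega), ih (by omega)]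

/-- The policy given by decision rules. -/
def rulePolicy (hσ : ∀ u, Measurable (σ u)) (x : M.DecPath) : M.Policy where
  toFun t q := rulePath σ x t (padExo q.1, padEndo q.2) t
  measurable t := (measurable_pi_apply t).comp ((measurable_rulePath hσ t).comp
    ((measurable_padExo.comp measurable_fst).prodMk (measurable_padEndo.comp measurable_snd)))

theorem rulePolicy_path (hσ : ∀ u, Measurable (σ u)) {u j : ℕ} (hj : j ≤ u) (ω : M.Path) :
    (rulePolicy hσ x).path ω.1 ω.2 j = rulePath σ x u ω j := by
  rw [rulePath_apply hj]
  change rulePath σ x j (padExo (M.hist j ω.1), padEndo ((Finset.Iio j).restrict ω.2)) j = _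
  rw [← trunc_eq_pad, nonanticipative_rulePath j _ _ (agree_trunc j ω)]

end Model

namespace Regular

variable {M : Model} {T : ℕ} {c : Moduli} {P : (t : ℕ) → Measure (Vec (M.dZ t))}
  [∀ t, IsProbabilityMeasure (P t)] {β B : ℝ}

/-- Nearly optimal decision rules for the dynamic program `growthVal`. -/
theorem exists_rules (hR : Regular M T c) (hβ : 0 ≤ β) (hB : 0 ≤ B) {ε : ℝ} (hε : 0 < ε) :
    ∃ σ : (u : ℕ) → M.DecPath × M.Path → Vec (M.dX (u + 1)), (∀ u, Measurable (σ u)) ∧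
      ∀ u < T, ∀ p : M.DecPath × M.Path, σ u p ∈ pathFeas u p.1 p.2 ∧
        gapObj P T (growthVal P T β B (T - (u + 1)) (u + 1)) u p.1 p.2 (σ u p) ≤
          growthVal P T β B (T - u) u p.1 p.2 + ε := by
  have h : ∀ u, ∃ s : M.DecPath × M.Path → Vec (M.dX (u + 1)), Measurable s ∧
      (u < T → ∀ p : M.DecPath × M.Path, s p ∈ pathFeas u p.1 p.2 ∧
        gapObj P T (growthVal P T β B (T - (u + 1)) (u + 1)) u p.1 p.2 (s p) ≤
          growthVal P T β B (T - u) u p.1 p.2 + ε) := by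
    intro u
    by_cases hu : u < T
    · obtain ⟨L, hL, hf⟩ := hR.isValueFun_growthVal (P := P) (u := u + 1) (k := T - (u + 1)) hβ hB
        (by omega)
      obtain ⟨s, hs, h⟩ := hR.exists_measurable_selection_feas (Θ := M.DecPath × M.Path) hu
        (s := fun p ↦ M.state p.1 p.2.1 p.2.2 (u + 1)) (x := fun p ↦ p.1 u)
        (h := fun p ↦ M.hist (u + 1) p.2.1)
        (φ := fun p y ↦ gapObj P T (growthVal P T β B (T - (u + 1)) (u + 1)) u p.1 p.2 y)
        (hR.measurable_state hu) (by fun_prop) (measurable_hist_path (u + 1))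
        (fun p ↦ hR.continuous_gapObj hu hL hf _ _) (hR.measurable_gapObj hu hf) hε
      refine ⟨s, hs, fun _ p ↦ ⟨(h p).1, (h p).2.trans_eq ?_⟩⟩
      rw [show T - u = (T - (u + 1)) + 1 by omega, growthVal]
      rfl
    · exact ⟨fun _ ↦ 0, measurable_const, fun h ↦ absurd h hu⟩
  choose s hs h using h
  exact ⟨s, hs, h⟩

theorem rulePolicy_isFeasible (hR : Regular M T c)
    {σ : (u : ℕ) → M.DecPath × M.Path → Vec (M.dX (u + 1))} (hσ : ∀ u, Measurable (σ u))
    (hfeas : ∀ u < T, ∀ p : M.DecPath × M.Path, σ u p ∈ pathFeas u p.1 p.2)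
    {x : M.DecPath} (hx : x 0 ∈ M.X₀) : (rulePolicy hσ x).IsFeasible T := by
  intro ξ ζ
  have hpath : ∀ u, ∀ j ≤ u, (rulePolicy hσ x).path ξ ζ j = rulePath σ x u (ξ, ζ) j :=
    fun u j hj ↦ rulePolicy_path hσ hj (ξ, ζ)
  refine ⟨?_, fun u hu ↦ ?_⟩
  · rw [hpath 0 0 le_rfl]
    exact hx
  · change _ ∈ pathFeas u ((rulePolicy hσ x).path ξ ζ) (ξ, ζ)
    rw [hpath (u + 1) (u + 1) le_rfl, rulePath, Function.update_self,
      ← hR.pathFeas_congr hu (agree_trunc (u + 1) (ξ, ζ)) fun j hj ↦ (hpath u j hj).symm]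
    exact hfeas u hu (rulePath σ x u (ξ, ζ), trunc (u + 1) (ξ, ζ))

theorem integral_min_optDist_le (hR : Regular M T c) (hP : FiniteCost M T P) (hβ : 0 ≤ β)
    (hB : 0 ≤ B) (hG : M.Growth T P β) {π : M.Policy} (hfeas : π.IsFeasible T) :
    β * ∫ ω : M.Path, min (optDist P T T (π.path ω.1 ω.2) ω) B ∂(M.law P) ≤
      M.expCost T P π - M.optVal T P := by
  have hDm := (hR.measurable_optDist_uncurry (P := P) le_rfl).comp
    (π.measurable_path.prodMk measurable_id)
  simp only [Function.comp_def, id] at hDm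
  -- Nonnegativity of the excess is needed to return from extended nonnegative numbers, where a
  -- negative right-hand side would read as 0.
  have hgap : 0 ≤ M.expCost T P π - M.optVal T P := by
    rw [hR.expCost_sub_optVal hP hfeas]
    refine Finset.sum_nonneg fun t ht ↦ integral_nonneg fun ω ↦ ?_
    have ht := Finset.mem_range.1 ht
    cases t with
    | zero => exact hR.gap_zero_nonneg (hfeas ω.1 ω.2).1
    | succ u => exact hR.gap_succ_nonneg (by omega) ((hfeas ω.1 ω.2).2 u (by omega))
  have h1 := hG π hfeas
  rw [← ENNReal.ofReal_le_ofReal_iff hgap]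
  refine le_trans ?_ h1
  rw [ENNReal.ofReal_mul hβ]
  gcongr
  have hmin : ∀ ω : M.Path, 0 ≤ min (optDist P T T (π.path ω.1 ω.2) ω) B :=
    fun ω ↦ le_min (optDist_nonneg _ _ _ _ _) hB
  rw [ofReal_integral_eq_lintegral_ofReal ?_ (Filter.Eventually.of_forall hmin)]
  · refine lintegral_mono fun ω ↦ ENNReal.ofReal_le_ofReal ?_
    rw [hR.optSet_eq]
    exact min_le_left _ _
  · refine Integrable.of_bound (hDm.min measurable_const).aestronglyMeasurable B
      (Filter.Eventually.of_forall fun ω ↦ ?_)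
    rw [Real.norm_eq_abs, abs_of_nonneg (hmin ω)]
    exact min_le_right _ _

/-- The pointwise ε-optimal Bellman inequality, integrated. The inner kernel integral disappears by
the tower property, since the next value depends on ξ_[u+2] and ζ_0, …, ζ_{u+1} only. -/
theorem integral_gap_add_integral_le (hR : Regular M T c) {ε b L L' : ℝ} {u : ℕ} (hu : u < T)
    {f f' : M.DecPath → M.Path → ℝ} (hL' : 0 ≤ L')
    (hf : IsValueFun u L b f) (hf' : IsValueFun (u + 1) L' b f')
    {σ : (u : ℕ) → M.DecPath × M.Path → Vec (M.dX (u + 1))} (hσ : ∀ u, Measurable (σ u))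
    {x : M.DecPath} (hfeas : (rulePolicy hσ x).IsFeasible T)
    (hopt : ∀ p : M.DecPath × M.Path, gapObj P T f' u p.1 p.2 (σ u p) ≤ f p.1 p.2 + ε) :
    ∫ ω : M.Path, gap P T (u + 1) ((rulePolicy hσ x).path ω.1 ω.2) ω ∂(M.law P) +
      ∫ ω, f' (rulePath σ x (u + 1) ω) ω ∂(M.law P) ≤
      ∫ ω, f (rulePath σ x u ω) ω ∂(M.law P) + ε := by
  have hmeas : ∀ {v K : _} {h : M.DecPath → M.Path → ℝ}, IsValueFun v K b h →
      Measurable fun ω ↦ h (rulePath σ x v ω) ω := fun {v _ _} hh ↦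
    hh.meas.comp ((measurable_rulePath hσ v).prodMk measurable_id)
  have h_int : ∀ {v K : _} {h : M.DecPath → M.Path → ℝ}, IsValueFun v K b h →
      Integrable (fun ω ↦ h (rulePath σ x v ω) ω) (M.law P) := fun {v _ _} hh ↦ by
    refine Integrable.of_bound (hmeas hh).aestronglyMeasurable b
      (Filter.Eventually.of_forall fun ω ↦ ?_)
    rw [Real.norm_eq_abs, abs_le]
    have h1 := hh.neg_le (rulePath σ x v ω) ω
    have h2 := hh.nonpos (rulePath σ x v ω) ω
    exact ⟨h1, by linarith⟩
  have hna : Nonanticipative (u + 1 + 1) fun ω ↦ f' (rulePath σ x (u + 1) ω) ω :=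
    fun ω ω' h ↦ by
      simp only [nonanticipative_rulePath (σ := σ) (x := x) (u + 1) ω ω' (h.mono (Nat.le_succ _))]
      exact hf'.nonanticipative _ _ _ h
  have hg := hR.integrable_gap_succ (P := P) hfeas hu
  have hA := integrable_integral_extend P (hmeas hf') hna (h_int hf')
  rw [← integral_extend P (hmeas hf') hna (h_int hf'), ← integral_add hg hA]
  have hle := integral_mono (hg.add hA) ((h_int hf).add (integrable_const ε)) fun ω ↦ ?_
  · simp only [Pi.add_apply] at hle
    rw [integral_add (h_int hf) (integrable_const ε)] at hle
    simpa using hle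
  · have h1 := hopt (rulePath σ x u ω, trunc (u + 1) ω)
    rw [hR.gapObj_congr hu hf' hL' (fun _ _ ↦ rfl) (agree_trunc (u + 1) ω)] at h1
    rw [hf.nonanticipative _ _ _ (agree_trunc (u + 1) ω)] at h1
    refine le_trans (le_of_eq ?_) h1
    simp only [Pi.add_apply]
    rw [gapObj]
    congr 1
    · exact hR.gap_congr (show u + 1 ≤ T from hu) (agree_refl _ ω)
        fun j hj ↦ rulePolicy_path hσ hj ω
    · refine integral_congr_ae (Filter.Eventually.of_forall fun p ↦ ?_)
      simp only [nonanticipative_rulePath (σ := σ) (x := x) (u + 1) _ _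
        (agree_extend (u + 1) ω p)]
      rfl

/-- Summing the T Bellman inequalities bounds the later gaps of the ε-optimal policy minus its
terminal term by the initial value plus Tε. Growth for this very policy bounds the same quantity
below by minus the gap of stage 0. -/
theorem integral_growthVal_ge_sub (hR : Regular M T c) (hP : FiniteCost M T P) (hβ : 0 ≤ β)
    (hB : 0 ≤ B) (hG : M.Growth T P β) {x : M.DecPath} (hx : x 0 ∈ M.X₀) {ε : ℝ} (hε : 0 < ε)
    (ω₀ : M.Path) :
    -gap P T 0 x ω₀ - T * ε ≤ ∫ ω, growthVal P T β B T 0 x ω ∂(M.law P) := by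
  obtain ⟨σ, hσ, hopt⟩ := hR.exists_rules (P := P) hβ hB hε
  have hfeas := hR.rulePolicy_isFeasible hσ (fun u hu p ↦ (hopt u hu p).1) hx
  have hpath : ∀ u (ω : M.Path), ∀ j ≤ u,
      (rulePolicy hσ x).path ω.1 ω.2 j = rulePath σ x u ω j :=
    fun u ω j hj ↦ rulePolicy_path hσ hj ω
  have hsum : ∀ n ≤ T, ∑ u ∈ Finset.range n,
      ∫ ω : M.Path, gap P T (u + 1) ((rulePolicy hσ x).path ω.1 ω.2) ω ∂(M.law P) +
      ∫ ω, growthVal P T β B (T - n) n (rulePath σ x n ω) ω ∂(M.law P) ≤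
      ∫ ω, growthVal P T β B T 0 x ω ∂(M.law P) + n * ε := by
    intro n
    induction n with
    | zero => intro _; simp [rulePath]
    | succ n ih =>
      intro hn
      have h1 := ih (by omega)
      obtain ⟨L, hL, hf⟩ := hR.isValueFun_growthVal (P := P) hβ hB (show n + (T - n) = T by omega)
      obtain ⟨L', hL', hf'⟩ := hR.isValueFun_growthVal (P := P) hβ hB
        (show n + 1 + (T - (n + 1)) = T by omega)
      have h2 := hR.integral_gap_add_integral_le hn hL' hf hf' hσ hfeas
        fun p ↦ (hopt n hn p).2
      rw [Finset.sum_range_succ]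
      push_cast
      linarith
  have hT := hsum T le_rfl
  have hgrow := hR.integral_min_optDist_le hP hβ hB hG hfeas
  rw [hR.expCost_sub_optVal hP hfeas, Finset.sum_range_succ'] at hgrow
  have hlast : ∫ ω, growthVal P T β B (T - T) T (rulePath σ x T ω) ω ∂(M.law P) =
      -(β * ∫ ω : M.Path, min (optDist P T T ((rulePolicy hσ x).path ω.1 ω.2) ω) B
        ∂(M.law P)) := by
    rw [← integral_const_mul, ← integral_neg, Nat.sub_self]
    refine integral_congr_ae (Filter.Eventually.of_forall fun ω ↦ ?_)
    simp only [growthVal]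
    rw [hR.optDist_congr le_rfl (agree_refl _ ω) (hpath T ω)]
  have hzero : ∫ ω : M.Path, gap P T 0 ((rulePolicy hσ x).path ω.1 ω.2) ω ∂(M.law P) =
      gap P T 0 x ω₀ := by
    have : ∀ ω : M.Path, gap P T 0 ((rulePolicy hσ x).path ω.1 ω.2) ω = gap P T 0 x ω₀ :=
      fun ω ↦ by
        rw [gap, gap, hpath 0 ω 0 le_rfl]
        rfl
    simp [this]
  linarith

theorem neg_gap_le_integral_growthVal (hR : Regular M T c) (hP : FiniteCost M T P) (hβ : 0 ≤ β)
    (hB : 0 ≤ B) (hG : M.Growth T P β) {x : M.DecPath} (hx : x 0 ∈ M.X₀) (ω₀ : M.Path) :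
    -gap P T 0 x ω₀ ≤ ∫ ω, growthVal P T β B T 0 x ω ∂(M.law P) := by
  refine le_of_forall_pos_le_add fun δ hδ ↦ ?_
  have h := hR.integral_growthVal_ge_sub hP hβ hB hG hx
    (ε := δ / (T + 1)) (by positivity) ω₀
  have h1 : (T : ℝ) * (δ / (T + 1)) ≤ δ := by
    rw [mul_div_assoc', div_le_iff₀ (by positivity)]
    nlinarith
  linarith

end Regular

/-! ### The growth condition along realizations -/

/-- Uncountably many null sets reduce to countably many by continuity. The dense set is taken inside
S, since density in E would not help for a thin S. -/
theorem ae_forall_mem_nonneg {α E : Type*} [MeasurableSpace α] {μ : Measure α}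
    [TopologicalSpace E] [SecondCountableTopology E] {S : Set E} {f : E → α → ℝ}
    (hc : ∀ a, Continuous fun y ↦ f y a) (h : ∀ y ∈ S, ∀ᵐ a ∂μ, 0 ≤ f y a) :
    ∀ᵐ a ∂μ, ∀ y ∈ S, 0 ≤ f y a := by
  obtain ⟨D, hD, hdense⟩ := TopologicalSpace.exists_countable_dense S
  have h1 : ∀ᵐ a ∂μ, ∀ y ∈ D, 0 ≤ f y a := (ae_ball_iff hD).2 fun y _ ↦ h y y.2
  filter_upwards [h1] with a ha y hy
  have hcl : IsClosed {y : S | 0 ≤ f y a} :=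
    isClosed_le continuous_const ((hc a).comp continuous_subtype_val)
  have := hcl.closure_subset_iff.2 (show D ⊆ {y : S | 0 ≤ f y a} from ha)
  rw [hdense.closure_eq] at this
  exact this (Set.mem_univ (⟨y, hy⟩ : S))

theorem ae_nonneg_of_integral_nonneg {α : Type*} [MeasurableSpace α] {μ : Measure α}
    {f : α → ℝ} (hi : Integrable f μ) (hf : ∀ a, f a ≤ 0) (h : 0 ≤ ∫ a, f a ∂μ) :
    ∀ᵐ a ∂μ, 0 ≤ f a := by
  have h1 : ∫ a, -f a ∂μ = 0 := by
    have h2 : 0 ≤ ∫ a, -f a ∂μ := integral_nonneg fun a ↦ neg_nonneg.2 (hf a)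
    rw [integral_neg] at h2 ⊢
    linarith
  rw [integral_eq_zero_iff_of_nonneg (fun a ↦ neg_nonneg.2 (hf a)) hi.neg] at h1
  filter_upwards [h1] with a ha
  have : -f a = 0 := ha
  linarith

namespace Model

variable {M : Model} (P : (t : ℕ) → Measure (Vec (M.dZ t))) (T : ℕ)

/-- Optimal decisions up to stage `u` cannot be continued to violate the growth condition. -/
def GrowthAt (β B : ℝ) (u : ℕ) (ω : M.Path) : Prop :=
  ∀ y, IsOpt P T u y ω → 0 ≤ growthVal P T β B (T - u) u y ω

/-- The growth condition for the gap of each stage along a realization. -/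
def PathGrowth (β : ℝ) (ω : M.Path) : Prop :=
  (∀ x : M.DecPath, x 0 ∈ M.X₀ → β * optDist P T 0 x ω ≤ gap P T 0 x ω) ∧
  ∀ u < T, ∀ x : M.DecPath, IsOpt P T u x ω → x (u + 1) ∈ pathFeas u x ω →
    β * optDist P T (u + 1) x ω ≤ gap P T (u + 1) x ω

variable {P T}

theorem IsValueFun.continuous {u : ℕ} {L B : ℝ} {f : M.DecPath → M.Path → ℝ}
    (hf : IsValueFun u L B f) (ω : M.Path) : Continuous fun x ↦ f x ω :=
  continuous_of_prefix_lipschitz fun x x' ↦ hf.lip x x' ω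

theorem IsValueFun.congr {u : ℕ} {L B : ℝ} {f : M.DecPath → M.Path → ℝ}
    (hf : IsValueFun u L B f) {x x' : M.DecPath} (hx : ∀ j ≤ u, x j = x' j) (ω : M.Path) :
    f x ω = f x' ω := by
  have h := hf.lip x x' ω
  have h0 : prefixDist u x x' = 0 := le_antisymm
    ((prefixDist_le_iff le_rfl).2 fun j hj ↦ by simp [hx j hj]) (prefixDist_nonneg u x x')
  rw [h0, mul_zero] at h
  exact sub_eq_zero.1 (abs_nonpos_iff.1 h)

theorem isOpt_zero_congr {x : M.DecPath} {ω ω' : M.Path} :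
    IsOpt P T 0 x ω ↔ IsOpt P T 0 x ω' :=
  ⟨fun h ↦ ⟨h.1, fun u hu ↦ absurd hu (Nat.not_lt_zero u)⟩,
    fun h ↦ ⟨h.1, fun u hu ↦ absurd hu (Nat.not_lt_zero u)⟩⟩

end Model

/-! ### Passing from growth in expectation to growth along almost all realizations -/

namespace Regular

variable {M : Model} {T : ℕ} {c : Moduli} {P : (t : ℕ) → Measure (Vec (M.dZ t))}
  [∀ t, IsProbabilityMeasure (P t)] {β B : ℝ}

theorem nonanticipative_growthAt (hR : Regular M T c) (hβ : 0 ≤ β) (hB : 0 ≤ B) {u : ℕ}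
    (hu : u ≤ T) : Nonanticipative (u + 1) (GrowthAt P T β B u) := by
  intro ω ω' h
  obtain ⟨L, hL, hf⟩ := hR.isValueFun_growthVal (P := P) hβ hB (show u + (T - u) = T by omega)
  refine propext (forall_congr' fun y ↦ ?_)
  rw [hR.isOpt_congr hu (h.mono (Nat.le_succ u)) fun _ _ ↦ rfl, hf.nonanticipative y ω ω' h]

theorem measurableSet_growthAt (hR : Regular M T c) (hβ : 0 ≤ β) (hB : 0 ≤ B) {u : ℕ}
    (hu : u ≤ T) : MeasurableSet {ω | GrowthAt P T β B u ω} := by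
  obtain ⟨L, hL, hf⟩ := hR.isValueFun_growthVal (P := P) hβ hB (show u + (T - u) = T by omega)
  -- Failure means a strictly negative value at some optimal prefix; the slack 1/(n+1) turns this
  -- into closed conditions.
  have : {ω | GrowthAt P T β B u ω} = (⋃ n : ℕ, {ω | ∃ y, IsOpt P T u y ω ∧
      growthVal P T β B (T - u) u y ω + 1 / ((n : ℝ) + 1) ≤ 0})ᶜ := by
    ext ω
    simp only [GrowthAt, Set.mem_compl_iff, Set.mem_iUnion, Set.mem_ofPred_eq, not_exists, not_and]
    constructor
    · intro h n y hy hle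
      have h1 := h y hy
      have : 0 < 1 / ((n : ℝ) + 1) := by positivity
      linarith
    · intro h y hy
      by_contra! hlt
      obtain ⟨n, hn⟩ := exists_nat_one_div_lt (neg_pos.2 hlt)
      exact h n y hy (by linarith)
  rw [this]
  refine (MeasurableSet.iUnion fun n : ℕ ↦ hR.measurableSet_exists_isOpt hu
    (Ψ := fun y ω ↦ growthVal P T β B (T - u) u y ω + 1 / ((n : ℝ) + 1))
    (fun ω ↦ (hf.continuous ω).add continuous_const)
    (fun y ↦ (hf.measurable_right y).add_const _) fun y ω ↦ ?_).compl
  rw [hf.congr (fun j hj ↦ cut_of_le hj y) ω]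

/-- An optimal decision has zero gap, so the Bellman inequality gives the next value a nonnegative
mean; being nonpositive it vanishes almost surely. Optimality of a prefix of stage u + 1 is
unaffected by the resampled variables. -/
theorem growthAt_extend (hR : Regular M T c) (hβ : 0 ≤ β) (hB : 0 ≤ B) {u : ℕ} (hu : u < T)
    {ω : M.Path} (h : GrowthAt P T β B u ω) :
    ∀ᵐ p ∂(stepKernel P (u + 1) ω), GrowthAt P T β B (u + 1) (extend (u + 1) ω p) := by
  obtain ⟨L, hL, hf⟩ := hR.isValueFun_growthVal (P := P) hβ hB
    (show u + 1 + (T - (u + 1)) = T by omega)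
  have hprob : IsProbabilityMeasure (stepKernel P (u + 1) ω) := by
    rw [stepKernel_apply]
    infer_instance
  have h1 : ∀ y ∈ {y | IsOpt P T (u + 1) y ω}, ∀ᵐ p ∂(stepKernel P (u + 1) ω),
      0 ≤ growthVal P T β B (T - (u + 1)) (u + 1) y (extend (u + 1) ω p) := by
    intro y hy
    refine ae_nonneg_of_integral_nonneg (hf.integrable y ω) (fun p ↦ hf.nonpos _ _) ?_
    have h2 := h y (IsOpt.mono (Nat.le_succ u) hy)
    have h3 := hy.2 u (Nat.lt_succ_self u)
    have h4 := hR.growthVal_succ_le (P := P) hβ hB (show u + (T - (u + 1) + 1) = T by omega) h3.1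
    rw [show T - (u + 1) + 1 = T - u by omega] at h4
    linarith [h3.2]
  filter_upwards [ae_forall_mem_nonneg (fun p ↦ hf.continuous (extend (u + 1) ω p)) h1]
    with p hp y hy
  exact hp y ((hR.isOpt_congr hu (agree_extend (u + 1) ω p) fun _ _ ↦ rfl).1 hy)

theorem ae_growthAt (hR : Regular M T c) (hP : FiniteCost M T P) (hβ : 0 ≤ β) (hB : 0 ≤ B)
    (hG : M.Growth T P β) {u : ℕ} (hu : u ≤ T) : ∀ᵐ ω ∂(M.law P), GrowthAt P T β B u ω := by
  induction u with
  | zero =>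
    obtain ⟨L, hL, hf⟩ := hR.isValueFun_growthVal (P := P) hβ hB (zero_add T)
    -- Optimality at stage 0 does not depend on the realization, so the zero realization stands for
    -- all of them.
    have h1 : ∀ y ∈ {y : M.DecPath | IsOpt P T 0 y 0}, ∀ᵐ ω ∂(M.law P),
        0 ≤ growthVal P T β B T 0 y ω := by
      intro y hy
      have hi : Integrable (growthVal P T β B T 0 y) (M.law P) :=
        Integrable.of_bound (hf.measurable_right y).aestronglyMeasurable (β * B)
          (Filter.Eventually.of_forall fun ω ↦ by
            rw [Real.norm_eq_abs, abs_le]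
            exact ⟨hf.neg_le y ω, (hf.nonpos y ω).trans (mul_nonneg hβ hB)⟩)
      refine ae_nonneg_of_integral_nonneg hi (hf.nonpos y) ?_
      have h2 := hR.neg_gap_le_integral_growthVal hP hβ hB hG hy.1.1 0
      linarith [hy.1.2]
    filter_upwards [ae_forall_mem_nonneg hf.continuous h1] with ω hω y hy
    exact hω y (isOpt_zero_congr.1 hy)
  | succ u ih =>
    refine ae_of_ae_extend P (hR.measurableSet_growthAt hβ hB hu)
      (hR.nonanticipative_growthAt hβ hB hu) ?_
    filter_upwards [ih (by omega)] with ω hω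
    exact hR.growthAt_extend hβ hB hu hω

theorem optDist_le_of_norm_le (hR : Regular M T c) {R : ℝ} (hb0 : ∀ x ∈ M.X₀, ‖x‖ ≤ R)
    (hb : ∀ u < T, ∀ (x : M.DecPath) (ω : M.Path), ∀ y ∈ pathFeas u x ω, ‖y‖ ≤ R)
    {t : ℕ} (ht : t ≤ T) {x : M.DecPath} {ω : M.Path} (hx : ∀ j ≤ t, ‖x j‖ ≤ R) :
    optDist P T t x ω ≤ 2 * R := by
  obtain ⟨y, hy⟩ := hR.exists_isOpt (P := P) ht ω
  have hR0 : 0 ≤ R := (norm_nonneg _).trans (hx 0 (Nat.zero_le t))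
  refine (optDist_le_prefixDist P T hy).trans ((prefixDist_le_iff (by positivity)).2
    fun j hj ↦ ?_)
  have h1 : ‖y j‖ ≤ R := by
    cases j with
    | zero => exact hb0 _ hy.1.1
    | succ j => exact hb j (by omega) y ω _ (hy.2 j hj).1
  linarith [norm_sub_le (x j) (y j), hx j hj]

/-- From an optimal prefix, 0 ≤ value ≤ gap + mean of the next value ≤ gap - β · distance. The level
2R exceeds every distance between feasible decisions, so the truncation is inactive. Stage 0 has no
preceding value and uses the expectation bound directly. -/
theorem pathGrowth_of_growthAt (hR : Regular M T c) (hP : FiniteCost M T P) (hβ : 0 ≤ β)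
    (hG : M.Growth T P β) {R : ℝ} (hR0 : 0 ≤ R) (hb0 : ∀ x ∈ M.X₀, ‖x‖ ≤ R)
    (hb : ∀ u < T, ∀ (x : M.DecPath) (ω : M.Path), ∀ y ∈ pathFeas u x ω, ‖y‖ ≤ R)
    {ω : M.Path} (h : ∀ u < T, GrowthAt P T β (2 * R) u ω) : PathGrowth P T β ω := by
  have hB : 0 ≤ 2 * R := by positivity
  constructor
  · intro x hx
    obtain ⟨L, hL, hf⟩ := hR.isValueFun_growthVal (P := P) hβ hB (zero_add T)
    have h1 := hR.neg_gap_le_integral_growthVal hP hβ hB hG hx ω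
    have h2 : optDist P T 0 x ω ≤ 2 * R :=
      hR.optDist_le_of_norm_le hb0 hb (Nat.zero_le T) fun j hj ↦ by
        obtain rfl : j = 0 := by omega
        exact hb0 _ hx
    have h3 : ∀ ω' : M.Path, growthVal P T β (2 * R) T 0 x ω' ≤ -(β * optDist P T 0 x ω) := by
      intro ω'
      have h4 : optDist P T 0 x ω' = optDist P T 0 x ω := by
        simp only [optDist, isOpt_zero_congr (P := P) (T := T) (ω := ω') (ω' := ω)]
      have h5 := hR.growthVal_le (P := P) hβ hB (zero_add T) x ω'
      rwa [h4, min_eq_left h2] at h5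
    have hi : Integrable (growthVal P T β (2 * R) T 0 x) (M.law P) :=
      Integrable.of_bound (hf.measurable_right x).aestronglyMeasurable (β * (2 * R))
        (Filter.Eventually.of_forall fun ω ↦ by
          rw [Real.norm_eq_abs, abs_le]
          exact ⟨hf.neg_le x ω, (hf.nonpos x ω).trans (mul_nonneg hβ hB)⟩)
    have h6 := integral_mono hi (integrable_const _) h3
    simp only [integral_const, probReal_univ, one_smul] at h6
    linarith
  · intro u hu x hx hxf
    obtain ⟨L, hL, hf⟩ := hR.isValueFun_growthVal (P := P) hβ hB
      (show u + 1 + (T - (u + 1)) = T by omega)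
    have hprob : IsProbabilityMeasure (stepKernel P (u + 1) ω) := by
      rw [stepKernel_apply]
      infer_instance
    have h1 := h u hu x hx
    have h2 := hR.growthVal_succ_le (P := P) hβ hB (show u + (T - (u + 1) + 1) = T by omega) hxf
    rw [show T - (u + 1) + 1 = T - u by omega] at h2
    have h3 : optDist P T (u + 1) x ω ≤ 2 * R :=
      hR.optDist_le_of_norm_le hb0 hb hu fun j hj ↦ by
        cases j with
        | zero => exact hb0 _ hx.1.1
        | succ j =>
          rcases (Nat.lt_or_eq_of_le hj) with hlt | heq
          · exact hb j (by omega) x ω _ (hx.2 j (by omega)).1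
          · obtain rfl : j = u := by omega
            exact hb j hu x ω _ hxf
    have h4 : ∀ p, growthVal P T β (2 * R) (T - (u + 1)) (u + 1) x (extend (u + 1) ω p) ≤
        -(β * optDist P T (u + 1) x ω) := by
      intro p
      have h5 := hR.growthVal_le (P := P) hβ hB (show u + 1 + (T - (u + 1)) = T by omega) x
        (extend (u + 1) ω p)
      rwa [hR.optDist_congr (P := P) hu (agree_extend (u + 1) ω p) fun _ _ ↦ rfl,
        min_eq_left h3] at h5
    have h6 := integral_mono (μ := stepKernel P (u + 1) ω) (hf.integrable (t := u + 1) x ω)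
      (integrable_const _) h4
    simp only [integral_const, probReal_univ, one_smul] at h6
    linarith

/-- The growth condition holds stage by stage along almost all realizations. -/
theorem ae_pathGrowth (hR : Regular M T c) (hP : FiniteCost M T P) (hβ : 0 ≤ β)
    (hG : M.Growth T P β) {Q : (t : ℕ) → Measure (Vec (M.dZ t))}
    [∀ t, IsProbabilityMeasure (Q t)] (hPQ : ∀ t < T, P t = Q t) :
    ∀ᵐ ω ∂(M.law Q), PathGrowth P T β ω := by
  obtain ⟨R, hR0, hb0, hb⟩ := hR.exists_bound
  have hB : 0 ≤ 2 * R := by positivity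
  have h : ∀ᵐ ω ∂(M.law Q), ∀ u < T, GrowthAt P T β (2 * R) u ω := by
    refine ae_all_iff.2 fun u ↦ Filter.eventually_imp_distrib_left.2 fun hu ↦ ?_
    -- At u < T the event involves ζ_0, …, ζ_u only, so agreement of the marginals before T
    -- suffices.
    exact ae_law_congr P (hR.measurableSet_growthAt hβ hB hu.le)
      ((hR.nonanticipative_growthAt hβ hB hu.le).mono hu) hPQ
      (hR.ae_growthAt hP hβ hB hG hu.le)
  filter_upwards [h] with ω hω
  exact hR.pathGrowth_of_growthAt hP hβ hG hR0 hb0 hb hω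

end Regular

/-! ### Stability of the optimal decisions -/

/-- Lipschitz modulus of the optimal decisions of stages `0, …, t` under the growth condition with
constant `β`. -/
def Moduli.solLip (c : Moduli) (T : ℕ) (β : ℝ) : ℕ → ℝ
  | 0 => 2 / β + 1
  | t + 1 => ((2 + c.gapLip T (t + 1)) / β + 2) *
      (1 + c.LX (t + 1) * (c.stateLip T (t + 1) + 1)) * solLip c T β t

namespace Regular

variable {M : Model} {T : ℕ} {c : Moduli} {P P' : (t : ℕ) → Measure (Vec (M.dZ t))} {β : ℝ}

theorem one_le_solLip (hR : Regular M T c) (hβ : 0 < β) {t : ℕ} (ht : t ≤ T) :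
    1 ≤ c.solLip T β t := by
  induction t with
  | zero =>
    have : 0 < 2 / β := by positivity
    rw [Moduli.solLip]
    linarith
  | succ t ih =>
    have h1 := hR.gapLip_nonneg ht
    have h2 := hR.LX_nonneg ht (t + 1)
    have h3 := c.stateLip_nonneg T (t + 1)
    have h4 : 0 ≤ (2 + c.gapLip T (t + 1)) / β := by positivity
    have h5 : 0 ≤ c.LX (t + 1) * (c.stateLip T (t + 1) + 1) := by positivity
    rw [Moduli.solLip]
    exact one_le_mul_of_one_le_of_one_le
      (one_le_mul_of_one_le_of_one_le (by linarith) (by linarith)) (ih (by omega))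

variable [∀ t, IsProbabilityMeasure (P t)]

/-- Optimal decisions for `P'` along `ω'` are close to optimal decisions for `P` along `ω`. -/
theorem exists_isOpt_near (hR : Regular M T c) (hβ : 0 < β)
    {η : ℝ} (hη : 0 < η) (hgap : ∀ t ≤ T, ∀ (x : M.DecPath) (ω : M.Path),
      |gap P T t x ω - gap P' T t x ω| ≤ 2 * η)
    {ω ω' : M.Path} (hω : Near T η ω' ω) (hG : PathGrowth P T β ω) {x : M.DecPath}
    (hx : IsOpt P' T T x ω') {t : ℕ} (ht : t ≤ T) :
    ∃ y, IsOpt P T t y ω ∧ ∀ j ≤ t, ‖x j - y j‖ ≤ c.solLip T β t * η := by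
  induction t with
  | zero =>
    have h1 := hG.1 x hx.1.1
    have h2 := abs_le.1 (hgap 0 ht x ω)
    have h3 : gap P' T 0 x ω ≤ 0 := hx.1.2
    have h4 : optDist P T 0 x ω ≤ 2 * η / β := by
      rw [le_div_iff₀ hβ]
      linarith [h2.2]
    -- The summand 1 in `solLip` makes the inequality strict, so an optimal point is obtained
    -- without attainment of the distance; this is why η must be positive.
    have h5 : optDist P T 0 x ω < c.solLip T β 0 * η := by
      rw [Moduli.solLip]
      refine h4.trans_lt ?_
      rw [mul_div_right_comm]
      linarith
    obtain ⟨y, hy, hlt⟩ := (hR.optDist_lt_iff ht).1 h5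
    exact ⟨y, hy, fun j hj ↦ (norm_sub_le_prefixDist hj x y).trans hlt.le⟩
  | succ t ih =>
    obtain ⟨y, hy, hxy⟩ := ih (by omega)
    have hK := hR.one_le_solLip hβ (show t ≤ T by omega)
    set r := c.solLip T β t * η with hr
    have hηr : η ≤ r := le_mul_of_one_le_left hη.le hK
    have hr0 : 0 < r := hη.trans_le hηr
    have hg := hR.gapLip_nonneg ht
    set D := c.LX (t + 1) * (c.stateLip T (t + 1) + 1) with hD
    have hD0 : 0 ≤ D :=
      mul_nonneg (hR.LX_nonneg ht (t + 1)) (by linarith [c.stateLip_nonneg T (t + 1)])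
    obtain ⟨hxf, hxg⟩ := hx.2 t ht
    -- Feasibility is repaired first: growth at this stage applies only to feasible continuations of
    -- a prefix that is optimal for P along ω.
    obtain ⟨y', hy', hle⟩ := hR.exists_pathFeas_near ht (hω.mono ht hηr) hxy hxf
    set X := Function.update y (t + 1) y' with hX
    have hXy : ∀ j ≤ t, X j = y j := fun j hj ↦ Function.update_of_ne (by omega) _ _
    have hXt : X (t + 1) = y' := Function.update_self _ _ _
    have hXo : IsOpt P T t X ω := (hR.isOpt_congr (by omega) (agree_refl t ω) hXy).2 hy
    have hXf : X (t + 1) ∈ pathFeas t X ω := by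
      rw [hXt, hR.pathFeas_congr ht (agree_refl _ ω) hXy]
      exact hy'
    have hDr : 0 ≤ D * r := by positivity
    have hxX : ∀ j ≤ t + 1, ‖x j - X j‖ ≤ (1 + D) * r := by
      intro j hj
      rcases Nat.le_succ_iff.1 hj with hj | rfl
      · rw [hXy j hj]
        linarith [hxy j hj]
      · rw [hXt]
        linarith
    have hnear : Near (t + 1) ((1 + D) * r) ω' ω := hω.mono ht (by linarith)
    have h1 := (abs_le.1 (hR.abs_gap_sub_le (P := P) ht hnear hxX)).1
    have h2 := (abs_le.1 (hgap (t + 1) ht x ω')).2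
    have h3 := hG.2 t ht X hXo hXf
    -- The gap of `x` for P' along ω' is nonpositive. Changing the law costs 2η ≤ 2(1 + D)r, and
    -- moving to `X` along ω costs `gapLip` times (1 + D)r.
    have h4 : optDist P T (t + 1) X ω ≤ (2 + c.gapLip T (t + 1)) / β * ((1 + D) * r) := by
      rw [div_mul_eq_mul_div, le_div_iff₀ hβ]
      nlinarith
    have h5 : optDist P T (t + 1) X ω <
        ((2 + c.gapLip T (t + 1)) / β + 1) * ((1 + D) * r) := by
      nlinarith
    obtain ⟨z, hz, hlt⟩ := (hR.optDist_lt_iff ht).1 h5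
    refine ⟨z, hz, fun j hj ↦ ?_⟩
    have h6 := norm_sub_le_prefixDist hj X z
    have h7 := norm_sub_le_norm_sub_add_norm_sub (x j) (X j) (z j)
    rw [Moduli.solLip, mul_assoc, ← hr, mul_assoc]
    linarith [hxX j hj]

theorem hausdorffDist_optSet_le [∀ t, IsProbabilityMeasure (P' t)] (hR : Regular M T c) (hβ : 0 < β)
    (hP : ∀ t ≤ T, Integrable (fun z ↦ ‖z‖) (P t))
    (hP' : ∀ t ≤ T, Integrable (fun z ↦ ‖z‖) (P' t)) {ω ω' : M.Path} (hω : ω.1 = ω'.1)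
    (hG : PathGrowth P T β ω) (hG' : PathGrowth P' T β ω') :
    Metric.hausdorffDist (M.optSet T P ω.1 ω.2) (M.optSet T P' ω'.1 ω'.2) ≤
      c.solLip T β T * (∑ t ∈ Finset.range T, ‖ω.2 t - ω'.2 t‖ + costErr T c P P' 0) := by
  have hK := hR.one_le_solLip hβ le_rfl
  set η₀ := ∑ t ∈ Finset.range T, ‖ω.2 t - ω'.2 t‖ + costErr T c P P' 0 with hη₀
  have hsum : 0 ≤ ∑ t ∈ Finset.range T, ‖ω.2 t - ω'.2 t‖ :=
    Finset.sum_nonneg fun _ _ ↦ norm_nonneg _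
  have hE := hR.costErr_nonneg hP hP' 0
  refine le_of_forall_pos_le_add fun ε hε ↦ ?_
  -- η₀ may vanish; the extra term keeps η positive and contributes exactly ε to the final bound.
  set η := η₀ + ε / c.solLip T β T with hη
  have hε' : 0 < ε / c.solLip T β T := by positivity
  have hη0 : 0 < η := by linarith
  have hgap : ∀ t ≤ T, ∀ (x : M.DecPath) (ω : M.Path),
      |gap P T t x ω - gap P' T t x ω| ≤ 2 * η := fun t ht x ω ↦
    (hR.abs_gap_sub_gap_le hP hP' ht x ω).trans (by linarith)
  have hz : ∀ t < T, ‖ω.2 t - ω'.2 t‖ ≤ η := fun t ht ↦ by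
    have := Finset.single_le_sum (f := fun t ↦ ‖ω.2 t - ω'.2 t‖) (fun _ _ ↦ norm_nonneg _)
      (Finset.mem_range.2 ht)
    linarith
  have hr : c.solLip T β T * η₀ + ε = c.solLip T β T * η := by
    rw [hη, mul_add _ η₀, mul_div_cancel₀ _ (by positivity)]
  have hr0 : 0 ≤ c.solLip T β T * η := by positivity
  rw [hr, hR.optSet_eq, hR.optSet_eq]
  refine Metric.hausdorffDist_le_of_mem_dist hr0 ?_ ?_
  · rintro _ ⟨x, hx, rfl⟩
    obtain ⟨y, hy, h⟩ := hR.exists_isOpt_near (P := P') (P' := P) hβ hη0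
      (fun t ht x ω ↦ by rw [abs_sub_comm]; exact hgap t ht x ω)
      (ω := ω') (ω' := ω) ⟨fun i _ ↦ by rw [hω], hz⟩ hG' hx le_rfl
    exact ⟨_, ⟨y, hy, rfl⟩, (prefixDist_le_iff hr0).2 h⟩
  · rintro _ ⟨x, hx, rfl⟩
    obtain ⟨y, hy, h⟩ := hR.exists_isOpt_near (P := P) (P' := P') hβ hη0 hgap
      (ω := ω) (ω' := ω') ⟨fun i _ ↦ by rw [hω], fun i hi ↦ by
        rw [norm_sub_rev]; exact hz i hi⟩ hG hx le_rfl
    exact ⟨_, ⟨y, hy, rfl⟩, (prefixDist_le_iff hr0).2 h⟩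

end Regular

/-! ### Averaging the pathwise bound over optimal couplings -/

namespace Model

variable {M : Model}

theorem ae_law_of_map {β : ℕ → Type*} [∀ t, MeasurableSpace (β t)]
    (π : (t : ℕ) → Measure (β t)) [∀ t, IsProbabilityMeasure (π t)]
    (Q : (t : ℕ) → Measure (Vec (M.dZ t))) [∀ t, IsProbabilityMeasure (Q t)]
    {f : (t : ℕ) → β t → Vec (M.dZ t)} (hf : ∀ t, Measurable (f t))
    (hQ : ∀ t, (π t).map (f t) = Q t) {p : M.Path → Prop} (h : ∀ᵐ ω ∂(M.law Q), p ω) :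
    ∀ᵐ ω ∂(M.exoLaw.prod (Measure.infinitePi π)), p (ω.1, fun t ↦ f t (ω.2 t)) := by
  have hprob : ∀ t, IsProbabilityMeasure ((π t).map (f t)) := fun t ↦ by
    rw [hQ t]; infer_instance
  have hexo : IsProbabilityMeasure M.exoLaw := by unfold exoLaw; infer_instance
  have hm : Measurable fun (z : (t : ℕ) → β t) t ↦ f t (z t) := by fun_prop
  have h1 : (M.exoLaw.prod (Measure.infinitePi π)).map
      (Prod.map id fun (z : (t : ℕ) → β t) t ↦ f t (z t)) = M.law Q := by
    rw [← Measure.map_prod_map _ _ measurable_id hm, Measure.map_id,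
      Measure.infinitePi_map_pi _ hf, Model.law]
    congr
    exact funext hQ
  rw [← h1] at h
  exact ae_of_ae_map (measurable_id.prodMap hm).aemeasurable h

end Model

theorem IsOptimalCoupling.integrable {n : ℕ} {π : Measure (Vec n × Vec n)} {μ ν : Measure (Vec n)}
    (h : IsOptimalCoupling π μ ν) (hμ : Integrable (fun z ↦ ‖z‖) μ)
    (hν : Integrable (fun z ↦ ‖z‖) ν) : Integrable (fun p ↦ ‖p.1 - p.2‖) π := by
  rw [← h.fst_eq] at hμ
  rw [← h.snd_eq] at hν
  have h1 := hμ.comp_measurable measurable_fst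
  have h2 := hν.comp_measurable measurable_snd
  refine (h1.add h2).mono' (by fun_prop) (Filter.Eventually.of_forall fun p ↦ ?_)
  rw [norm_norm]
  exact norm_sub_le p.1 p.2

theorem IsOptimalCoupling.lintegral_eq {n : ℕ} {π : Measure (Vec n × Vec n)}
    {μ ν : Measure (Vec n)} (h : IsOptimalCoupling π μ ν) (hμ : Integrable (fun z ↦ ‖z‖) μ)
    (hν : Integrable (fun z ↦ ‖z‖) ν) :
    ∫⁻ p, ENNReal.ofReal ‖p.1 - p.2‖ ∂π = ENNReal.ofReal (kantorovich μ ν) := by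
  rw [← h.cost_eq, ofReal_integral_eq_lintegral_ofReal (h.integrable hμ hν)
    (Filter.Eventually.of_forall fun p ↦ norm_nonneg _)]

/-- Under the product of couplings each marginal realization satisfies stagewise growth almost
surely, so the pathwise Hausdorff bound holds almost surely and is integrated termwise. Only the
upper bound needs to be measurable. -/
theorem Regular.lintegral_hausdorffDist_le {M : Model} {T : ℕ} {c : Moduli}
    {P P' : (t : ℕ) → Measure (Vec (M.dZ t))} [∀ t, IsProbabilityMeasure (P t)]
    [∀ t, IsProbabilityMeasure (P' t)] {β : ℝ} (hR : Regular M T c) (hβ : 0 < β)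
    (hP : FiniteCost M T P) (hP' : FiniteCost M T P') (hG : M.Growth T P β)
    (hG' : M.Growth T P' β)
    (π : (t : ℕ) → Measure (Vec (M.dZ t) × Vec (M.dZ t))) [∀ t, IsProbabilityMeasure (π t)]
    (hπ : ∀ t ≤ T, IsOptimalCoupling (π t) (P t) (P' t)) :
    ∫⁻ ω, ENNReal.ofReal (Metric.hausdorffDist
        (M.optSet T P ω.1 (fun t ↦ (ω.2 t).1)) (M.optSet T P' ω.1 (fun t ↦ (ω.2 t).2)))
        ∂(M.exoLaw.prod (Measure.infinitePi π)) ≤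
      ENNReal.ofReal (c.solLip T β T *
        (∑ t ∈ Finset.range T, kantorovich (P t) (P' t) + costErr T c P P' 0)) := by
  have hexo : IsProbabilityMeasure M.exoLaw := by unfold Model.exoLaw; infer_instance
  have hK := hR.one_le_solLip hβ le_rfl
  have hE := hR.costErr_nonneg hP.moment hP'.moment 0
  have hfst : ∀ t, IsProbabilityMeasure ((π t).map Prod.fst) := fun t ↦
    Measure.isProbabilityMeasure_map measurable_fst.aemeasurable
  have hsnd : ∀ t, IsProbabilityMeasure ((π t).map Prod.snd) := fun t ↦
    Measure.isProbabilityMeasure_map measurable_snd.aemeasurable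
  have h1 := ae_law_of_map π _ (fun t ↦ measurable_fst) (fun t ↦ rfl)
    (hR.ae_pathGrowth hP hβ.le hG (Q := fun t ↦ (π t).map Prod.fst)
      fun t ht ↦ (hπ t ht.le).fst_eq.symm)
  have h2 := ae_law_of_map π _ (fun t ↦ measurable_snd) (fun t ↦ rfl)
    (hR.ae_pathGrowth hP' hβ.le hG' (Q := fun t ↦ (π t).map Prod.snd)
      fun t ht ↦ (hπ t ht.le).snd_eq.symm)
  calc _ ≤ ∫⁻ ω : M.ExoPath × ((t : ℕ) → Vec (M.dZ t) × Vec (M.dZ t)),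
        ENNReal.ofReal (c.solLip T β T) *
          (∑ t ∈ Finset.range T, ENNReal.ofReal ‖(ω.2 t).1 - (ω.2 t).2‖ +
            ENNReal.ofReal (costErr T c P P' 0)) ∂(M.exoLaw.prod (Measure.infinitePi π)) := by
        refine lintegral_mono_ae ?_
        filter_upwards [h1, h2] with ω hω hω'
        have h3 := hR.hausdorffDist_optSet_le hβ hP.moment hP'.moment
          (ω := (ω.1, fun t ↦ (ω.2 t).1)) (ω' := (ω.1, fun t ↦ (ω.2 t).2)) rfl hω hω'
        refine (ENNReal.ofReal_le_ofReal h3).trans_eq ?_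
        rw [ENNReal.ofReal_mul (by positivity),
          ENNReal.ofReal_add (Finset.sum_nonneg fun _ _ ↦ norm_nonneg _) hE,
          ENNReal.ofReal_sum_of_nonneg fun _ _ ↦ norm_nonneg _]
    _ = _ := by
        have hm : ∀ t, Measurable fun ω : M.ExoPath × ((t : ℕ) → Vec (M.dZ t) × Vec (M.dZ t)) ↦
            ENNReal.ofReal ‖(ω.2 t).1 - (ω.2 t).2‖ := fun t ↦ by fun_prop
        have hk : ∀ t ∈ Finset.range T, 0 ≤ kantorovich (P t) (P' t) := fun t ht ↦
          kantorovich_nonneg (hP.moment t (Finset.mem_range.1 ht).le)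
            (hP'.moment t (Finset.mem_range.1 ht).le)
        rw [lintegral_const_mul _ (by fun_prop), lintegral_add_right _ measurable_const,
          lintegral_finsetSum _ fun t _ ↦ hm t, ENNReal.ofReal_mul (by positivity),
          ENNReal.ofReal_add (Finset.sum_nonneg hk) hE, ENNReal.ofReal_sum_of_nonneg hk,
          lintegral_const, measure_univ, mul_one]
        congr 2
        refine Finset.sum_congr rfl fun t ht ↦ ?_
        have ht := (Finset.mem_range.1 ht).le
        have hmp : MeasurePreserving
            (fun ω : M.ExoPath × ((t : ℕ) → Vec (M.dZ t) × Vec (M.dZ t)) ↦ ω.2 t)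
            (M.exoLaw.prod (Measure.infinitePi π)) (π t) :=
          (measurePreserving_eval_infinitePi π t).comp measurePreserving_snd
        rw [← (hπ t ht).lintegral_eq (hP.moment t ht) (hP'.moment t ht)]
        exact hmp.lintegral_comp (f := fun p ↦ ENNReal.ofReal ‖p.1 - p.2‖) (by fun_prop)

end MspMdp

end

/-! ### The two stability estimates -/

theorem mainTheorem5 (T : ℕ) (c : MspMdp.Moduli) :
    (∀ (M : MspMdp.Model) (P P' : (t : ℕ) → MeasureTheory.Measure (MspMdp.Vec (M.dZ t)))
        [∀ t, MeasureTheory.IsProbabilityMeasure (P t)]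
        [∀ t, MeasureTheory.IsProbabilityMeasure (P' t)],
      MspMdp.Regular M T c → MspMdp.FiniteCost M T P → MspMdp.FiniteCost M T P' →
      |M.optVal T P - M.optVal T P'| ≤
        ∑ t ∈ Finset.range T, c.Lhat T (t + 1) * MspMdp.kantorovich (P t) (P' t) +
          c.maxC T * MspMdp.kantorovich (P T) (P' T)) ∧
    (∀ β : ℝ, 0 < β → ∃ (H : ℕ → ℝ) (LXX : ℕ → ℕ → ℝ),
      ∀ (M : MspMdp.Model) (P P' : (t : ℕ) → MeasureTheory.Measure (MspMdp.Vec (M.dZ t)))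
        [∀ t, MeasureTheory.IsProbabilityMeasure (P t)]
        [∀ t, MeasureTheory.IsProbabilityMeasure (P' t)],
      MspMdp.Regular M T c → MspMdp.FiniteCost M T P → MspMdp.FiniteCost M T P' →
      M.Growth T P β → M.Growth T P' β →
      ∀ (π : (t : ℕ) → MeasureTheory.Measure (MspMdp.Vec (M.dZ t) × MspMdp.Vec (M.dZ t)))
        [∀ t, MeasureTheory.IsProbabilityMeasure (π t)],
      (∀ t ≤ T, MspMdp.IsOptimalCoupling (π t) (P t) (P' t)) →
      ∫⁻ ω, ENNReal.ofReal (Metric.hausdorffDist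
          (M.optSet T P ω.1 (fun t ↦ (ω.2 t).1)) (M.optSet T P' ω.1 (fun t ↦ (ω.2 t).2)))
          ∂(M.exoLaw.prod (MeasureTheory.Measure.infinitePi π)) ≤
        ENNReal.ofReal (∑ t ∈ Finset.range (T + 1),
          (H t + ∑ k ∈ Finset.Icc (t + 1) T, LXX k t) * MspMdp.kantorovich (P t) (P' t))) := by
  constructor
  · intro M P P' _ _ hR hP hP'
    have h := hR.abs_optVal_sub_le hP.moment hP'.moment
    rwa [MspMdp.costErr, ← Finset.range_eq_Ico] at h
  · intro β hβ
    -- H carries the change of the costs to go, the second family the displacement of ζ_t. A single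
    -- term k = T already suffices for that displacement; for t = T the inner sum is empty, as ζ_T
    -- influences no decision.
    refine ⟨fun t ↦ c.solLip T β T * (if t < T then c.Lhat T (t + 1) else c.maxC T),
      fun _ _ ↦ c.solLip T β T, fun M P P' _ _ hR hP hP' hG hG' π _ hπ ↦ ?_⟩
    refine (hR.lintegral_hausdorffDist_le hβ hP hP' hG hG' π hπ).trans
      (ENNReal.ofReal_le_ofReal ?_)
    have hK := hR.one_le_solLip hβ le_rfl
    rw [MspMdp.costErr, ← Finset.range_eq_Ico, ← add_assoc, ← Finset.sum_add_distrib,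
      Finset.sum_range_succ, mul_add, Finset.mul_sum]
    refine add_le_add (Finset.sum_le_sum fun t ht ↦ ?_) (le_of_eq ?_)
    · have ht := Finset.mem_range.1 ht
      have hk := MspMdp.kantorovich_nonneg (hP.moment t ht.le) (hP'.moment t ht.le)
      have h1 : c.solLip T β T ≤ ∑ _k ∈ Finset.Icc (t + 1) T, c.solLip T β T :=
        Finset.single_le_sum (f := fun _ ↦ c.solLip T β T) (fun _ _ ↦ by positivity)
          (Finset.mem_Icc.2 ⟨ht, le_rfl⟩)
      simp only [if_pos ht]
      nlinarith [mul_le_mul_of_nonneg_right h1 hk]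
    · simp [mul_assoc]
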